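/- Setting. Let $(\mathsf Z,\mathcal Z)$ be a Polish space with its Borel $\sigma$-field, $d\ge 1$, $F:\mathbb R^d\times\mathsf Z\to\mathbb R$ measurable with $F(\cdot,z)$ differentiable for every $z$, $\pi$ a probability measure on $\mathsf Z$ with $F(x,\cdot)\in L^1(\pi)$ for every $x$, and $f(x)=\mathbb E_{Z\sim\pi}[F(x,Z)]$. Let $L,\mu>0$, $\sigma,\delta\ge 0$, and $\tau\in\mathbb N$ with $\tau\ge 1$. Assume: (i) $f$ is differentiable and $\|\nabla f(x)-\nabla f(y)\|\le L\|x-y\|$ for all $x,y$; (ii) $f$ is continuously differentiable and $\frac{\mu}{2}\|x-y\|^2\le f(x)-f(y)-\langle\nabla f(y),x-y\rangle$ for all $x,y$; (iii) $(Z_i)_{i\ge0}$ is a stationary Markov chain with Markov kernel $\mathrm Q$ and unique invariant distribution $\pi$, and $\sup_{z,z'}\frac12\|\mathrm Q^k(z,\cdot)-\mathrm Q^k(z',\cdot)\|_{\mathsf{TV}}\le(1/4)^{\lfloor k/\tau\rfloor}$ for all $k\in\mathbb N$; (iv) $\mathbb E_\pi[\nabla F(x,Z)]=\nabla f(x)$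 and $\|\nabla F(x,z)-\nabla f(x)\|^2\le\sigma^2+\delta^2\|\nabla f(x)\|^2$ for all $x,z$, where $\nabla F$ is the gradient in $x$. Let $x^*$ be the minimizer of $f$. Algorithm (randomized accelerated gradient descent). Given $\gamma,\theta,\eta,\beta,p,M,B$ and $x^0\in\mathbb R^d$, put $x^0_f=x^0$, $T^0=0$, let $J_0,J_1,\dots$ be i.i.d. with $\mathbb P(J_k=j)=2^{-j}$ for $j\ge1$, independent of the chain, and for $k=0,1,\dots,N-1$ let $$x^k_g=\theta x^k_f+(1-\theta)x^k,\qquad g^k_j=\frac1{2^jB}\sum_{i=1}^{2^jB}\nabla F(x^k_g,Z_{T^k+i}),\qquad g^k=g^k_0+\mathbf 1\{2^{J_k}\le M\}\,2^{J_k}\bigl(g^k_{J_k}-g^k_{J_k-1}\bigr),$$ $$x^{k+1}_f=x^k_g-p\gamma g^k,\qquad x^{k+1}=\eta x^{k+1}_f+(p-\eta)x^k_f+(1-p)(1-\beta)x^k+(1-p)\beta x^k_g,\qquad T^{k+1}=T^k+2^{J_k}B.$$ The number of oracle calls is the number of evaluations of $\nabla F$: iteration $k$ uses $2^{J_k}B$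 calls if $2^{J_k}\le M$ and $B$ calls otherwise. Parameters for a horizon $N\ge1$. Put $R=\|x^0-x^*\|^2+\frac6\mu(f(x^0)-f(x^*))$, $b=\tau$, $C_1=16(1+\frac1{\ln^2 4})$, $C_2=\frac{256}3$, and let $\gamma,p,\beta,\eta,\theta,M,B$ satisfy $$\gamma=\min\Bigl\{\frac3{4L};\ \frac{3}{p^2\mu N^2}\ln^2\Bigl(\max\Bigl\{2;\frac{\mu^2NR}{\sigma^2}\Bigr\}\Bigr)\Bigr\}\quad\Bigl(\gamma=\frac3{4L}\text{ if }\sigma=0\Bigr),$$ $$p=\Bigl[1+2(1+\gamma L)\bigl(1+4[C_1\tau b^{-1}+(C_1+1)\tau^2b^{-2}]\delta^2\bigr)\Bigr]^{-1},\quad \beta=\sqrt{\tfrac43p^2\mu\gamma},\quad \eta=\sqrt{\tfrac{3}{\mu\gamma}},\quad \theta=\frac{p\eta^{-1}-1}{\beta p\eta^{-1}-1},$$ $$M=\max\bigl\{2;\sqrt{C_2p^{-1}(1+2p/\beta)}\bigr\},\qquad B=\lceil b\log_2M\rceil.$$ Claim. There is a universal constant $C>0$ such that for all $L,\mu,\varepsilon>0$,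 $\sigma,\delta,R\ge0$ and $\tau\ge1$ there is a horizon $N\ge1$, depending only on these numbers, for which parameters as above exist and such that, for every choice of such parameters and every problem as above with these values of $L,\mu,\sigma,\delta,\tau$ and $R$, the algorithm satisfies $$\mathbb E\bigl[\|x^N-x^*\|^2\bigr]\le\varepsilon,$$ while the expected total number of oracle calls in the $N$ iterations is at most $$C\,\tau\Bigl[(1+\delta^2)\sqrt{\tfrac L\mu}\,\log\Bigl(2+\frac R\varepsilon\Bigr)+\frac{\sigma^2}{\mu^2\varepsilon}\Bigr]\cdot\log^3\Bigl(2+\delta^2+\frac L\mu+\frac{\sigma^2}{\mu^2\varepsilon}+\frac R\varepsilon\Bigr).$$ Thus the oracle complexity is $\tilde{\mathcal O}\bigl(\tau\bigl[(1+\delta^2)\sqrt{L/\mu}\,\log\frac1\varepsilon+\frac{\sigma^2}{\mu^2\varepsilon}\bigr]\bigr)$, linear in the mixing time $\tau$. -/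

import Mathlib

open MeasureTheory ProbabilityTheory

namespace MarkovASGD

noncomputable section

/-- `ℝ^d` with its Euclidean norm. -/
abbrev Vec (d : ℕ) := EuclideanSpace ℝ (Fin d)

/-! ### Regularity of the objective -/

/-- `f` is differentiable with `L`-Lipschitz gradient. -/
structure IsLSmooth {d : ℕ} (L : ℝ) (f : Vec d → ℝ) : Prop where
  differentiable : Differentiable ℝ f
  lipschitz : ∀ x y, ‖gradient f x - gradient f y‖ ≤ L * ‖x - y‖

/-- `f` is continuously differentiable and `μ`-strongly convex. -/
structure IsStronglyConvex {d : ℕ} (μ : ℝ) (f : Vec d → ℝ) : Prop where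
  contDiff : ContDiff ℝ 1 f
  lower_bound : ∀ x y,
    μ / 2 * ‖x - y‖ ^ 2 ≤ f x - f y - inner ℝ (gradient f y) (x - y)

/-! ### The Markov chain -/

instance isMarkovKernel_pow {Z : Type*} [MeasurableSpace Z] (Q : Kernel Z Z) [IsMarkovKernel Q]
    (k : ℕ) : IsMarkovKernel (Q ^ k) := by
  induction k with
  | zero =>
    rw [pow_zero]
    exact inferInstanceAs (IsMarkovKernel (Kernel.id : Kernel Z Z))
  | succ k ih =>
    rw [pow_succ]
    exact inferInstanceAs (IsMarkovKernel ((Q ^ k) ∘ₖ Q))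

/-- Total variation norm of the signed measure `ν₁ - ν₂`, i.e. the mass of its variation. -/
def tvNorm {Z : Type*} [MeasurableSpace Z] (ν₁ ν₂ : Measure Z) [IsFiniteMeasure ν₁]
    [IsFiniteMeasure ν₂] : ℝ :=
  (ν₁.toSignedMeasure - ν₂.toSignedMeasure).totalVariation.real Set.univ

/-- `Q` is uniformly geometrically ergodic with mixing time `τ`: for every `k`, the Dobrushin
coefficient of `Q ^ k` is at most `(1/4)^⌊k/τ⌋`. -/
def IsUniformlyErgodic {Z : Type*} [MeasurableSpace Z] (Q : Kernel Z Z) [IsMarkovKernel Q]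
    (τ : ℕ) : Prop :=
  ∀ k : ℕ, ∀ z z' : Z, (1 / 2) * tvNorm ((Q ^ k) z) ((Q ^ k) z') ≤ (1 / 4 : ℝ) ^ (k / τ)

/-- `Zs` is a Markov chain with transition kernel `Q` and initial law `π`: given `Zs 0, …, Zs n`,
the conditional law of `Zs (n + 1)` is `Q (Zs n)`. -/
structure IsMarkovChain {Z Ω : Type*} [MeasurableSpace Z] [MeasurableSpace Ω] (Q : Kernel Z Z)
    (π : Measure Z) (P : Measure Ω) (Zs : ℕ → Ω → Z) : Prop where
  measurable : ∀ n, Measurable (Zs n)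
  law_zero : P.map (Zs 0) = π
  transition : ∀ n : ℕ,
    HasCondDistrib (Zs (n + 1)) (fun ω (i : Fin (n + 1)) => Zs i ω)
      (Q.comap (fun h : Fin (n + 1) → Z => h (Fin.last n)) (measurable_pi_apply _)) P

/-- `Zs` is a stationary Markov chain with kernel `Q`, whose unique invariant distribution is `π`,
and `Q` is uniformly geometrically ergodic with mixing time `τ`. -/
structure IsErgodicNoise {Z Ω : Type*} [MeasurableSpace Z] [MeasurableSpace Ω] (Q : Kernel Z Z)
    [IsMarkovKernel Q] (π : Measure Z) (τ : ℕ) (P : Measure Ω) (Zs : ℕ → Ω → Z) : Prop where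
  invariant : Kernel.Invariant Q π
  unique : ∀ ν : Measure Z, IsProbabilityMeasure ν → Kernel.Invariant Q ν → ν = π
  chain : IsMarkovChain Q π P Zs
  ergodic : IsUniformlyErgodic Q τ

/-! ### The stochastic oracle -/

/-- The stochastic gradient `∇F(x, z)`, gradient with respect to `x`. -/
def gradF {d : ℕ} {Z : Type*} (F : Vec d → Z → ℝ) (x : Vec d) (z : Z) : Vec d :=
  gradient (fun y => F y z) x

/-- `f(x) = E_π F(x, Z)`, with `F(·, z)` differentiable. -/
structure IsExpectedRisk {d : ℕ} {Z : Type*} [MeasurableSpace Z] (π : Measure Z)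
    (F : Vec d → Z → ℝ) (f : Vec d → ℝ) : Prop where
  measurable : Measurable (Function.uncurry F)
  differentiable : ∀ z, Differentiable ℝ (fun x => F x z)
  integrable : ∀ x, Integrable (F x) π
  eq_integral : ∀ x, f x = ∫ z, F x z ∂π

/-- Unbiasedness under `π` and the uniform growth bound on the gradient noise. -/
structure HasBoundedNoise {d : ℕ} {Z : Type*} [MeasurableSpace Z] (π : Measure Z)
    (F : Vec d → Z → ℝ) (f : Vec d → ℝ) (σ δ : ℝ) : Prop where
  unbiased : ∀ x, ∫ z, gradF F x z ∂π = gradient f x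
  growth : ∀ x z, ‖gradF F x z - gradient f x‖ ^ 2 ≤ σ ^ 2 + δ ^ 2 * ‖gradient f x‖ ^ 2

/-- The batch levels `J 0, J 1, …` are i.i.d. geometric with parameter `1/2` on `{1, 2, …}` and
independent of the chain `Zs`. -/
structure IsBatchLevels {Z Ω : Type*} [MeasurableSpace Z] [MeasurableSpace Ω] (P : Measure Ω)
    (Zs : ℕ → Ω → Z) (J : ℕ → Ω → ℕ) : Prop where
  measurable : ∀ k, Measurable (J k)
  law : ∀ k j : ℕ, 1 ≤ j → P (J k ⁻¹' {j}) = (1 / 2) ^ j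
  iIndep : iIndepFun J P
  indep_chain : IndepFun (fun ω k => J k ω) (fun ω i => Zs i ω) P

/-! ### Randomized accelerated gradient descent -/

/-- Parameters of the method. -/
structure Params where
  γ : ℝ
  θ : ℝ
  η : ℝ
  β : ℝ
  p : ℝ
  M : ℝ
  B : ℕ

/-- Current points `x^k`, `x_f^k` and sample counter `T^k`. -/
structure State (d : ℕ) where
  x : Vec d
  xf : Vec d
  T : ℕ

/-- `x_g^k = θ x_f^k + (1 - θ) x^k`. -/
def State.xg {d : ℕ} (s : State d) (a : Params) : Vec d :=
  a.θ • s.xf + (1 - a.θ) • s.x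

/-- `g_j = 2^{-j} B^{-1} ∑_{i=1}^{2^j B} ∇F(x, z_{T+i})`. -/
def batchGrad {d : ℕ} {Z : Type*} (F : Vec d → Z → ℝ) (B : ℕ) (z : ℕ → Z) (T : ℕ) (x : Vec d)
    (j : ℕ) : Vec d :=
  ((2 : ℝ) ^ j * B)⁻¹ • ∑ i ∈ Finset.Icc 1 (2 ^ j * B), gradF F x (z (T + i))

/-- The multilevel gradient estimate at the point `x` for the batch level `j`. -/
def gradEst {d : ℕ} {Z : Type*} (F : Vec d → Z → ℝ) (a : Params) (z : ℕ → Z) (T : ℕ) (x : Vec d)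
    (j : ℕ) : Vec d :=
  batchGrad F a.B z T x 0 +
    if (2 : ℝ) ^ j ≤ a.M then
      (2 : ℝ) ^ j • (batchGrad F a.B z T x j - batchGrad F a.B z T x (j - 1))
    else 0

/-- One iteration, with chain trajectory `z` and batch level `j`. -/
def step {d : ℕ} {Z : Type*} (F : Vec d → Z → ℝ) (a : Params) (z : ℕ → Z) (j : ℕ)
    (s : State d) : State d :=
  let xg := s.xg a
  let xf' := xg - (a.p * a.γ) • gradEst F a z s.T xg j
  { x := a.η • xf' + (a.p - a.η) • s.xf + ((1 - a.p) * (1 - a.β)) • s.x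
      + ((1 - a.p) * a.β) • xg
    xf := xf'
    T := s.T + 2 ^ j * a.B }

/-- State after `k` iterations, started from `x^0 = x_f^0 = x₀`, `T^0 = 0`. -/
def run {d : ℕ} {Z : Type*} (F : Vec d → Z → ℝ) (a : Params) (x₀ : Vec d) (z : ℕ → Z)
    (j : ℕ → ℕ) : ℕ → State d
  | 0 => { x := x₀, xf := x₀, T := 0 }
  | k + 1 => step F a z (j k) (run F a x₀ z j k)

/-- Number of stochastic gradients evaluated in `N` iterations. An iteration with batch level `j`
evaluates `2^j B` of them if `2^j ≤ M`, and only the `B` needed for `g_0` otherwise. -/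
def oracleCalls (a : Params) (j : ℕ → ℕ) (N : ℕ) : ℕ :=
  ∑ k ∈ Finset.range N, if (2 : ℝ) ^ j k ≤ a.M then 2 ^ j k * a.B else a.B

/-! ### Choice of the parameters -/

/-- `16 (1 + 1 / ln² 4)`. -/
def C₁ : ℝ := 16 * (1 + 1 / Real.log 4 ^ 2)

/-- `256 / 3`. -/
def C₂ : ℝ := 256 / 3

/-- The stepsize for the horizon `N`; `R` is the initial error
`‖x⁰ - x*‖² + (6/μ)(f(x⁰) - f(x*))`. For `σ = 0` the logarithm is read as `+∞`. -/
def horizonStepsize (L μ σ R p : ℝ) (N : ℕ) : ℝ :=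
  if σ = 0 then 3 / (4 * L)
  else min (3 / (4 * L))
    (3 / (p ^ 2 * μ * (N : ℝ) ^ 2) * Real.log (max 2 (μ ^ 2 * N * R / σ ^ 2)) ^ 2)

/-- The coupled choice of `β, θ, η, p, M, B` for given `b` and `γ`. -/
structure IsAdmissible (L μ δ : ℝ) (τ b : ℕ) (a : Params) : Prop where
  γ_pos : 0 < a.γ
  γ_le : a.γ ≤ 3 / (4 * L)
  p_eq : a.p = (1 + 2 * (1 + a.γ * L) *
    (1 + 4 * (C₁ * τ * (b : ℝ)⁻¹ + (C₁ + 1) * (τ : ℝ) ^ 2 * ((b : ℝ) ^ 2)⁻¹) * δ ^ 2))⁻¹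
  β_eq : a.β = √(4 * a.p ^ 2 * μ * a.γ / 3)
  η_eq : a.η = √(3 / (μ * a.γ))
  θ_eq : a.θ = (a.p * a.η⁻¹ - 1) / (a.β * a.p * a.η⁻¹ - 1)
  M_eq : a.M = max 2 (√(C₂ * a.p⁻¹ * (1 + 2 * a.p / a.β)))
  B_eq : a.B = ⌈b * Real.logb 2 a.M⌉₊

/-- The parameters for the horizon `N`: `b = τ` and `γ` the horizon-dependent stepsize. -/
structure IsHorizonChoice (L μ σ δ R : ℝ) (τ N : ℕ) (a : Params) : Prop where
  admissible : IsAdmissible L μ δ τ τ a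
  γ_eq : a.γ = horizonStepsize L μ σ R a.p N

end

end MarkovASGD

namespace MarkovASGD

/-! ### Total variation and mixing of the chain -/

/-! The Lyapunov function `lyapunov` contracts in expectation by the factor `1 - β/2` per iteration,
up to a constant noise term. Three ingredients give this.

Mixing. Given the past, a function centred under `π` has, `i` steps later, conditional mean of
relative size at most `2 (1/4)^⌊i/τ⌋`. These weights sum to `O(τ)`. Hence a sum of `n` consecutive
noise vectors has correlation `O(τ)` with any vector determined by the past, whatever `n` is, and
second moment `O(τ n)`: `abs_integral_inner_noiseSum_le` and `integral_norm_noiseSum_sq_le`.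

Randomized batches. The levels are independent of the chain, so they can be frozen; sampling times
are then deterministic and the current state is a function of the observed trajectory. Averaging
over the newest level alone makes the multilevel correction telescope: the mean of the estimate is
the average over `2^m B` samples with `m = ⌊log₂ M⌋`, so the bias is `O(τ/(MB))`. Each of the `m`
levels adds `O(τ/B)` to the relative second moment, `O(1)` in total because `B ≥ τ m`. The mean
number of calls is nevertheless only `(m + 2^{-m}) B`.

Acceleration. For a gradient estimate with error `D`, `lyapunov_step_le` separates the linear and
quadratic effects of `D`, and `stateBound_add_le` turns the expected bias and variance into the
contraction. The value of `p`, of order `1/(1 + δ²)`, absorbs the multiplicative noise; the size of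
`M` absorbs the bias.

With `w = √(μγ/3)` one has `β/2 = p w`, and iteration bounds the error by `exp(-p w N) R + 2358 p w
σ²/μ²`. The stepsize makes either `w = 1/(2√(L/μ))`, or `p w N` equal to `log max(2, μ²NR/σ²)`; in
both cases `p w N` is at most this logarithm when `σ ≠ 0`. A horizon equal to the claimed bracket
times one logarithm makes each term at most `ε/2`. The expected cost is at most `4 N τ log₂² M`, and
`M` is polynomial in the problem data, which gives the cube of the logarithm. -/

theorem abs_integral_sub_integral_le_tvNorm {Z : Type*} [MeasurableSpace Z] (ν₁ ν₂ : Measure Z)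
    [IsFiniteMeasure ν₁] [IsFiniteMeasure ν₂] {φ : Z → ℝ} (hφ : Measurable φ) {A : ℝ}
    (hA : ∀ z, |φ z| ≤ A) : |∫ z, φ z ∂ν₁ - ∫ z, φ z ∂ν₂| ≤ A * tvNorm ν₁ ν₂ := by
  set s := ν₁.toSignedMeasure - ν₂.toSignedMeasure with hs
  set j := s.toJordanDecomposition with hj
  have hint : ∀ (ν : Measure Z) [IsFiniteMeasure ν], Integrable φ ν := fun ν _ =>
    Integrable.of_bound hφ.aestronglyMeasurable A (Filter.Eventually.of_forall hA)
  -- Moving the negative parts across the Jordan decomposition leaves an identity of positive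
  -- measures, against which `φ` can be integrated.
  have hmeas : ν₁ + j.negPart = ν₂ + j.posPart := by
    rw [← Measure.toSignedMeasure_eq_toSignedMeasure_iff, Measure.toSignedMeasure_add,
      Measure.toSignedMeasure_add]
    have h : s = j.posPart.toSignedMeasure - j.negPart.toSignedMeasure := by
      rw [← SignedMeasure.toSignedMeasure_toJordanDecomposition s,
        JordanDecomposition.toSignedMeasure]
    rw [hs] at h
    rw [add_comm ν₂.toSignedMeasure]
    exact sub_eq_sub_iff_add_eq_add.1 h
  have hsum : ∫ z, φ z ∂ν₁ + ∫ z, φ z ∂j.negPart = ∫ z, φ z ∂ν₂ + ∫ z, φ z ∂j.posPart := by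
    rw [← integral_add_measure (hint _) (hint _), hmeas,
      integral_add_measure (hint _) (hint _)]
  have hp := norm_integral_le_of_norm_le_const (μ := j.posPart) (f := φ) (C := A)
    (Filter.Eventually.of_forall hA)
  have hn := norm_integral_le_of_norm_le_const (μ := j.negPart) (f := φ) (C := A)
    (Filter.Eventually.of_forall hA)
  have htv : tvNorm ν₁ ν₂ = j.posPart.real Set.univ + j.negPart.real Set.univ := by
    rw [tvNorm, SignedMeasure.totalVariation, measureReal_add_apply]
  rw [Real.norm_eq_abs] at hp hn
  rw [htv, show ∫ z, φ z ∂ν₁ - ∫ z, φ z ∂ν₂ = ∫ z, φ z ∂j.posPart - ∫ z, φ z ∂j.negPart by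
    linarith, mul_add]
  exact (abs_sub _ _).trans (add_le_add hp hn)

theorem invariant_pow {Z : Type*} [MeasurableSpace Z] {Q : Kernel Z Z} {π : Measure Z}
    (h : Kernel.Invariant Q π) (k : ℕ) : Kernel.Invariant (Q ^ k) π := by
  induction k with
  | zero =>
    rw [pow_zero]
    exact Measure.id_comp
  | succ k ih =>
    rw [pow_succ]
    exact ih.comp h

/-- By invariance `Q^k φ` still has mean zero under `π`, so its value at `z` is the `π`-average over
`z'` of its differences between `z` and `z'`; mixing controls each of them. The factor 2 appears
because ergodicity bounds half the total variation norm. -/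
theorem abs_integral_pow_le {Z : Type*} [MeasurableSpace Z] {Q : Kernel Z Z} [IsMarkovKernel Q]
    {π : Measure Z} [IsProbabilityMeasure π] {τ : ℕ} (hinv : Kernel.Invariant Q π)
    (herg : IsUniformlyErgodic Q τ) {φ : Z → ℝ} (hφ : Measurable φ) {A : ℝ}
    (hA : ∀ z, |φ z| ≤ A) (hmean : ∫ z, φ z ∂π = 0) (k : ℕ) (z : Z) :
    |∫ z', φ z' ∂((Q ^ k) z)| ≤ 2 * (1 / 4 : ℝ) ^ (k / τ) * A := by
  have hA0 : 0 ≤ A := (abs_nonneg _).trans (hA z)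
  have hint : ∀ (ν : Measure Z) [IsFiniteMeasure ν], Integrable φ ν := fun ν _ =>
    Integrable.of_bound hφ.aestronglyMeasurable A (Filter.Eventually.of_forall hA)
  have hmeasQ : Measurable fun z' => ∫ y, φ y ∂((Q ^ k) z') :=
    (StronglyMeasurable.integral_kernel_prod_right (κ := Q ^ k) (f := fun _ y => φ y)
      (hφ.comp measurable_snd).stronglyMeasurable).measurable
  have hbdQ : ∀ z', |∫ y, φ y ∂((Q ^ k) z')| ≤ A := fun z' => by
    simpa using norm_integral_le_of_norm_le_const (μ := (Q ^ k) z') (f := φ) (C := A)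
      (Filter.Eventually.of_forall hA)
  have hintQ : Integrable (fun z' => ∫ y, φ y ∂((Q ^ k) z')) π :=
    Integrable.of_bound hmeasQ.aestronglyMeasurable A (Filter.Eventually.of_forall hbdQ)
  have h0 : ∫ z', (∫ y, φ y ∂((Q ^ k) z')) ∂π = 0 := by
    have h := Kernel.integral_comp (κ := Kernel.const Unit π) (η := Q ^ k) (a := ()) (f := φ)
      (hint _)
    rw [Kernel.comp_const, Kernel.const_apply, Kernel.const_apply, (invariant_pow hinv k).def,
      hmean] at h
    exact h.symm
  have hdiff : ∀ z', |∫ y, φ y ∂((Q ^ k) z) - ∫ y, φ y ∂((Q ^ k) z')|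
      ≤ 2 * (1 / 4 : ℝ) ^ (k / τ) * A := fun z' => by
    refine (abs_integral_sub_integral_le_tvNorm _ _ hφ hA).trans ?_
    have := herg k z z'
    nlinarith
  have heq : ∫ y, φ y ∂((Q ^ k) z)
      = ∫ z', (∫ y, φ y ∂((Q ^ k) z) - ∫ y, φ y ∂((Q ^ k) z')) ∂π := by
    rw [integral_sub (integrable_const _) hintQ, h0]
    simp
  rw [heq]
  simpa using norm_integral_le_of_norm_le_const (μ := π)
    (f := fun z' => ∫ y, φ y ∂((Q ^ k) z) - ∫ y, φ y ∂((Q ^ k) z'))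
    (Filter.Eventually.of_forall hdiff)

/-- The trajectory up to time `n`. -/
def past {Z Ω : Type*} (Zs : ℕ → Ω → Z) (n : ℕ) (ω : Ω) : Fin (n + 1) → Z := fun i => Zs i ω

theorem IsMarkovChain.measurable_past {Z Ω : Type*} [MeasurableSpace Z] [MeasurableSpace Ω]
    {Q : Kernel Z Z} {π : Measure Z} {P : Measure Ω} {Zs : ℕ → Ω → Z}
    (hc : IsMarkovChain Q π P Zs) (n : ℕ) : Measurable (past Zs n) :=
  measurable_pi_lambda _ fun i => hc.measurable i

theorem measurable_integral_kernel {W Z : Type*} [MeasurableSpace W] [MeasurableSpace Z]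
    (Q : Kernel Z Z) [IsMarkovKernel Q] {φ : W → Z → ℝ}
    (hφ : Measurable (Function.uncurry φ)) :
    Measurable (Function.uncurry fun w z => ∫ z', φ w z' ∂(Q z)) := by
  have h := StronglyMeasurable.integral_kernel_prod_right
    (κ := Q.comap (fun p : W × Z => p.2) measurable_snd) (f := fun p z' => φ p.1 z')
    (hφ.comp ((measurable_fst.comp measurable_fst).prodMk measurable_snd)).stronglyMeasurable
  exact h.measurable

theorem IsMarkovChain.integral_succ {Z Ω : Type*} [MeasurableSpace Z] [MeasurableSpace Ω]
    {Q : Kernel Z Z} [IsMarkovKernel Q] {π : Measure Z} {P : Measure Ω} [IsProbabilityMeasure P]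
    {Zs : ℕ → Ω → Z} (hc : IsMarkovChain Q π P Zs) (n : ℕ) {φ : (Fin (n + 1) → Z) → Z → ℝ}
    (hφ : Measurable (Function.uncurry φ)) {C : ℝ} (hC : ∀ w z, |φ w z| ≤ C) :
    ∫ ω, φ (past Zs n ω) (Zs (n + 1) ω) ∂P
      = ∫ ω, ∫ z, φ (past Zs n ω) z ∂(Q (Zs n ω)) ∂P := by
  have ht := (hc.transition n).map_eq
  have hpast := hc.measurable_past n
  have : IsProbabilityMeasure (P.map (past Zs n)) :=
    Measure.isProbabilityMeasure_map hpast.aemeasurable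
  calc ∫ ω, φ (past Zs n ω) (Zs (n + 1) ω) ∂P
      = ∫ x, Function.uncurry φ x ∂(P.map (fun ω => (past Zs n ω, Zs (n + 1) ω))) := by
        rw [integral_map (hpast.prodMk (hc.measurable _)).aemeasurable
          hφ.aestronglyMeasurable]
        rfl
    _ = ∫ x, Function.uncurry φ x ∂(P.map (past Zs n) ⊗ₘ
          Q.comap (fun h : Fin (n + 1) → Z => h (Fin.last n)) (measurable_pi_apply _)) := by
        exact congrArg (fun m => ∫ x, Function.uncurry φ x ∂m) ht
    _ = ∫ w, ∫ z, φ w z ∂(Q (w (Fin.last n))) ∂(P.map (past Zs n)) := by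
        rw [Measure.integral_compProd]
        · rfl
        · exact Integrable.of_bound hφ.aestronglyMeasurable C
            (Filter.Eventually.of_forall fun x => hC x.1 x.2)
    _ = _ := by
        rw [integral_map hpast.aemeasurable]
        · rfl
        · have hm := (measurable_integral_kernel Q hφ).comp
            (measurable_id.prodMk (measurable_pi_apply (Fin.last n)))
          exact hm.aestronglyMeasurable

/-- Chapman–Kolmogorov by induction on `i`. Integrating out the last transition replaces `φ` by its
`Q`-average in the second variable, which is again a bounded function of the same past; hence the
induction generalizes over `φ`. -/
theorem IsMarkovChain.integral_add {Z Ω : Type*} [MeasurableSpace Z] [MeasurableSpace Ω]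
    {Q : Kernel Z Z} [IsMarkovKernel Q] {π : Measure Z} {P : Measure Ω} [IsProbabilityMeasure P]
    {Zs : ℕ → Ω → Z} (hc : IsMarkovChain Q π P Zs) (n i : ℕ) {φ : (Fin (n + 1) → Z) → Z → ℝ}
    (hφ : Measurable (Function.uncurry φ)) {C : ℝ} (hC : ∀ w z, |φ w z| ≤ C) :
    ∫ ω, φ (past Zs n ω) (Zs (n + i) ω) ∂P
      = ∫ ω, ∫ z, φ (past Zs n ω) z ∂((Q ^ i) (Zs n ω)) ∂P := by
  induction i generalizing φ with
  | zero =>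
    refine integral_congr_ae (Filter.Eventually.of_forall fun ω => ?_)
    have hm : StronglyMeasurable (φ (past Zs n ω)) :=
      (hφ.comp measurable_prodMk_left).stronglyMeasurable
    change φ (past Zs n ω) (Zs n ω) = ∫ z, φ (past Zs n ω) z ∂((Q ^ 0) (Zs n ω))
    rw [pow_zero]
    change _ = ∫ z, φ (past Zs n ω) z ∂((Kernel.id : Kernel Z Z) (Zs n ω))
    rw [Kernel.id_apply, integral_dirac' _ _ hm]
  | succ i ih =>
    have hres : Measurable fun w : Fin (n + i + 1) → Z =>
        (fun l : Fin (n + 1) => w ⟨l, by omega⟩) :=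
      measurable_pi_lambda _ fun l => measurable_pi_apply _
    have h1 := hc.integral_succ (n + i)
      (φ := fun w z => φ (fun l : Fin (n + 1) => w ⟨l, by omega⟩) z)
      (hφ.comp ((hres.comp measurable_fst).prodMk measurable_snd)) (fun w z => hC _ z)
    have h2 := ih (φ := fun w z => ∫ z', φ w z' ∂(Q z)) (measurable_integral_kernel Q hφ)
      (fun w z => by
        simpa using norm_integral_le_of_norm_le_const (μ := Q z) (f := φ w)
          (Filter.Eventually.of_forall (hC w)))
    refine h1.trans (h2.trans ?_)
    refine integral_congr_ae (Filter.Eventually.of_forall fun ω => ?_)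
    change _ = ∫ z, φ (past Zs n ω) z ∂((Q ^ (i + 1)) (Zs n ω))
    have hm : Measurable (φ (past Zs n ω)) := hφ.comp measurable_prodMk_left
    rw [pow_succ']
    refine (Kernel.integral_comp (κ := Q ^ i) (η := Q) (a := Zs n ω) ?_).symm
    exact Integrable.of_bound hm.aestronglyMeasurable C
      (Filter.Eventually.of_forall fun z => hC _ z)

/-- Functionals of the past decorrelate geometrically from centred functions of the future. -/
theorem IsErgodicNoise.abs_integral_le {Z Ω : Type*} [MeasurableSpace Z] [MeasurableSpace Ω]
    {Q : Kernel Z Z} [IsMarkovKernel Q] {π : Measure Z} [IsProbabilityMeasure π] {τ : ℕ}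
    {P : Measure Ω} [IsProbabilityMeasure P] {Zs : ℕ → Ω → Z} (hn : IsErgodicNoise Q π τ P Zs)
    (n i : ℕ) {φ : (Fin (n + 1) → Z) → Z → ℝ} (hφ : Measurable (Function.uncurry φ))
    {A : (Fin (n + 1) → Z) → ℝ} (hA : Measurable A) (hφA : ∀ w z, |φ w z| ≤ A w)
    {C : ℝ} (hC : ∀ w, A w ≤ C) (hmean : ∀ w, ∫ z, φ w z ∂π = 0) :
    |∫ ω, φ (past Zs n ω) (Zs (n + i) ω) ∂P|
      ≤ 2 * (1 / 4 : ℝ) ^ (i / τ) * ∫ ω, A (past Zs n ω) ∂P := by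
  rw [hn.chain.integral_add n i hφ (fun w z => (hφA w z).trans (hC w)), ← integral_const_mul]
  have hA0 : ∀ ω, 0 ≤ A (past Zs n ω) := fun ω => (abs_nonneg _).trans (hφA _ (Zs 0 ω))
  rw [← Real.norm_eq_abs]
  refine norm_integral_le_of_norm_le (g := fun ω => 2 * (1 / 4 : ℝ) ^ (i / τ) * A (past Zs n ω))
    ?_ (Filter.Eventually.of_forall fun ω => ?_)
  · refine Integrable.const_mul ?_ _
    refine Integrable.of_bound (hA.comp (hn.chain.measurable_past n)).aestronglyMeasurable C
      (Filter.Eventually.of_forall fun ω => ?_)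
    rw [Real.norm_of_nonneg (hA0 ω)]
    exact hC _
  · exact abs_integral_pow_le hn.invariant hn.ergodic (hφ.comp measurable_prodMk_left)
      (hφA _) (hmean _) i _

/-! ### The deterministic part of the analysis -/

/-- Along the segment, the gap between `f` and its quadratic model has nonpositive derivative for `t
≥ 0`, by Cauchy–Schwarz and the Lipschitz bound. -/
theorem IsLSmooth.le_quadratic {d : ℕ} {L : ℝ} {f : Vec d → ℝ} (h : IsLSmooth L f)
    (x y : Vec d) : f y ≤ f x + inner ℝ (gradient f x) (y - x) + L / 2 * ‖y - x‖ ^ 2 := by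
  set v := y - x with hv
  let φ : ℝ → ℝ := fun t => f (x + t • v) - t * inner ℝ (gradient f x) v - L / 2 * t ^ 2 * ‖v‖ ^ 2
  have hline : ∀ t : ℝ, HasDerivAt (fun t : ℝ => x + t • v) v t := fun t => by
    simpa using ((hasDerivAt_id t).smul_const v).const_add x
  have hφ : ∀ t, HasDerivAt φ (inner ℝ (gradient f (x + t • v)) v - inner ℝ (gradient f x) v
      - L * t * ‖v‖ ^ 2) t := fun t => by
    have h1 : HasDerivAt (fun t : ℝ => f (x + t • v)) (inner ℝ (gradient f (x + t • v)) v) t := by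
      have := ((h.differentiable (x + t • v)).hasGradientAt.hasFDerivAt).comp_hasDerivAt t (hline t)
      exact this.congr_deriv (by simp)
    have h2 : HasDerivAt (fun t : ℝ => t * inner ℝ (gradient f x) v)
        (inner ℝ (gradient f x) v) t := by
      simpa using (hasDerivAt_id t).mul_const (inner ℝ (gradient f x) v)
    have h3 : HasDerivAt (fun t : ℝ => L / 2 * t ^ 2 * ‖v‖ ^ 2) (L * t * ‖v‖ ^ 2) t := by
      have := (((hasDerivAt_id t).pow 2).const_mul (L / 2)).mul_const (‖v‖ ^ 2)
      refine this.congr_deriv ?_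
      simp only [id_eq, Nat.cast_ofNat, Nat.add_one_sub_one, pow_one, mul_one]
      ring
    exact (h1.sub h2).sub h3
  have hanti : AntitoneOn φ (Set.Ici 0) := by
    refine antitoneOn_of_deriv_nonpos (convex_Ici 0)
      (fun t _ => (hφ t).continuousAt.continuousWithinAt)
      (fun t _ => (hφ t).differentiableAt.differentiableWithinAt) (fun t ht => ?_)
    rw [interior_Ici] at ht
    rw [(hφ t).deriv, ← inner_sub_left]
    have h1 := real_inner_le_norm (gradient f (x + t • v) - gradient f x) v
    have h2 := h.lipschitz (x + t • v) x
    rw [add_sub_cancel_left, norm_smul, Real.norm_of_nonneg (le_of_lt ht)] at h2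
    have h3 := mul_le_mul_of_nonneg_right h2 (norm_nonneg v)
    nlinarith
  have h01 := hanti (Set.mem_Ici.2 le_rfl) (Set.mem_Ici.2 zero_le_one) zero_le_one
  simp only [φ, one_smul, zero_smul, add_zero, hv, add_sub_cancel] at h01
  simp only [hv]
  linarith

/-- The quadratic lower and upper bounds are compared at a nonzero vector, which exists because `d >
0`. This makes the case `L < μ` of the main theorem vacuous. -/
theorem le_of_isStronglyConvex_of_isLSmooth {d : ℕ} (hd : 0 < d) {L μ : ℝ} {f : Vec d → ℝ}
    (hs : IsLSmooth L f) (hc : IsStronglyConvex μ f) : μ ≤ L := by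
  have : Nonempty (Fin d) := ⟨⟨0, hd⟩⟩
  obtain ⟨x, hx⟩ := exists_ne (0 : Vec d)
  have h1 := hs.le_quadratic 0 x
  have h2 := hc.lower_bound x 0
  have h3 : 0 < ‖x - 0‖ ^ 2 := by
    rw [sub_zero]
    exact pow_pos (norm_pos_iff.2 hx) 2
  nlinarith

/-- The relations between the step parameters used in the convergence analysis. -/
structure IsCoupled (μ : ℝ) (a : Params) : Prop where
  γ_pos : 0 < a.γ
  p_pos : 0 < a.p
  β_pos : 0 < a.β
  β_le : a.β ≤ 1
  p_le_η : a.p ≤ a.η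
  β_mul_η : a.β * a.η = 2 * a.p
  η_sq : a.η ^ 2 * μ * a.γ = 3
  θ_mul : a.θ * (a.η - a.p * a.β) = a.η - a.p

/-- The momentum average `(1 - β) x + β x_g`. -/
noncomputable def State.avg {d : ℕ} (s : State d) (a : Params) : Vec d :=
  (1 - a.β) • s.x + a.β • s.xg a

/-- The Lyapunov function `‖x - x*‖² + (6/μ) (f(x_f) - f(x*))`. -/
noncomputable def lyapunov {d : ℕ} (μ : ℝ) (f : Vec d → ℝ) (xs : Vec d) (s : State d) : ℝ :=
  ‖s.x - xs‖ ^ 2 + 6 / μ * (f s.xf - f xs)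

/-- The direction against which the error of the gradient estimate enters linearly. -/
noncomputable def errorDir {d : ℕ} (μ : ℝ) (f : Vec d → ℝ) (xs : Vec d) (a : Params) (s : State d) : Vec d :=
  (2 * a.η * a.p * a.γ) • (s.avg a - xs) + (6 / μ * (a.p * a.γ)) • gradient f (s.xg a)

/-- The weight of the squared norm of the gradient estimate. -/
noncomputable def quadWeight (L : ℝ) (a : Params) : ℝ := a.η ^ 2 * a.p ^ 2 * a.γ ^ 2 * (1 + L * a.γ)

/-- The part of the one-step bound which only depends on the current state. -/
noncomputable def stateBound {d : ℕ} (L μ : ℝ) (f : Vec d → ℝ) (xs : Vec d) (a : Params) (s : State d) : ℝ :=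
  ‖s.avg a - xs‖ ^ 2 - 2 * a.η * a.p * a.γ * inner ℝ (gradient f (s.xg a)) (s.avg a - xs)
    + 2 * quadWeight L a * ‖gradient f (s.xg a)‖ ^ 2
    + 6 / μ * (f (s.xg a) - f xs - a.p * a.γ * ‖gradient f (s.xg a)‖ ^ 2)

/-- This identity is the purpose of the formula for `θ`: it expresses the momentum average through
`x_g` and `x_f` alone. -/
theorem IsCoupled.smul_avg {d : ℕ} {μ : ℝ} {a : Params} (ha : IsCoupled μ a) (s : State d) :
    a.p • s.avg a = a.η • s.xg a + (a.p - a.η) • s.xf := by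
  have h1 : a.η * a.θ + (a.p - a.η) = a.p * a.β * a.θ := by linarith [ha.θ_mul]
  have h2 : a.η * (1 - a.θ) = a.p * (1 - a.β) + a.p * a.β * (1 - a.θ) := by linarith [ha.θ_mul]
  have e1 : a.η • s.xg a + (a.p - a.η) • s.xf
      = (a.η * a.θ + (a.p - a.η)) • s.xf + (a.η * (1 - a.θ)) • s.x := by
    simp only [State.xg]; module
  rw [e1, h1, h2]
  simp only [State.avg, State.xg]
  module

/-- In the update, `η x_g + (p - η) x_f` equals `p` times the momentum average and the remaining
terms equal `1 - p` times it. The four-term update is thus one gradient step from the average, whose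
squared distance to `x*` expands exactly. -/
theorem step_x_eq {d : ℕ} {Z : Type*} {μ : ℝ} {a : Params} (ha : IsCoupled μ a)
    (F : Vec d → Z → ℝ) (z : ℕ → Z) (j : ℕ) (s : State d) :
    (step F a z j s).x = s.avg a - (a.η * a.p * a.γ) • gradEst F a z s.T (s.xg a) j := by
  have h := ha.smul_avg s
  have e : (step F a z j s).x = (a.η • s.xg a + (a.p - a.η) • s.xf) + (1 - a.p) • s.avg a
      - (a.η * a.p * a.γ) • gradEst F a z s.T (s.xg a) j := by
    simp only [step, State.avg]; module
  rw [e, ← h]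
  module

/-- The squared distance is expanded and the descent inequality is applied to `x_f`. Terms linear in
`D` are kept exact, since only their mean will be small; quadratic ones are split by `‖v + D‖² ≤
2‖v‖² + 2‖D‖²`. -/
theorem lyapunov_step_le {d : ℕ} {Z : Type*} {L μ : ℝ} (hL : 0 < L) (hμ : 0 < μ) {a : Params}
    (ha : IsCoupled μ a) {f : Vec d → ℝ} (hs : IsLSmooth L f) (xs : Vec d)
    (F : Vec d → Z → ℝ) (z : ℕ → Z) (j : ℕ) (s : State d) {D : Vec d}
    (hD : gradEst F a z s.T (s.xg a) j = gradient f (s.xg a) + D) :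
    lyapunov μ f xs (step F a z j s) ≤
      stateBound L μ f xs a s - inner ℝ D (errorDir μ f xs a s)
        + 2 * quadWeight L a * ‖D‖ ^ 2 := by
  set v := gradient f (s.xg a) with hv
  set y := s.avg a with hy
  have hx : (step F a z j s).x = y - (a.η * a.p * a.γ) • (v + D) := by
    rw [step_x_eq ha, hD]
  have hxf : (step F a z j s).xf = s.xg a - (a.p * a.γ) • (v + D) := by
    simp only [step, hD]
  have hf := hs.le_quadratic (s.xg a) ((step F a z j s).xf)
  rw [hxf, sub_sub_cancel_left, inner_neg_right, norm_neg, inner_smul_right, norm_smul, mul_pow,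
    Real.norm_eq_abs, sq_abs, ← hv, inner_add_right, real_inner_self_eq_norm_sq] at hf
  have hnorm : ‖y - (a.η * a.p * a.γ) • (v + D) - xs‖ ^ 2 = ‖y - xs‖ ^ 2
      - 2 * (a.η * a.p * a.γ) * (inner ℝ v (y - xs) + inner ℝ D (y - xs))
      + (a.η * a.p * a.γ) ^ 2 * ‖v + D‖ ^ 2 := by
    rw [sub_right_comm, norm_sub_sq_real, inner_smul_right, norm_smul, mul_pow, Real.norm_eq_abs,
      sq_abs, real_inner_comm, inner_add_left]
    ring
  have hdir : inner ℝ D (errorDir μ f xs a s) = 2 * a.η * a.p * a.γ * inner ℝ D (y - xs)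
      + 6 / μ * (a.p * a.γ) * inner ℝ v D := by
    rw [errorDir, inner_add_right, inner_smul_right, inner_smul_right, real_inner_comm v D]
  have hsq : ‖v + D‖ ^ 2 ≤ 2 * ‖v‖ ^ 2 + 2 * ‖D‖ ^ 2 := by
    have h1 := parallelogram_law_with_norm ℝ v D
    nlinarith [sq_nonneg ‖v - D‖]
  -- With this value of `6/μ`, the quadratic coefficients from the distance and from the function
  -- value add up to `quadWeight`.
  have h6 : 6 / μ = 2 * a.η ^ 2 * a.γ := by
    rw [div_eq_iff hμ.ne']; linarith [ha.η_sq]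
  have hq : 0 ≤ quadWeight L a := by
    have := ha.γ_pos
    unfold quadWeight; positivity
  have hmul := mul_le_mul_of_nonneg_left hf (show 0 ≤ 6 / μ by positivity)
  have hq' := mul_le_mul_of_nonneg_left hsq hq
  have hqe : quadWeight L a = (a.η * a.p * a.γ) ^ 2 + 6 / μ * (L / 2 * (a.p * a.γ) ^ 2) := by
    rw [h6, quadWeight]; ring
  have hlast : quadWeight L a * ‖v + D‖ ^ 2
      = (a.η * a.p * a.γ) ^ 2 * ‖v + D‖ ^ 2
        + 6 / μ * (L / 2 * (a.p * a.γ) ^ 2) * ‖v + D‖ ^ 2 := by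
    rw [hqe]; ring
  rw [lyapunov, hx, hxf, hnorm, hdir, stateBound, ← hv, ← hy]
  linarith

/-- Here `e S` bounds the bias and `V S²` the second moment of the gradient error. Strong convexity
at `x_g`, against `x_f` with weight `η - p` and against `x*` with weight `p`, bounds the inner
product in `stateBound`. Young's inequality pays for the bias with `β/2` of the contraction and one
of the two units of `-‖v‖²` supplied by the descent. The other unit pays for the variance, by the
hypothesis on `p`. -/
theorem stateBound_add_le {d : ℕ} {L μ σ δ V e S : ℝ} (hμ : 0 < μ) {a : Params}
    (ha : IsCoupled μ a) {f : Vec d → ℝ} (hc : IsStronglyConvex μ f) (xs : Vec d)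
    (s : State d)
    (hS0 : 0 ≤ S) (hS : S ^ 2 = σ ^ 2 + δ ^ 2 * ‖gradient f (s.xg a)‖ ^ 2)
    (he0 : 0 ≤ e) (he : e ^ 2 * (1 + 2 * a.p / a.β) ≤ a.p / 3)
    (hp : a.p * (2 * (1 + L * a.γ) + δ ^ 2 * (1 / 3 + 2 * (1 + L * a.γ) * V)) ≤ 1) :
    stateBound L μ f xs a s + e * (S * ‖errorDir μ f xs a s‖) + 2 * quadWeight L a * (V * S ^ 2) ≤
      (1 - a.β / 2) * lyapunov μ f xs s
        + a.η ^ 2 * a.γ ^ 2 * a.p ^ 2 * (1 / 3 + 2 * (1 + L * a.γ) * V) * σ ^ 2 := by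
  have hγ := ha.γ_pos
  have hp0 := ha.p_pos
  have hβ := ha.β_pos
  have hη : 0 < a.η := hp0.trans_le ha.p_le_η
  have h6 : 6 / μ = 2 * a.η ^ 2 * a.γ := by
    rw [div_eq_iff hμ.ne']; linarith [ha.η_sq]
  set v := gradient f (s.xg a) with hv
  set y := s.avg a with hy
  have hdir : ‖errorDir μ f xs a s‖ ≤ 2 * a.η * a.p * a.γ * ‖y - xs‖
      + 2 * a.η ^ 2 * a.γ ^ 2 * a.p * ‖v‖ := by
    refine (norm_add_le _ _).trans (le_of_eq ?_)
    rw [norm_smul, norm_smul, Real.norm_of_nonneg (by positivity),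
      Real.norm_of_nonneg (by positivity), h6]
    ring
  have hconv : ‖y - xs‖ ^ 2 ≤ (1 - a.β) * ‖s.x - xs‖ ^ 2 + a.β * ‖s.xg a - xs‖ ^ 2 := by
    have e1 : y - xs = (1 - a.β) • (s.x - xs) + a.β • (s.xg a - xs) := by
      simp only [hy, State.avg]; module
    have h1 : ‖y - xs‖ ≤ (1 - a.β) * ‖s.x - xs‖ + a.β * ‖s.xg a - xs‖ := by
      rw [e1]
      refine (norm_add_le _ _).trans (le_of_eq ?_)
      rw [norm_smul, norm_smul, Real.norm_of_nonneg (by linarith [ha.β_le]),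
        Real.norm_of_nonneg hβ.le]
    have h2 : ‖y - xs‖ ^ 2 ≤ ((1 - a.β) * ‖s.x - xs‖ + a.β * ‖s.xg a - xs‖) ^ 2 := by gcongr
    linarith [mul_nonneg (mul_nonneg hβ.le (sub_nonneg.2 ha.β_le))
      (sq_nonneg (‖s.x - xs‖ - ‖s.xg a - xs‖))]
  have hinner : a.p * inner ℝ v (y - xs)
      = (a.η - a.p) * inner ℝ v (s.xg a - s.xf) + a.p * inner ℝ v (s.xg a - xs) := by
    have e1 : a.p • (y - xs) = (a.η - a.p) • (s.xg a - s.xf) + a.p • (s.xg a - xs) := by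
      rw [smul_sub, ha.smul_avg]; module
    rw [← inner_smul_right, e1, inner_add_right, inner_smul_right, inner_smul_right]
  have hsc1 := hc.lower_bound s.xf (s.xg a)
  have hsc2 := hc.lower_bound xs (s.xg a)
  rw [← hv, ← neg_sub (s.xg a), inner_neg_right, norm_neg] at hsc1 hsc2
  have hi1 : f (s.xg a) - f s.xf ≤ inner ℝ v (s.xg a - s.xf) := by
    have : 0 ≤ μ / 2 * ‖s.xg a - s.xf‖ ^ 2 := by positivity
    linarith
  have hi2 : f (s.xg a) - f xs + μ / 2 * ‖s.xg a - xs‖ ^ 2 ≤ inner ℝ v (s.xg a - xs) := by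
    linarith
  have hi : (a.η - a.p) * (f (s.xg a) - f s.xf)
      + a.p * (f (s.xg a) - f xs + μ / 2 * ‖s.xg a - xs‖ ^ 2) ≤ a.p * inner ℝ v (y - xs) := by
    rw [hinner]
    exact add_le_add (mul_le_mul_of_nonneg_left hi1 (sub_nonneg.2 ha.p_le_η))
      (mul_le_mul_of_nonneg_left hi2 hp0.le)
  have hi' := mul_le_mul_of_nonneg_left hi (show 0 ≤ 2 * a.η * a.γ by positivity)
  -- Strong convexity against `x*` thus yields exactly `(3β/2)‖x_g - x*‖²`: a share `β` cancels the
  -- term from the convexity of the squared norm, a share `β/2` the one from Young's inequality.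
  have hG : a.η * a.γ * a.p * μ = 3 * a.β / 2 := by
    have h1 := ha.η_sq
    have h2 := ha.β_mul_η
    have : a.η * (a.η * a.γ * a.p * μ) = a.η * (3 * a.β / 2) := by
      calc a.η * (a.η * a.γ * a.p * μ) = (a.η ^ 2 * μ * a.γ) * a.p := by ring
        _ = a.η * (3 * a.β / 2) := by rw [h1]; linarith
    exact mul_left_cancel₀ hη.ne' this
  -- the two Young inequalities for the bias
  have hy1 : e * S * (2 * a.η * a.p * a.γ * ‖y - xs‖)
      ≤ a.β / 2 * ‖y - xs‖ ^ 2 + a.η ^ 2 * a.γ ^ 2 * a.p * (e ^ 2 * (2 * a.p / a.β) * S ^ 2) := by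
    have h : 0 ≤ (a.β * ‖y - xs‖ - 2 * a.η * a.p * a.γ * (e * S)) ^ 2 / (2 * a.β) := by positivity
    have e1 : (a.β * ‖y - xs‖ - 2 * a.η * a.p * a.γ * (e * S)) ^ 2 / (2 * a.β)
        = a.β / 2 * ‖y - xs‖ ^ 2 + a.η ^ 2 * a.γ ^ 2 * a.p * (e ^ 2 * (2 * a.p / a.β) * S ^ 2)
          - e * S * (2 * a.η * a.p * a.γ * ‖y - xs‖) := by
      field_simp
      ring
    linarith
  have hy2 : e * S * (2 * a.η ^ 2 * a.γ ^ 2 * a.p * ‖v‖)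
      ≤ a.η ^ 2 * a.γ ^ 2 * a.p * (‖v‖ ^ 2 + e ^ 2 * S ^ 2) := by
    have h : 0 ≤ a.η ^ 2 * a.γ ^ 2 * a.p * (‖v‖ - e * S) ^ 2 := by positivity
    linarith
  have hbias : e * (S * ‖errorDir μ f xs a s‖) ≤ a.β / 2 * ‖y - xs‖ ^ 2
      + a.η ^ 2 * a.γ ^ 2 * a.p * (‖v‖ ^ 2 + e ^ 2 * (1 + 2 * a.p / a.β) * S ^ 2) := by
    have h := mul_le_mul_of_nonneg_left hdir (mul_nonneg he0 hS0)
    rw [mul_add] at h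
    linarith
  have hyb : a.β / 2 * ‖y - xs‖ ^ 2 ≤ a.β / 2 * (‖s.x - xs‖ ^ 2 + ‖s.xg a - xs‖ ^ 2) := by
    refine mul_le_mul_of_nonneg_left (hconv.trans ?_) (by positivity)
    have h1 := mul_nonneg hβ.le (sq_nonneg ‖s.x - xs‖)
    have h2 := mul_nonneg (sub_nonneg.2 ha.β_le) (sq_nonneg ‖s.xg a - xs‖)
    linarith
  have hS2 : e ^ 2 * (1 + 2 * a.p / a.β) * S ^ 2 ≤ a.p / 3 * S ^ 2 :=
    mul_le_mul_of_nonneg_right he (sq_nonneg S)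
  -- All gradient and noise terms, in units of `η²γ²p`: bias, variance, then the descent term
  -- `-2‖v‖²`.
  have hfin : ‖v‖ ^ 2 + a.p / 3 * S ^ 2 + 2 * a.p * (1 + L * a.γ) * (‖v‖ ^ 2 + V * S ^ 2)
      - 2 * ‖v‖ ^ 2 ≤ a.p * (1 / 3 + 2 * (1 + L * a.γ) * V) * σ ^ 2 := by
    rw [hS]
    linarith [mul_le_mul_of_nonneg_right hp (sq_nonneg ‖v‖)]
  have hfin' := mul_le_mul_of_nonneg_left hfin
    (show 0 ≤ a.η ^ 2 * a.γ ^ 2 * a.p by positivity)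
  have hbias' := mul_le_mul_of_nonneg_left hS2
    (show 0 ≤ a.η ^ 2 * a.γ ^ 2 * a.p by positivity)
  have hβη : a.η ^ 2 * a.γ * a.β = 2 * a.η * a.γ * a.p := by
    linear_combination (a.η * a.γ) * ha.β_mul_η
  have hGt : 2 * a.η * a.γ * (a.p * (μ / 2 * ‖s.xg a - xs‖ ^ 2))
      = 3 * a.β / 2 * ‖s.xg a - xs‖ ^ 2 := by
    rw [← hG]; ring
  -- The coefficient left on `f(x_f) - f(x*)` is exactly the contracted Lyapunov weight; this fixes
  -- `βη = 2p`.
  have hL1 : 6 / μ * (1 - a.β / 2) = 2 * a.η * a.γ * (a.η - a.p) := by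
    rw [h6]; linear_combination (-1 : ℝ) * hβη
  have hL2 : (1 - a.β / 2) * lyapunov μ f xs s = (1 - a.β / 2) * ‖s.x - xs‖ ^ 2
      + 2 * a.η * a.γ * (a.η - a.p) * (f s.xf - f xs) := by
    rw [lyapunov, ← hL1]; ring
  rw [hL2, stateBound, ← hv, ← hy, h6, quadWeight]
  linarith

/-! ### Averages of centred functions along the chain -/

/-- The exponent is constant on blocks of length `τ`, so the sum is at most `2τ` times the geometric
series of ratio `1/4`, whose value is `4/3`. -/
theorem sum_range_geometric_div_le {τ : ℕ} (hτ : 1 ≤ τ) (n : ℕ) :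
    ∑ k ∈ Finset.range n, 2 * (1 / 4 : ℝ) ^ (k / τ) ≤ 8 / 3 * τ := by
  have hblock : ∀ q : ℕ, ∑ k ∈ Finset.range (τ * q), (1 / 4 : ℝ) ^ (k / τ)
      = τ * ∑ r ∈ Finset.range q, (1 / 4 : ℝ) ^ r := by
    intro q
    induction q with
    | zero => simp
    | succ q ih =>
      rw [Nat.mul_succ, Finset.sum_range_add, ih, Finset.sum_range_succ, mul_add]
      congr 1
      rw [Finset.sum_congr rfl (g := fun _ => (1 / 4 : ℝ) ^ q)]
      · simp
      · intro k hk
        rw [Nat.mul_add_div (by omega), Nat.div_eq_of_lt (Finset.mem_range.1 hk), add_zero]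
  have hgeom : ∑ r ∈ Finset.range n, (1 / 4 : ℝ) ^ r ≤ 4 / 3 := by
    rw [geom_sum_eq (by norm_num)]
    have : (0 : ℝ) ≤ (1 / 4) ^ n := by positivity
    rw [div_le_iff_of_neg (by norm_num)]
    linarith
  rw [← Finset.mul_sum]
  have h1 : ∑ k ∈ Finset.range n, (1 / 4 : ℝ) ^ (k / τ)
      ≤ ∑ k ∈ Finset.range (τ * n), (1 / 4 : ℝ) ^ (k / τ) :=
    Finset.sum_le_sum_of_subset_of_nonneg
      (Finset.range_mono (Nat.le_mul_of_pos_left n (by omega))) fun _ _ _ => by positivity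
  rw [hblock] at h1
  have h2 : (τ : ℝ) * ∑ r ∈ Finset.range n, (1 / 4 : ℝ) ^ r ≤ τ * (4 / 3) :=
    mul_le_mul_of_nonneg_left hgeom (by positivity)
  linarith

/-- A function of the past up to time `t` and of one further observation, centred under `π` in the
last variable and dominated by a bounded function `S` of the past. -/
structure IsCentredNoise {Z : Type*} [MeasurableSpace Z] {d t : ℕ} (π : Measure Z)
    (G : (Fin (t + 1) → Z) → Z → Vec d) (S : (Fin (t + 1) → Z) → ℝ) (C : ℝ) : Prop where
  measurable : Measurable (Function.uncurry G)
  measurable_bound : Measurable S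
  norm_le : ∀ w z, ‖G w z‖ ≤ S w
  nonneg : ∀ w, 0 ≤ S w
  bound_le : ∀ w, S w ≤ C
  mean : ∀ w, ∫ z, G w z ∂π = 0

section Averages

set_option linter.unusedSectionVars false

variable {Z Ω : Type*} [MeasurableSpace Z] [MeasurableSpace Ω]
  {Q : Kernel Z Z} [IsMarkovKernel Q] {π : Measure Z} [IsProbabilityMeasure π] {τ : ℕ}
  {P : Measure Ω} [IsProbabilityMeasure P] {Zs : ℕ → Ω → Z} {d t : ℕ}
  {G : (Fin (t + 1) → Z) → Z → Vec d} {S : (Fin (t + 1) → Z) → ℝ} {C : ℝ}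

theorem IsCentredNoise.integral_inner_eq_zero (hG : IsCentredNoise π G S C)
    (w : Fin (t + 1) → Z) (h : Vec d) : ∫ z, inner ℝ h (G w z) ∂π = 0 := by
  have hi : Integrable (G w) π :=
    Integrable.of_bound (hG.measurable.comp measurable_prodMk_left).aestronglyMeasurable (S w)
      (Filter.Eventually.of_forall fun z => hG.norm_le w z)
  rw [integral_inner hi, hG.mean, inner_zero_right]

theorem IsCentredNoise.measurable_at (hG : IsCentredNoise π G S C)
    (hc : IsMarkovChain Q π P Zs) (i : ℕ) :
    Measurable fun ω => G (past Zs t ω) (Zs i ω) :=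
  hG.measurable.comp ((hc.measurable_past t).prodMk (hc.measurable i))

theorem IsCentredNoise.abs_integral_inner_le (hn : IsErgodicNoise Q π τ P Zs)
    (hG : IsCentredNoise π G S C) {H : (Fin (t + 1) → Z) → Vec d} (hH : Measurable H) {C' : ℝ}
    (hC' : ∀ w, ‖H w‖ ≤ C') (i : ℕ) :
    |∫ ω, inner ℝ (H (past Zs t ω)) (G (past Zs t ω) (Zs (t + i) ω)) ∂P|
      ≤ 2 * (1 / 4 : ℝ) ^ (i / τ) * ∫ ω, S (past Zs t ω) * ‖H (past Zs t ω)‖ ∂P := by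
  refine hn.abs_integral_le t i (φ := fun w z => inner ℝ (H w) (G w z))
    (A := fun w => S w * ‖H w‖) (C := C * C') ?_ (hG.measurable_bound.mul hH.norm) ?_ ?_ ?_
  · exact (hH.comp measurable_fst).inner hG.measurable
  · intro w z
    rw [mul_comm]
    exact (abs_real_inner_le_norm _ _).trans
      (mul_le_mul_of_nonneg_left (hG.norm_le w z) (norm_nonneg _))
  · intro w
    exact mul_le_mul (hG.bound_le w) (hC' w) (norm_nonneg _)
      ((hG.nonneg w).trans (hG.bound_le w))
  · exact fun w => hG.integral_inner_eq_zero w _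

/-- The earlier noise vector belongs to the past at time `t + i`; relative to that past only the
later one is fresh, and it is centred. -/
theorem IsCentredNoise.integral_cov_le (hn : IsErgodicNoise Q π τ P Zs)
    (hG : IsCentredNoise π G S C) (i k : ℕ) :
    ∫ ω, inner ℝ (G (past Zs t ω) (Zs (t + i) ω)) (G (past Zs t ω) (Zs (t + i + k) ω)) ∂P
      ≤ 2 * (1 / 4 : ℝ) ^ (k / τ) * ∫ ω, S (past Zs t ω) ^ 2 ∂P := by
  let res : (Fin (t + i + 1) → Z) → (Fin (t + 1) → Z) := fun w l => w ⟨l, by omega⟩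
  have hres : Measurable res := measurable_pi_lambda _ fun l => measurable_pi_apply _
  refine (le_abs_self _).trans ?_
  refine hn.abs_integral_le (t + i) k
    (φ := fun w z => inner ℝ (G (res w) (w (Fin.last _))) (G (res w) z))
    (A := fun w => S (res w) ^ 2) (C := C ^ 2) ?_ ((hG.measurable_bound.comp hres).pow_const 2)
    ?_ ?_ ?_
  · have h1 : Measurable fun q : (Fin (t + i + 1) → Z) × Z =>
        G (res q.1) (q.1 (Fin.last _)) :=
      hG.measurable.comp ((hres.comp measurable_fst).prodMk
        ((measurable_pi_apply _).comp measurable_fst))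
    have h2 : Measurable fun q : (Fin (t + i + 1) → Z) × Z => G (res q.1) q.2 :=
      hG.measurable.comp ((hres.comp measurable_fst).prodMk measurable_snd)
    exact h1.inner h2
  · intro w z
    rw [pow_two]
    exact (abs_real_inner_le_norm _ _).trans
      (mul_le_mul (hG.norm_le _ _) (hG.norm_le _ _) (norm_nonneg _) (hG.nonneg _))
  · exact fun w => pow_le_pow_left₀ (hG.nonneg _) (hG.bound_le _) 2
  · exact fun w => hG.integral_inner_eq_zero _ _

/-- The sum of `n` consecutive noise vectors after time `t`. -/
noncomputable def noiseSum (G : (Fin (t + 1) → Z) → Z → Vec d) (Zs : ℕ → Ω → Z) (n : ℕ) (ω : Ω) :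
    Vec d := ∑ i ∈ Finset.range n, G (past Zs t ω) (Zs (t + (i + 1)) ω)

theorem IsCentredNoise.norm_noiseSum_le (hG : IsCentredNoise π G S C) (n : ℕ) (ω : Ω) :
    ‖noiseSum G Zs n ω‖ ≤ n * C := by
  refine (norm_sum_le _ _).trans ?_
  simpa using Finset.sum_le_card_nsmul (Finset.range n) _ C
    fun i _ => (hG.norm_le (past Zs t ω) (Zs (t + (i + 1)) ω)).trans (hG.bound_le _)

theorem IsCentredNoise.measurable_noiseSum (hG : IsCentredNoise π G S C)
    (hc : IsMarkovChain Q π P Zs) (n : ℕ) : Measurable (noiseSum G Zs n) :=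
  Finset.measurable_fun_sum _ fun _ _ => hG.measurable_at hc _

theorem IsCentredNoise.integrable_bound (hG : IsCentredNoise π G S C)
    (hc : IsMarkovChain Q π P Zs) : Integrable (fun ω => S (past Zs t ω) ^ 2) P := by
  refine Integrable.of_bound
    ((hG.measurable_bound.comp (hc.measurable_past t)).pow_const 2).aestronglyMeasurable (C ^ 2)
    (Filter.Eventually.of_forall fun ω => ?_)
  rw [Real.norm_of_nonneg (by positivity)]
  exact pow_le_pow_left₀ (hG.nonneg _) (hG.bound_le _) 2

/-- The decorrelation weights are summable, so the bound does not grow with `n`. After division by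
`n` the bias of an average decays like `τ/n`. -/
theorem IsCentredNoise.abs_integral_inner_noiseSum_le (hn : IsErgodicNoise Q π τ P Zs)
    (hτ : 1 ≤ τ) (hG : IsCentredNoise π G S C) {H : (Fin (t + 1) → Z) → Vec d}
    (hH : Measurable H) {C' : ℝ} (hC' : ∀ w, ‖H w‖ ≤ C') (n : ℕ) :
    |∫ ω, inner ℝ (H (past Zs t ω)) (noiseSum G Zs n ω) ∂P|
      ≤ 8 / 3 * τ * ∫ ω, S (past Zs t ω) * ‖H (past Zs t ω)‖ ∂P := by
  have hc := hn.chain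
  have hHm : Measurable fun ω => H (past Zs t ω) := hH.comp (hc.measurable_past t)
  have hint : ∀ i ∈ Finset.range n, Integrable (fun ω =>
      inner ℝ (H (past Zs t ω)) (G (past Zs t ω) (Zs (t + (i + 1)) ω))) P := fun i _ => by
    refine Integrable.of_bound (hHm.inner (hG.measurable_at hc _)).aestronglyMeasurable (C' * C)
      (Filter.Eventually.of_forall fun ω => ?_)
    exact (norm_inner_le_norm _ _).trans (mul_le_mul (hC' _)
      ((hG.norm_le _ _).trans (hG.bound_le _)) (norm_nonneg _) 
      ((norm_nonneg _).trans (hC' (past Zs t ω))))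
  have hI : 0 ≤ ∫ ω, S (past Zs t ω) * ‖H (past Zs t ω)‖ ∂P :=
    integral_nonneg fun ω => mul_nonneg (hG.nonneg _) (norm_nonneg _)
  simp only [noiseSum, inner_sum]
  rw [integral_finsetSum _ hint]
  refine (Finset.abs_sum_le_sum_abs _ _).trans ?_
  refine (Finset.sum_le_sum fun i _ => hG.abs_integral_inner_le hn hH hC' (i + 1)).trans ?_
  rw [← Finset.sum_mul]
  refine mul_le_mul_of_nonneg_right ?_ hI
  refine le_trans ?_ (sum_range_geometric_div_le hτ (n + 1))
  rw [Finset.sum_range_succ']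
  exact le_add_of_nonneg_right (by positivity)

/-- Induction on `n`: a further vector adds its own square and twice its covariance with the
preceding sum, and the covariances decay geometrically in the lag. -/
theorem IsCentredNoise.integral_norm_noiseSum_sq_le (hn : IsErgodicNoise Q π τ P Zs)
    (hτ : 1 ≤ τ) (hG : IsCentredNoise π G S C) (n : ℕ) :
    ∫ ω, ‖noiseSum G Zs n ω‖ ^ 2 ∂P ≤ 16 / 3 * τ * n * ∫ ω, S (past Zs t ω) ^ 2 ∂P := by
  have hc := hn.chain
  set I := ∫ ω, S (past Zs t ω) ^ 2 ∂P with hI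
  have hI0 : 0 ≤ I := integral_nonneg fun ω => sq_nonneg _
  have hC0 : ∀ ω : Ω, 0 ≤ C := fun ω => (hG.nonneg (past Zs t ω)).trans (hG.bound_le _)
  have hnext : ∀ n (ω : Ω), ‖G (past Zs t ω) (Zs (t + (n + 1)) ω)‖ ≤ C := fun n ω =>
    (hG.norm_le _ _).trans (hG.bound_le _)
  induction n with
  | zero => simp [noiseSum]
  | succ n ih =>
    have hexp : ∀ ω, ‖noiseSum G Zs (n + 1) ω‖ ^ 2 = ‖noiseSum G Zs n ω‖ ^ 2
        + 2 * inner ℝ (noiseSum G Zs n ω) (G (past Zs t ω) (Zs (t + (n + 1)) ω))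
        + ‖G (past Zs t ω) (Zs (t + (n + 1)) ω)‖ ^ 2 := fun ω => by
      rw [noiseSum, Finset.sum_range_succ, norm_add_sq_real]
      rfl
    have i1 : Integrable (fun ω => ‖noiseSum G Zs n ω‖ ^ 2) P := by
      refine Integrable.of_bound
        ((hG.measurable_noiseSum hc n).norm.pow_const 2).aestronglyMeasurable ((n * C) ^ 2)
        (Filter.Eventually.of_forall fun ω => ?_)
      rw [Real.norm_of_nonneg (by positivity)]
      exact pow_le_pow_left₀ (norm_nonneg _) (hG.norm_noiseSum_le n ω) 2
    have i2 : ∀ i, Integrable (fun ω => inner ℝ (G (past Zs t ω) (Zs (t + (i + 1)) ω))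
        (G (past Zs t ω) (Zs (t + (n + 1)) ω))) P := fun i => by
      refine Integrable.of_bound
        ((hG.measurable_at hc _).inner (hG.measurable_at hc _)).aestronglyMeasurable (C * C)
        (Filter.Eventually.of_forall fun ω => ?_)
      exact (norm_inner_le_norm _ _).trans
        (mul_le_mul (hnext i ω) (hnext n ω) (norm_nonneg _) (hC0 ω))
    have i2' : Integrable (fun ω => inner ℝ (noiseSum G Zs n ω)
        (G (past Zs t ω) (Zs (t + (n + 1)) ω))) P := by
      simp only [noiseSum, sum_inner]
      exact integrable_finsetSum _ fun i _ => i2 i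
    have i3 : Integrable (fun ω => ‖G (past Zs t ω) (Zs (t + (n + 1)) ω)‖ ^ 2) P := by
      refine Integrable.of_bound
        ((hG.measurable_at hc _).norm.pow_const 2).aestronglyMeasurable (C ^ 2)
        (Filter.Eventually.of_forall fun ω => ?_)
      rw [Real.norm_of_nonneg (by positivity)]
      exact pow_le_pow_left₀ (norm_nonneg _) (hnext n ω) 2
    have b3 : ∫ ω, ‖G (past Zs t ω) (Zs (t + (n + 1)) ω)‖ ^ 2 ∂P ≤ I :=
      integral_mono i3 (hG.integrable_bound hc) fun ω =>
        pow_le_pow_left₀ (norm_nonneg _) (hG.norm_le _ _) 2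
    -- Only lags at least 1 occur, so the lag-0 weight 2 is removed from `8/3 τ`. The increment is
    -- then at most `(2(8/3 τ - 2) + 1) I ≤ 16/3 τ I`.
    have b2 : ∫ ω, inner ℝ (noiseSum G Zs n ω) (G (past Zs t ω) (Zs (t + (n + 1)) ω)) ∂P
        ≤ (8 / 3 * τ - 2) * I := by
      simp only [noiseSum, sum_inner]
      rw [integral_finsetSum _ fun i _ => i2 i]
      have hterm : ∀ i ∈ Finset.range n, ∫ ω, inner ℝ (G (past Zs t ω) (Zs (t + (i + 1)) ω))
          (G (past Zs t ω) (Zs (t + (n + 1)) ω)) ∂P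
          ≤ 2 * (1 / 4 : ℝ) ^ ((n - 1 - i + 1) / τ) * I := fun i hi => by
        have := hG.integral_cov_le hn (i + 1) (n - 1 - i + 1)
        rwa [show t + (i + 1) + (n - 1 - i + 1) = t + (n + 1) by
          have := Finset.mem_range.1 hi; omega] at this
      refine (Finset.sum_le_sum hterm).trans ?_
      rw [← Finset.sum_mul]
      refine mul_le_mul_of_nonneg_right ?_ hI0
      rw [Finset.sum_range_reflect (fun i => 2 * (1 / 4 : ℝ) ^ ((i + 1) / τ)) n]
      have h := sum_range_geometric_div_le hτ (n + 1)
      rw [Finset.sum_range_succ'] at h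
      simp only [Nat.zero_div, pow_zero, mul_one] at h
      linarith
    simp only [hexp]
    have i12 : Integrable (fun ω => ‖noiseSum G Zs n ω‖ ^ 2
        + 2 * inner ℝ (noiseSum G Zs n ω) (G (past Zs t ω) (Zs (t + (n + 1)) ω))) P :=
      i1.add (i2'.const_mul 2)
    rw [integral_add i12 i3, integral_add i1 (i2'.const_mul 2),
      integral_const_mul]
    push_cast
    linarith

end Averages

/-! ### Measurability and boundedness of the iterates -/

/-- Each partial derivative is the pointwise limit of the difference quotients `n (F(x + b_i/n, z) -
F(x, z))`, which are jointly measurable. -/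
theorem IsExpectedRisk.measurable_gradF {d : ℕ} {Z : Type*} [MeasurableSpace Z] {π : Measure Z}
    {F : Vec d → Z → ℝ} {f : Vec d → ℝ} (h : IsExpectedRisk π F f) :
    Measurable (Function.uncurry (gradF F)) := by
  let b := EuclideanSpace.basisFun (Fin d) ℝ
  have hrepr : Function.uncurry (gradF F)
      = fun q : Vec d × Z => ∑ i, (fderiv ℝ (fun y => F y q.2) q.1 (b i)) • b i := by
    funext q
    conv_lhs => rw [← b.sum_repr (Function.uncurry (gradF F) q)]
    refine Finset.sum_congr rfl fun i _ => ?_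
    rw [b.repr_apply_apply, real_inner_comm]
    congr 1
    have := (h.differentiable q.2 q.1).hasGradientAt.hasFDerivAt.fderiv
    rw [this, InnerProductSpace.toDual_apply_apply]
    rfl
  rw [hrepr]
  refine Finset.measurable_fun_sum _ fun i _ => Measurable.smul_const ?_ _
  refine measurable_of_tendsto_metrizable
    (f := fun (n : ℕ) (q : Vec d × Z) =>
      (n : ℝ) • (F (q.1 + (n : ℝ)⁻¹ • b i) q.2 - F q.1 q.2)) (fun n => ?_) ?_
  · have hshift : Measurable fun q : Vec d × Z => F (q.1 + (n : ℝ)⁻¹ • b i) q.2 :=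
      h.measurable.comp ((measurable_fst.add_const _).prodMk measurable_snd)
    exact (hshift.sub h.measurable).const_smul (n : ℝ)
  · rw [tendsto_pi_nhds]
    intro q
    refine (h.differentiable q.2 q.1).hasFDerivAt.lim (b i) ?_
    simpa using tendsto_natCast_atTop_atTop (R := ℝ)

theorem IsLSmooth.continuous_gradient {d : ℕ} {L : ℝ} {f : Vec d → ℝ} (h : IsLSmooth L f) :
    Continuous (gradient f) := by
  have hl : LipschitzWith (Real.toNNReal L) (gradient f) :=
    LipschitzWith.of_dist_le_mul fun x y => by
      rw [dist_eq_norm, dist_eq_norm]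
      exact (h.lipschitz x y).trans
        (mul_le_mul_of_nonneg_right (Real.le_coe_toNNReal L) (norm_nonneg _))
  exact hl.continuous

theorem HasBoundedNoise.exists_norm_gradF_le {d : ℕ} {Z : Type*} [MeasurableSpace Z]
    {π : Measure Z} {F : Vec d → Z → ℝ} {f : Vec d → ℝ} {σ δ L : ℝ}
    (h : HasBoundedNoise π F f σ δ) (hs : IsLSmooth L f) (r : ℝ) :
    ∃ C, 0 ≤ C ∧ ∀ x, ‖x‖ ≤ r → ∀ z, ‖gradF F x z‖ ≤ C := by
  have hcont : Continuous fun x => ‖gradient f x‖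
      + √(σ ^ 2 + δ ^ 2 * ‖gradient f x‖ ^ 2) := by
    have := hs.continuous_gradient
    fun_prop
  obtain ⟨C, hC⟩ := (isCompact_closedBall (0 : Vec d) r).exists_bound_of_continuousOn
    hcont.continuousOn
  refine ⟨max C 0, le_max_right _ _, fun x hx z => le_trans ?_ (le_max_left _ _)⟩
  have h1 := (le_abs_self _).trans (hC x (by simpa using hx))
  have h2 : ‖gradF F x z - gradient f x‖ ≤ √(σ ^ 2 + δ ^ 2 * ‖gradient f x‖ ^ 2) :=
    Real.le_sqrt_of_sq_le (h.growth x z)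
  have h3 := norm_le_norm_add_norm_sub' (gradF F x z) (gradient f x)
  linarith

theorem norm_batchGrad_le {d : ℕ} {Z : Type*} {F : Vec d → Z → ℝ} {x : Vec d} {C : ℝ}
    (hC0 : 0 ≤ C) (hC : ∀ z, ‖gradF F x z‖ ≤ C) (B : ℕ) (z : ℕ → Z) (T j : ℕ) :
    ‖batchGrad F B z T x j‖ ≤ C := by
  rw [batchGrad, norm_smul, Real.norm_of_nonneg (by positivity)]
  have h1 : ‖∑ i ∈ Finset.Icc 1 (2 ^ j * B), gradF F x (z (T + i))‖ ≤ (2 ^ j * B) * C := by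
    refine (norm_sum_le _ _).trans ?_
    simpa using Finset.sum_le_card_nsmul (Finset.Icc 1 (2 ^ j * B)) _ C fun i _ => hC (z (T + i))
  refine (mul_le_mul_of_nonneg_left h1 (by positivity)).trans ?_
  rw [← mul_assoc]
  exact (mul_le_mul_of_nonneg_right inv_mul_le_one hC0).trans (one_mul C).le

theorem norm_gradEst_le {d : ℕ} {Z : Type*} {F : Vec d → Z → ℝ} {x : Vec d} {C : ℝ}
    (hC0 : 0 ≤ C) (hC : ∀ z, ‖gradF F x z‖ ≤ C) {a : Params} (hM : 0 ≤ a.M)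
    (z : ℕ → Z) (T j : ℕ) : ‖gradEst F a z T x j‖ ≤ C + a.M * (C + C) := by
  have hb := norm_batchGrad_le hC0 hC a.B z T
  refine (norm_add_le _ _).trans (add_le_add (hb 0) ?_)
  split_ifs with h
  · rw [norm_smul, Real.norm_of_nonneg (by positivity)]
    exact mul_le_mul h ((norm_sub_le _ _).trans (add_le_add (hb j) (hb (j - 1))))
      (norm_nonneg _) hM
  · rw [norm_zero]; positivity

section Iterates

set_option linter.unusedSectionVars false

variable {d : ℕ} {Z : Type*} {F : Vec d → Z → ℝ} {f : Vec d → ℝ} {a : Params} (x₀ : Vec d)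

/-- The growth condition bounds the oracle on balls uniformly in `z`, and truncation caps the factor
`2^j` by `M`. Iterates are therefore bounded uniformly over trajectories and levels, and every later
integrability claim reduces to measurability. -/
theorem exists_norm_run_le [MeasurableSpace Z] {π : Measure Z} {σ δ L : ℝ}
    (h : HasBoundedNoise π F f σ δ) (hs : IsLSmooth L f) (hM : 0 ≤ a.M) (k : ℕ) :
    ∃ C, ∀ (z : ℕ → Z) (j : ℕ → ℕ),
      ‖(run F a x₀ z j k).x‖ ≤ C ∧ ‖(run F a x₀ z j k).xf‖ ≤ C := by
  induction k with
  | zero => exact ⟨‖x₀‖, fun z j => ⟨le_rfl, le_rfl⟩⟩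
  | succ k ih =>
    obtain ⟨C, hC⟩ := ih
    obtain ⟨D, hD0, hD⟩ := h.exists_norm_gradF_le hs (|a.θ| * C + |1 - a.θ| * C)
    set g := D + a.M * (D + D)
    set r := |a.θ| * C + |1 - a.θ| * C
    have hstep : ∀ (z : ℕ → Z) (j : ℕ → ℕ), ‖(run F a x₀ z j k).xg a‖ ≤ r ∧
        ‖(run F a x₀ z j (k + 1)).xf‖ ≤ r + |a.p * a.γ| * g := by
      intro z j
      have hxg : ‖(run F a x₀ z j k).xg a‖ ≤ r := by
        refine (norm_add_le _ _).trans ?_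
        rw [norm_smul, norm_smul, Real.norm_eq_abs, Real.norm_eq_abs]
        exact add_le_add (mul_le_mul_of_nonneg_left (hC z j).2 (abs_nonneg _))
          (mul_le_mul_of_nonneg_left (hC z j).1 (abs_nonneg _))
      refine ⟨hxg, ?_⟩
      change ‖(run F a x₀ z j k).xg a - (a.p * a.γ) • gradEst F a z _ _ (j k)‖ ≤ _
      refine (norm_sub_le _ _).trans (add_le_add hxg ?_)
      rw [norm_smul, Real.norm_eq_abs]
      exact mul_le_mul_of_nonneg_left
        (norm_gradEst_le hD0 (hD _ hxg) hM z _ (j k)) (abs_nonneg _)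
    refine ⟨max (r + |a.p * a.γ| * g) (|a.η| * (r + |a.p * a.γ| * g) + |a.p - a.η| * C
      + |(1 - a.p) * (1 - a.β)| * C + |(1 - a.p) * a.β| * r), fun z j => ⟨?_, ?_⟩⟩
    · refine le_trans ?_ (le_max_right _ _)
      change ‖a.η • (run F a x₀ z j (k + 1)).xf + (a.p - a.η) • (run F a x₀ z j k).xf
        + ((1 - a.p) * (1 - a.β)) • (run F a x₀ z j k).x
        + ((1 - a.p) * a.β) • (run F a x₀ z j k).xg a‖ ≤ _
      refine (norm_add_le _ _).trans (add_le_add ((norm_add_le _ _).trans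
        (add_le_add ((norm_add_le _ _).trans (add_le_add ?_ ?_)) ?_)) ?_) <;>
      rw [norm_smul, Real.norm_eq_abs] <;>
      refine mul_le_mul_of_nonneg_left ?_ (abs_nonneg _)
      exacts [(hstep z j).2, (hC z j).2, (hC z j).1, (hstep z j).1]
    · exact (hstep z j).2.trans (le_max_left _ _)

theorem run_T (z : ℕ → Z) (j : ℕ → ℕ) (k : ℕ) :
    (run F a x₀ z j k).T = ∑ i ∈ Finset.range k, 2 ^ j i * a.B := by
  induction k with
  | zero => rfl
  | succ k ih =>
    rw [Finset.sum_range_succ, ← ih]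
    rfl

theorem batchGrad_congr {B T j : ℕ} {x : Vec d} {z z' : ℕ → Z}
    (h : ∀ i ≤ T + 2 ^ j * B, z i = z' i) : batchGrad F B z T x j = batchGrad F B z' T x j := by
  rw [batchGrad, batchGrad]
  congr 1
  refine Finset.sum_congr rfl fun i hi => ?_
  rw [h (T + i) (by have := (Finset.mem_Icc.1 hi).2; omega)]

theorem gradEst_congr {T j : ℕ} {x : Vec d} {z z' : ℕ → Z}
    (h : ∀ i ≤ T + 2 ^ j * a.B, z i = z' i) : gradEst F a z T x j = gradEst F a z' T x j := by
  have hle : ∀ j' ≤ j, batchGrad F a.B z T x j' = batchGrad F a.B z' T x j' := fun j' hj' => by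
    refine batchGrad_congr fun i hi => h i (hi.trans ?_)
    have := Nat.mul_le_mul_right a.B (Nat.pow_le_pow_right (n := 2) (by norm_num) hj')
    omega
  rw [gradEst, gradEst, hle 0 (Nat.zero_le _), hle j le_rfl, hle (j - 1) (Nat.sub_le _ _)]

/-- Causality: the counter depends on the levels alone, so it tells in advance which part of the
trajectory an iterate can have seen. -/
theorem run_congr {z z' : ℕ → Z} {j : ℕ → ℕ} {k : ℕ}
    (h : ∀ i ≤ ∑ l ∈ Finset.range k, 2 ^ j l * a.B, z i = z' i) :
    run F a x₀ z j k = run F a x₀ z' j k := by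
  induction k with
  | zero => rfl
  | succ k ih =>
    rw [Finset.sum_range_succ] at h
    have ih' := ih fun i hi => h i (by omega)
    simp only [run]
    rw [ih']
    simp only [step]
    rw [gradEst_congr (z := z) (z' := z')]
    rw [run_T]
    exact h

theorem run_congr_levels {z : ℕ → Z} {j j' : ℕ → ℕ} {k : ℕ} (h : ∀ i < k, j i = j' i) :
    run F a x₀ z j k = run F a x₀ z j' k := by
  induction k with
  | zero => rfl
  | succ k ih =>
    simp only [run]
    rw [ih fun i hi => h i (by omega), h k (by omega)]

/-- Isolates the newest level: changing it leaves the state it acts on untouched, so it can be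
averaged with all else fixed. -/
theorem run_update (z : ℕ → Z) (j : ℕ → ℕ) (k l : ℕ) :
    run F a x₀ z (Function.update j k l) (k + 1) = step F a z l (run F a x₀ z j k) := by
  simp only [run, Function.update_self]
  rw [run_congr_levels x₀ (j' := j)]
  intro i hi
  exact Function.update_of_ne (by omega) _ _

theorem measurable_gradEst [MeasurableSpace Z] {Y : Type*} [MeasurableSpace Y]
    (hF : Measurable (Function.uncurry (gradF F))) {x : Y → Vec d} (hx : Measurable x)
    {z : Y → ℕ → Z} (hz : Measurable z) (T j : ℕ) :
    Measurable fun y => gradEst F a (z y) T (x y) j := by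
  have hb : ∀ j, Measurable fun y => batchGrad F a.B (z y) T (x y) j := fun j => by
    have hsum : Measurable fun y => ∑ i ∈ Finset.Icc 1 (2 ^ j * a.B), gradF F (x y) (z y (T + i)) :=
      Finset.measurable_fun_sum _ fun i _ =>
        hF.comp (hx.prodMk ((measurable_pi_apply _).comp hz))
    exact hsum.const_smul ((2 : ℝ) ^ j * a.B)⁻¹
  refine (hb 0).add ?_
  split_ifs
  · exact ((hb j).sub (hb (j - 1))).const_smul ((2 : ℝ) ^ j)
  · exact measurable_const

theorem measurable_run [MeasurableSpace Z] (hF : Measurable (Function.uncurry (gradF F)))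
    (j : ℕ → ℕ) (k : ℕ) :
    Measurable (fun z => (run F a x₀ z j k).x) ∧ Measurable (fun z => (run F a x₀ z j k).xf) := by
  induction k with
  | zero => exact ⟨measurable_const, measurable_const⟩
  | succ k ih =>
    obtain ⟨hx, hxf⟩ := ih
    have hxg : Measurable fun z => (run F a x₀ z j k).xg a :=
      (hxf.const_smul a.θ).add (hx.const_smul (1 - a.θ))
    have hg : Measurable fun z => gradEst F a z (run F a x₀ z j k).T
        ((run F a x₀ z j k).xg a) (j k) := by
      simp only [run_T]
      exact measurable_gradEst hF hxg measurable_id _ _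
    have hxf' : Measurable fun z => (run F a x₀ z j (k + 1)).xf :=
      hxg.sub (hg.const_smul (a.p * a.γ))
    refine ⟨?_, hxf'⟩
    exact (((hxf'.const_smul a.η).add (hxf.const_smul (a.p - a.η))).add
      (hx.const_smul ((1 - a.p) * (1 - a.β)))).add (hxg.const_smul ((1 - a.p) * a.β))

theorem exists_bound_run [MeasurableSpace Z] {π : Measure Z} {σ δ L : ℝ}
    (h : HasBoundedNoise π F f σ δ) (hs : IsLSmooth L f) (hM : 0 ≤ a.M)
    {E : Type*} [NormedAddCommGroup E] {φ : Vec d × Vec d → E} (hφ : Continuous φ) (k : ℕ) :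
    ∃ C, ∀ (z : ℕ → Z) (j : ℕ → ℕ),
      ‖φ ((run F a x₀ z j k).x, (run F a x₀ z j k).xf)‖ ≤ C := by
  obtain ⟨r, hr⟩ := exists_norm_run_le (F := F) (f := f) (a := a) x₀ h hs hM k
  obtain ⟨C, hC⟩ := (isCompact_closedBall (0 : Vec d × Vec d) r).exists_bound_of_continuousOn
    hφ.continuousOn
  refine ⟨C, fun z j => hC _ ?_⟩
  rw [mem_closedBall_zero_iff]
  exact max_le (hr z j).1 (hr z j).2

end Iterates

/-! ### The expectation over a batch level -/

/-- The mean of `h` under the geometric law when `h` is constant on levels above `m`. -/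
noncomputable def levelMean (m : ℕ) (h : ℕ → ℝ) : ℝ :=
  ∑ l ∈ Finset.range m, (1 / 2 : ℝ) ^ (l + 1) * h (l + 1) + (1 / 2) ^ m * h (m + 1)

theorem levelMean_mono {m : ℕ} {h h' : ℕ → ℝ} (hh : ∀ l, h l ≤ h' l) :
    levelMean m h ≤ levelMean m h' :=
  add_le_add (Finset.sum_le_sum fun l _ => mul_le_mul_of_nonneg_left (hh _) (by positivity))
    (mul_le_mul_of_nonneg_left (hh _) (by positivity))

theorem levelMean_add (m : ℕ) (h h' : ℕ → ℝ) :
    levelMean m (fun l => h l + h' l) = levelMean m h + levelMean m h' := by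
  simp only [levelMean, mul_add, Finset.sum_add_distrib]
  ring

theorem levelMean_const_mul (m : ℕ) (c : ℝ) (h : ℕ → ℝ) :
    levelMean m (fun l => c * h l) = c * levelMean m h := by
  simp only [levelMean, mul_add, Finset.mul_sum]
  congr 1
  · exact Finset.sum_congr rfl fun l _ => by ring
  · ring

theorem sum_half_pow (m : ℕ) :
    ∑ l ∈ Finset.range m, (1 / 2 : ℝ) ^ (l + 1) = 1 - (1 / 2) ^ m := by
  induction m with
  | zero => simp
  | succ m ih => rw [Finset.sum_range_succ, ih]; ring

theorem levelMean_const (m : ℕ) (c : ℝ) : levelMean m (fun _ => c) = c := by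
  rw [levelMean, ← Finset.sum_mul, sum_half_pow]
  ring

theorem integral_levelMean {Ω : Type*} [MeasurableSpace Ω] {P : Measure Ω} (m : ℕ)
    {h : ℕ → Ω → ℝ} (hi : ∀ l, Integrable (h l) P) :
    ∫ ω, levelMean m (fun l => h l ω) ∂P = levelMean m fun l => ∫ ω, h l ω ∂P := by
  simp only [levelMean]
  rw [integral_add (integrable_finsetSum _ fun l _ => (hi _).const_mul _) ((hi _).const_mul _),
    integral_finsetSum _ fun l _ => (hi _).const_mul _]
  simp only [integral_const_mul]

/-- The mean of the multilevel correction telescopes to the finest average. -/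
theorem levelMean_telescope {m : ℕ} {M : ℝ} (hM : (2 : ℝ) ^ m ≤ M) (hM' : M < 2 ^ (m + 1))
    (u : ℕ → ℝ) :
    levelMean m (fun l => u 0 + if (2 : ℝ) ^ l ≤ M then 2 ^ l * (u l - u (l - 1)) else 0)
      = u m := by
  rw [levelMean_add, levelMean_const, levelMean, if_neg (not_le.2 hM'), mul_zero, add_zero]
  rw [Finset.sum_congr rfl (g := fun l => u (l + 1) - u l), Finset.sum_range_sub]
  · ring
  · intro l hl
    have hle : (2 : ℝ) ^ (l + 1) ≤ M :=
      (pow_le_pow_right₀ one_le_two (Finset.mem_range.1 hl)).trans hM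
    rw [if_pos hle, ← mul_assoc, ← mul_pow, Nat.add_sub_cancel]
    norm_num

/-- The second moment of the multilevel estimate is controlled by those of the averages. -/
theorem levelMean_norm_sq_le {E : Type*} [NormedAddCommGroup E] [InnerProductSpace ℝ E] {m : ℕ}
    {M : ℝ} (hM' : M < 2 ^ (m + 1)) (u : ℕ → E) :
    levelMean m (fun l =>
        ‖u 0 + if (2 : ℝ) ^ l ≤ M then (2 : ℝ) ^ l • (u l - u (l - 1)) else 0‖ ^ 2)
      ≤ 2 * ‖u 0‖ ^ 2
        + ∑ l ∈ Finset.range m, 4 * 2 ^ (l + 1) * (‖u (l + 1)‖ ^ 2 + ‖u l‖ ^ 2) := by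
  have hsq : ∀ x y : E, ‖x + y‖ ^ 2 ≤ 2 * ‖x‖ ^ 2 + 2 * ‖y‖ ^ 2 := fun x y => by
    have h1 := parallelogram_law_with_norm ℝ x y
    nlinarith [sq_nonneg ‖x - y‖]
  have hdiff : ∀ x y : E, ‖x - y‖ ^ 2 ≤ 2 * ‖x‖ ^ 2 + 2 * ‖y‖ ^ 2 := fun x y => by
    simpa [sub_eq_add_neg] using hsq x (-y)
  have h1 := levelMean_mono (m := m) fun l => hsq (u 0)
    (if (2 : ℝ) ^ l ≤ M then (2 : ℝ) ^ l • (u l - u (l - 1)) else 0)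
  refine h1.trans ?_
  rw [levelMean_add, levelMean_const]
  refine add_le_add le_rfl ?_
  rw [levelMean, if_neg (not_le.2 hM'), norm_zero]
  simp only [ne_eq, OfNat.ofNat_ne_zero, not_false_eq_true, zero_pow, mul_zero, add_zero]
  refine Finset.sum_le_sum fun l _ => ?_
  have h2 := hdiff (u (l + 1)) (u l)
  have h3 : ‖if (2 : ℝ) ^ (l + 1) ≤ M then (2 : ℝ) ^ (l + 1) • (u (l + 1) - u (l + 1 - 1)) else 0‖
      ≤ 2 ^ (l + 1) * ‖u (l + 1) - u l‖ := by
    split_ifs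
    · rw [norm_smul, Real.norm_of_nonneg (by positivity), Nat.add_sub_cancel]
    · rw [norm_zero]; positivity
  have h4 := pow_le_pow_left₀ (norm_nonneg _) h3 2
  -- The probability of the level cancels one of the two factors `2^(l+1)` in the square; the other
  -- is compensated by the variance of the longer averages.
  have h5 : (1 / 2 : ℝ) ^ (l + 1) * 2 ^ (l + 1) = 1 := by
    rw [← mul_pow]; norm_num
  calc (1 / 2 : ℝ) ^ (l + 1) * (2 * _)
      ≤ (1 / 2 : ℝ) ^ (l + 1) * (2 * (2 ^ (l + 1) * ‖u (l + 1) - u l‖) ^ 2) := by gcongr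
    _ = ((1 / 2 : ℝ) ^ (l + 1) * 2 ^ (l + 1)) * (2 * 2 ^ (l + 1) * ‖u (l + 1) - u l‖ ^ 2) := by
      ring
    _ = 2 * 2 ^ (l + 1) * ‖u (l + 1) - u l‖ ^ 2 := by rw [h5, one_mul]
    _ ≤ 2 * 2 ^ (l + 1) * (2 * ‖u (l + 1)‖ ^ 2 + 2 * ‖u l‖ ^ 2) := by gcongr
    _ = _ := by ring

/-! ### One iteration in expectation, for fixed batch levels of the past -/

theorem sum_Icc_one_eq_sum_range {E : Type*} [AddCommMonoid E] (u : ℕ → E) (n : ℕ) :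
    ∑ i ∈ Finset.Icc 1 n, u i = ∑ i ∈ Finset.range n, u (i + 1) := by
  induction n with
  | zero => simp
  | succ n ih => rw [Finset.sum_Icc_succ_top (by omega), ih, Finset.sum_range_succ]

theorem batchGrad_eq_add_noise {d : ℕ} {Z : Type*} (F : Vec d → Z → ℝ) {B : ℕ} (hB : 0 < B)
    (z : ℕ → Z) (T : ℕ) (x v : Vec d) (j : ℕ) :
    batchGrad F B z T x j = v + ((2 : ℝ) ^ j * B)⁻¹ •
      ∑ i ∈ Finset.range (2 ^ j * B), (gradF F x (z (T + (i + 1))) - v) := by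
  have hne : ((2 : ℝ) ^ j * B) ≠ 0 := by positivity
  rw [batchGrad, sum_Icc_one_eq_sum_range (fun i => gradF F x (z (T + i))),
    Finset.sum_sub_distrib, Finset.sum_const, Finset.card_range, smul_sub,
    ← Nat.cast_smul_eq_nsmul ℝ, smul_smul]
  push_cast
  rw [inv_mul_cancel₀ hne, one_smul]
  abel

/-- The bound `(σ² + δ² ‖∇f(x)‖²)^{1/2}` on the norm of the noise at `x`. -/
noncomputable def noiseLevel {d : ℕ} (f : Vec d → ℝ) (σ δ : ℝ) (x : Vec d) : ℝ :=
  √(σ ^ 2 + δ ^ 2 * ‖gradient f x‖ ^ 2)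

theorem noiseLevel_sq {d : ℕ} (f : Vec d → ℝ) (σ δ : ℝ) (x : Vec d) :
    noiseLevel f σ δ x ^ 2 = σ ^ 2 + δ ^ 2 * ‖gradient f x‖ ^ 2 :=
  Real.sq_sqrt (by positivity)

theorem IsExpectedRisk.integral_gradF_sub {d : ℕ} {Z : Type*} [MeasurableSpace Z] {π : Measure Z}
    [IsProbabilityMeasure π] {F : Vec d → Z → ℝ} {f : Vec d → ℝ} {σ δ : ℝ}
    (hr : IsExpectedRisk π F f) (hb : HasBoundedNoise π F f σ δ) (x : Vec d) :
    ∫ z, (gradF F x z - gradient f x) ∂π = 0 := by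
  have hm : Measurable fun z => gradF F x z - gradient f x :=
    (hr.measurable_gradF.comp measurable_prodMk_left).sub_const _
  have hi : Integrable (fun z => gradF F x z - gradient f x) π :=
    Integrable.of_bound hm.aestronglyMeasurable (noiseLevel f σ δ x)
      (Filter.Eventually.of_forall fun z => Real.le_sqrt_of_sq_le (hb.growth x z))
  have hi' : Integrable (fun z => gradF F x z) π := by
    refine (hi.add (integrable_const (gradient f x))).congr (Filter.Eventually.of_forall ?_)
    exact fun z => sub_add_cancel _ _
  rw [integral_sub hi' (integrable_const _), hb.unbiased]
  simp

section OneStep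

set_option linter.unusedSectionVars false

variable {d : ℕ} {Z Ω : Type*} [MeasurableSpace Z] [MeasurableSpace Ω]
  {Q : Kernel Z Z} [IsMarkovKernel Q] {π : Measure Z} [IsProbabilityMeasure π] {τ : ℕ}
  {P : Measure Ω} [IsProbabilityMeasure P] {Zs : ℕ → Ω → Z}
  {F : Vec d → Z → ℝ} {f : Vec d → ℝ} {a : Params} {L μ σ δ : ℝ}

/-- The state after `k` iterations as a function of the trajectory up to time `t`. -/
noncomputable def pastState (F : Vec d → Z → ℝ) (a : Params) (x₀ : Vec d) (j : ℕ → ℕ) (k t : ℕ)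
    (w : Fin (t + 1) → Z) : State d :=
  -- Indices beyond `t` are clamped to make `w` a full trajectory; by `run_congr` the values there
  -- are irrelevant when `t` is the counter.
  run F a x₀ (fun i => w ⟨min i t, by omega⟩) j k

theorem run_eq_pastState (x₀ : Vec d) (j : ℕ → ℕ) (k : ℕ) {t : ℕ}
    (ht : t = ∑ l ∈ Finset.range k, 2 ^ j l * a.B) (ω : Ω) :
    run F a x₀ (fun i => Zs i ω) j k = pastState F a x₀ j k t (past Zs t ω) := by
  refine run_congr x₀ fun i hi => ?_
  rw [← ht] at hi
  simp [past, min_eq_left hi]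

theorem measurable_pastState (hF : Measurable (Function.uncurry (gradF F))) (x₀ : Vec d)
    (j : ℕ → ℕ) (k t : ℕ) : Measurable fun w : Fin (t + 1) → Z =>
      ((pastState F a x₀ j k t w).x, (pastState F a x₀ j k t w).xf) := by
  have hclamp : Measurable fun (w : Fin (t + 1) → Z) (i : ℕ) =>
      w (⟨min i t, by omega⟩ : Fin (t + 1)) :=
    measurable_pi_lambda _ fun i => measurable_pi_apply _
  exact ((measurable_run x₀ hF j k).1.comp hclamp).prodMk
    ((measurable_run x₀ hF j k).2.comp hclamp)

theorem integrable_run (hr : IsExpectedRisk π F f) (hs : IsLSmooth L f)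
    (hb : HasBoundedNoise π F f σ δ) (hM : 0 ≤ a.M) (hZ : ∀ n, Measurable (Zs n))
    {φ : Vec d × Vec d → ℝ} (hφ : Continuous φ) (x₀ : Vec d) (j : ℕ → ℕ) (k : ℕ) :
    Integrable (fun ω => φ ((run F a x₀ (fun i => Zs i ω) j k).x,
      (run F a x₀ (fun i => Zs i ω) j k).xf)) P := by
  obtain ⟨C, hC⟩ := exists_bound_run (F := F) (a := a) x₀ hb hs hM hφ k
  have hz : Measurable fun ω => (fun i => Zs i ω) := measurable_pi_lambda _ hZ
  refine Integrable.of_bound (Measurable.aestronglyMeasurable ?_) C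
    (Filter.Eventually.of_forall fun ω => hC _ j)
  have hm := measurable_run (a := a) x₀ hr.measurable_gradF j k
  exact hφ.measurable.comp ((hm.1.comp hz).prodMk (hm.2.comp hz))

theorem continuous_lyapunov (μ : ℝ) (hs : IsLSmooth L f) (xs : Vec d) :
    Continuous fun q : Vec d × Vec d => lyapunov μ f xs ⟨q.1, q.2, 0⟩ := by
  have := hs.differentiable.continuous
  simp only [lyapunov]
  fun_prop

theorem continuous_gradient_xg (a : Params) (hs : IsLSmooth L f) :
    Continuous fun q : Vec d × Vec d => gradient f ((⟨q.1, q.2, 0⟩ : State d).xg a) := by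
  have := hs.continuous_gradient
  simp only [State.xg]
  fun_prop

theorem continuous_errorDir (μ : ℝ) (a : Params) (hs : IsLSmooth L f) (xs : Vec d) :
    Continuous fun q : Vec d × Vec d => errorDir μ f xs a ⟨q.1, q.2, 0⟩ := by
  have := continuous_gradient_xg a hs
  simp only [errorDir, State.avg, State.xg] at this ⊢
  fun_prop

theorem continuous_stateBound (μ : ℝ) (a : Params) (hs : IsLSmooth L f) (xs : Vec d) :
    Continuous fun q : Vec d × Vec d => stateBound L μ f xs a ⟨q.1, q.2, 0⟩ := by
  have h1 := continuous_gradient_xg a hs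
  have h2 := hs.differentiable.continuous
  simp only [stateBound, State.avg, State.xg] at h1 ⊢
  fun_prop

theorem continuous_noiseLevel (a : Params) (σ δ : ℝ) (hs : IsLSmooth L f) :
    Continuous fun q : Vec d × Vec d => noiseLevel f σ δ ((⟨q.1, q.2, 0⟩ : State d).xg a) := by
  have := continuous_gradient_xg a hs
  simp only [noiseLevel]
  fun_prop

/-- The state with its sample counter reset. -/
def State.reset (s : State d) : State d := ⟨s.x, s.xf, 0⟩

/-- The continuity lemmas concern states with counter 0. None of the functionals reads the counter,
so these identities transfer them to actual states. -/
theorem State.xg_reset (s : State d) (a : Params) : s.reset.xg a = s.xg a := rfl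

theorem lyapunov_reset (xs : Vec d) (s : State d) :
    lyapunov μ f xs s.reset = lyapunov μ f xs s := rfl

theorem errorDir_reset (xs : Vec d) (s : State d) :
    errorDir μ f xs a s.reset = errorDir μ f xs a s := rfl

theorem stateBound_reset (xs : Vec d) (s : State d) :
    stateBound L μ f xs a s.reset = stateBound L μ f xs a s := rfl

/-- The error of the gradient oracle at the extrapolated point, given the past. -/
noncomputable def oracleNoise (F : Vec d → Z → ℝ) (f : Vec d → ℝ) (a : Params) (x₀ : Vec d)
    (j : ℕ → ℕ) (k t : ℕ) (w : Fin (t + 1) → Z) (z : Z) : Vec d :=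
  gradF F ((pastState F a x₀ j k t w).xg a) z - gradient f ((pastState F a x₀ j k t w).xg a)

theorem exists_isCentredNoise (hr : IsExpectedRisk π F f) (hs : IsLSmooth L f)
    (hb : HasBoundedNoise π F f σ δ) (hM : 0 ≤ a.M) (x₀ : Vec d) (j : ℕ → ℕ) (k t : ℕ) :
    ∃ C, IsCentredNoise π (oracleNoise F f a x₀ j k t)
      (fun w => noiseLevel f σ δ ((pastState F a x₀ j k t w).xg a)) C := by
  have hcont := continuous_noiseLevel a σ δ hs
  obtain ⟨C, hC⟩ := exists_bound_run (F := F) (a := a) x₀ hb hs hM hcont k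
  have hst := measurable_pastState (a := a) hr.measurable_gradF x₀ j k t
  have hxg : Measurable fun w => (pastState F a x₀ j k t w).xg a :=
    (hst.snd.const_smul a.θ).add (hst.fst.const_smul (1 - a.θ))
  refine ⟨C, ?_, ?_, ?_, ?_, ?_, ?_⟩
  · have h1 : Measurable fun q : (Fin (t + 1) → Z) × Z =>
        gradF F ((pastState F a x₀ j k t q.1).xg a) q.2 :=
      hr.measurable_gradF.comp ((hxg.comp measurable_fst).prodMk measurable_snd)
    have h2 : Measurable fun q : (Fin (t + 1) → Z) × Z =>
        gradient f ((pastState F a x₀ j k t q.1).xg a) :=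
      hs.continuous_gradient.measurable.comp (hxg.comp measurable_fst)
    exact h1.sub h2
  · have h := hcont.measurable.comp hst
    simp only [← State.xg_reset (pastState F a x₀ j k t _)]
    exact h
  · exact fun w z => Real.le_sqrt_of_sq_le (hb.growth _ z)
  · exact fun w => Real.sqrt_nonneg _
  · intro w
    rw [← State.xg_reset]
    exact (le_abs_self _).trans (hC _ j)
  · exact fun w => hr.integral_gradF_sub hb _

/-- The constant additive error of one iteration. -/
noncomputable def stepNoise (L σ : ℝ) (a : Params) : ℝ :=
  -- The `1/3` comes from the bias; `224/3 = 2 · 16/3 + 64` is the second-moment constant, from the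
  -- base batch and from all levels together.
  a.η ^ 2 * a.γ ^ 2 * a.p ^ 2 * (1 / 3 + 2 * (1 + L * a.γ) * (224 / 3)) * σ ^ 2

theorem integrable_lyapunov_run (hr : IsExpectedRisk π F f) (hs : IsLSmooth L f)
    (hb : HasBoundedNoise π F f σ δ) (hM : 0 ≤ a.M) (hZ : ∀ n, Measurable (Zs n))
    (x₀ xs : Vec d) (j : ℕ → ℕ) (k : ℕ) :
    Integrable (fun ω => lyapunov μ f xs (run F a x₀ (fun i => Zs i ω) j k)) P := by
  simp only [← lyapunov_reset xs (run F a x₀ _ j k)]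
  exact integrable_run hr hs hb hM hZ (continuous_lyapunov μ hs xs) x₀ j k

theorem integrable_stateBound_run (hr : IsExpectedRisk π F f) (hs : IsLSmooth L f)
    (hb : HasBoundedNoise π F f σ δ) (hM : 0 ≤ a.M) (hZ : ∀ n, Measurable (Zs n))
    (x₀ xs : Vec d) (j : ℕ → ℕ) (k : ℕ) :
    Integrable (fun ω => stateBound L μ f xs a (run F a x₀ (fun i => Zs i ω) j k)) P := by
  simp only [← stateBound_reset xs (run F a x₀ _ j k)]
  exact integrable_run hr hs hb hM hZ (continuous_stateBound μ a hs xs) x₀ j k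

theorem measurable_errorDir_pastState (hr : IsExpectedRisk π F f) (hs : IsLSmooth L f)
    (x₀ xs : Vec d) (j : ℕ → ℕ) (k t : ℕ) :
    Measurable fun w : Fin (t + 1) → Z => errorDir μ f xs a (pastState F a x₀ j k t w) := by
  simp only [← errorDir_reset xs (pastState F a x₀ j k t _)]
  have h := (continuous_errorDir μ a hs xs).measurable.comp
    (measurable_pastState (a := a) hr.measurable_gradF x₀ j k t)
  exact h

theorem exists_norm_errorDir_pastState_le (hs : IsLSmooth L f)
    (hb : HasBoundedNoise π F f σ δ) (hM : 0 ≤ a.M) (x₀ xs : Vec d) (j : ℕ → ℕ) (k t : ℕ) :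
    ∃ C, ∀ w : Fin (t + 1) → Z, ‖errorDir μ f xs a (pastState F a x₀ j k t w)‖ ≤ C := by
  obtain ⟨C, hC⟩ := exists_bound_run (F := F) (a := a) x₀ hb hs hM
    (continuous_errorDir μ a hs xs) k
  refine ⟨C, fun w => ?_⟩
  rw [← errorDir_reset]
  exact hC _ j

/-- With the old levels frozen, the counter is a constant `t`, and `H`, `S` and the noise depend on
the past up to `t` and one later sample. Averaging the newest level leaves, in the linear term, only
the finest average, with relative bias `e`; the quadratic term becomes a weighted sum over levels.
`stateBound_add_le` is then integrated pointwise. -/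
theorem levelMean_integral_lyapunov_le (hL : 0 < L) (hμ : 0 < μ) (ha : IsCoupled μ a)
    (hr : IsExpectedRisk π F f) (hs : IsLSmooth L f) (hc : IsStronglyConvex μ f)
    (hn : IsErgodicNoise Q π τ P Zs) (hb : HasBoundedNoise π F f σ δ) (hτ : 1 ≤ τ)
    {m : ℕ} (hm : 1 ≤ m) (hM : (2 : ℝ) ^ m ≤ a.M) (hM' : a.M < 2 ^ (m + 1))
    (hB : τ * m ≤ a.B)
    (he : (8 / 3 * τ / (2 ^ m * a.B : ℝ)) ^ 2 * (1 + 2 * a.p / a.β) ≤ a.p / 3)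
    (hp : a.p * (2 * (1 + L * a.γ) + δ ^ 2 * (1 / 3 + 2 * (1 + L * a.γ) * (224 / 3))) ≤ 1)
    (x₀ xs : Vec d) (j : ℕ → ℕ) (k : ℕ) :
    levelMean m (fun l => ∫ ω, lyapunov μ f xs
        (run F a x₀ (fun i => Zs i ω) (Function.update j k l) (k + 1)) ∂P)
      ≤ (1 - a.β / 2) * ∫ ω, lyapunov μ f xs (run F a x₀ (fun i => Zs i ω) j k) ∂P
        + stepNoise L σ a := by
  have hM0 : 0 ≤ a.M := le_trans (by positivity) hM
  have hB0 : 0 < a.B := lt_of_lt_of_le (Nat.mul_pos hτ hm) hB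
  have hBr : (0 : ℝ) < a.B := Nat.cast_pos.2 hB0
  obtain ⟨t, ht⟩ : ∃ t, t = ∑ l ∈ Finset.range k, 2 ^ j l * a.B := ⟨_, rfl⟩
  let st : Ω → State d := fun ω => run F a x₀ (fun i => Zs i ω) j k
  have hst : ∀ ω, st ω = pastState F a x₀ j k t (past Zs t ω) := run_eq_pastState x₀ j k ht
  obtain ⟨C, hG⟩ := exists_isCentredNoise hr hs hb hM0 x₀ j k t
  set G := oracleNoise F f a x₀ j k t with hGdef
  set S : (Fin (t + 1) → Z) → ℝ := fun w => noiseLevel f σ δ ((pastState F a x₀ j k t w).xg a)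
  let H : (Fin (t + 1) → Z) → Vec d := fun w => errorDir μ f xs a (pastState F a x₀ j k t w)
  have hHm : Measurable H := measurable_errorDir_pastState hr hs x₀ xs j k t
  obtain ⟨C', hH⟩ : ∃ C', ∀ w, ‖H w‖ ≤ C' :=
    exists_norm_errorDir_pastState_le hs hb hM0 x₀ xs j k t
  let u : ℕ → Ω → Vec d := fun l ω => ((2 : ℝ) ^ l * a.B)⁻¹ • noiseSum G Zs (2 ^ l * a.B) ω
  let D : ℕ → Ω → Vec d := fun l ω =>
    u 0 ω + if (2 : ℝ) ^ l ≤ a.M then (2 : ℝ) ^ l • (u l ω - u (l - 1) ω) else 0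
  -- the gradient estimate is the gradient plus the error `D`
  have hD : ∀ l ω, gradEst F a (fun i => Zs i ω) (st ω).T ((st ω).xg a) l
      = gradient f ((st ω).xg a) + D l ω := by
    intro l ω
    have hbg : ∀ l, batchGrad F a.B (fun i => Zs i ω) (st ω).T ((st ω).xg a) l
        = gradient f ((st ω).xg a) + u l ω := fun l => by
      rw [batchGrad_eq_add_noise F hB0 _ _ _ (gradient f ((st ω).xg a)),
        show (st ω).T = t by rw [ht]; exact run_T x₀ _ j k]
      simp only [u, noiseSum, hGdef, oracleNoise, ← hst]
    rw [gradEst, hbg, hbg, hbg]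
    simp only [D, add_sub_add_left_eq_sub, add_assoc]
  -- integrability
  have hum : ∀ l, Measurable (u l) := fun l =>
    (hG.measurable_noiseSum hn.chain _).const_smul ((2 : ℝ) ^ l * a.B)⁻¹
  have hub : ∀ l ω, ‖u l ω‖ ≤ ((2 : ℝ) ^ l * a.B)⁻¹ * (((2 ^ l * a.B : ℕ) : ℝ) * C) := fun l ω => by
    simp only [u]
    rw [norm_smul, Real.norm_of_nonneg (by positivity)]
    exact mul_le_mul_of_nonneg_left (hG.norm_noiseSum_le _ ω) (by positivity)
  have hisq : ∀ l, Integrable (fun ω => ‖u l ω‖ ^ 2) P := fun l => by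
    refine Integrable.of_bound ((hum l).norm.pow_const 2).aestronglyMeasurable
      ((((2 : ℝ) ^ l * a.B)⁻¹ * (((2 ^ l * a.B : ℕ) : ℝ) * C)) ^ 2)
      (Filter.Eventually.of_forall fun ω => ?_)
    rw [Real.norm_of_nonneg (by positivity)]
    exact pow_le_pow_left₀ (norm_nonneg _) (hub l ω) 2
  have hHm' : Measurable fun ω => H (past Zs t ω) := hHm.comp (hn.chain.measurable_past t)
  have hiin : Integrable (fun ω => inner ℝ (H (past Zs t ω)) (u m ω)) P := by
    refine Integrable.of_bound (hHm'.inner (hum m)).aestronglyMeasurable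
      (C' * (((2 : ℝ) ^ m * a.B)⁻¹ * (((2 ^ m * a.B : ℕ) : ℝ) * C)))
      (Filter.Eventually.of_forall fun ω => ?_)
    exact (norm_inner_le_norm _ _).trans (mul_le_mul (hH _) (hub m ω) (norm_nonneg _)
      ((norm_nonneg _).trans (hH (past Zs t ω))))
  have hisb : Integrable (fun ω => stateBound L μ f xs a (st ω)) P :=
    integrable_stateBound_run hr hs hb hM0 hn.chain.measurable x₀ xs j k
  have hily : Integrable (fun ω => lyapunov μ f xs (st ω)) P :=
    integrable_lyapunov_run hr hs hb hM0 hn.chain.measurable x₀ xs j k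
  have hily' : ∀ l, Integrable (fun ω => lyapunov μ f xs
      (run F a x₀ (fun i => Zs i ω) (Function.update j k l) (k + 1))) P := fun l =>
    integrable_lyapunov_run hr hs hb hM0 hn.chain.measurable x₀ xs _ _
  have hiterm : ∀ l : ℕ, Integrable (fun ω =>
      4 * (2 : ℝ) ^ (l + 1) * (‖u (l + 1) ω‖ ^ 2 + ‖u l ω‖ ^ 2)) P := fun l =>
    ((hisq (l + 1)).add (hisq l)).const_mul _
  have hisum : Integrable (fun ω => ∑ l ∈ Finset.range m,
      4 * (2 : ℝ) ^ (l + 1) * (‖u (l + 1) ω‖ ^ 2 + ‖u l ω‖ ^ 2)) P :=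
    integrable_finsetSum _ fun l _ => hiterm l
  have hivar : Integrable (fun ω => 2 * quadWeight L a * (2 * ‖u 0 ω‖ ^ 2
      + ∑ l ∈ Finset.range m, 4 * (2 : ℝ) ^ (l + 1) * (‖u (l + 1) ω‖ ^ 2 + ‖u l ω‖ ^ 2))) P :=
    (((hisq 0).const_mul 2).add hisum).const_mul _
  have hq : 0 ≤ quadWeight L a := by
    have := ha.γ_pos
    unfold quadWeight; positivity
  -- pathwise bound
  have hpath : ∀ ω, levelMean m (fun l => lyapunov μ f xs
      (run F a x₀ (fun i => Zs i ω) (Function.update j k l) (k + 1)))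
      ≤ stateBound L μ f xs a (st ω) - inner ℝ (H (past Zs t ω)) (u m ω)
        + 2 * quadWeight L a * (2 * ‖u 0 ω‖ ^ 2 + ∑ l ∈ Finset.range m,
            4 * (2 : ℝ) ^ (l + 1) * (‖u (l + 1) ω‖ ^ 2 + ‖u l ω‖ ^ 2)) := by
    intro ω
    have hHω : errorDir μ f xs a (st ω) = H (past Zs t ω) := by rw [hst]
    have h1 : ∀ l, lyapunov μ f xs
        (run F a x₀ (fun i => Zs i ω) (Function.update j k l) (k + 1))
        ≤ stateBound L μ f xs a (st ω) + (-1) * inner ℝ (H (past Zs t ω)) (D l ω)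
          + 2 * quadWeight L a * ‖D l ω‖ ^ 2 := fun l => by
      rw [run_update]
      have := lyapunov_step_le hL hμ ha hs xs F (fun i => Zs i ω) l (st ω) (hD l ω)
      rw [hHω, real_inner_comm] at this
      linarith
    refine (levelMean_mono h1).trans ?_
    rw [levelMean_add, levelMean_add, levelMean_const, levelMean_const_mul, levelMean_const_mul]
    have h2 : levelMean m (fun l => inner ℝ (H (past Zs t ω)) (D l ω))
        = inner ℝ (H (past Zs t ω)) (u m ω) := by
      rw [← levelMean_telescope hM hM' (fun l => inner ℝ (H (past Zs t ω)) (u l ω))]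
      congr 1
      funext l
      simp only [D, inner_add_right]
      congr 1
      split_ifs
      · rw [inner_smul_right, inner_sub_right]
      · rw [inner_zero_right]
    have h3 := mul_le_mul_of_nonneg_left (levelMean_norm_sq_le hM' (fun l => u l ω))
      (show 0 ≤ 2 * quadWeight L a by positivity)
    rw [h2]
    linarith
  -- integrate
  have hmain : levelMean m (fun l => ∫ ω, lyapunov μ f xs
        (run F a x₀ (fun i => Zs i ω) (Function.update j k l) (k + 1)) ∂P)
      ≤ ∫ ω, stateBound L μ f xs a (st ω) ∂P
        - ∫ ω, inner ℝ (H (past Zs t ω)) (u m ω) ∂P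
        + 2 * quadWeight L a * (2 * ∫ ω, ‖u 0 ω‖ ^ 2 ∂P + ∑ l ∈ Finset.range m,
            4 * (2 : ℝ) ^ (l + 1) * (∫ ω, ‖u (l + 1) ω‖ ^ 2 ∂P + ∫ ω, ‖u l ω‖ ^ 2 ∂P)) := by
    rw [← integral_levelMean m hily']
    have hil : Integrable (fun ω => levelMean m (fun l => lyapunov μ f xs
        (run F a x₀ (fun i => Zs i ω) (Function.update j k l) (k + 1)))) P := by
      simp only [levelMean]
      exact (integrable_finsetSum _ fun l _ => (hily' _).const_mul _).add
        ((hily' _).const_mul _)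
    have hisub : Integrable (fun ω => stateBound L μ f xs a (st ω)
        - inner ℝ (H (past Zs t ω)) (u m ω)) P := hisb.sub hiin
    refine (integral_mono hil (hisub.add hivar) hpath).trans (le_of_eq ?_)
    simp only [Pi.add_apply]
    rw [integral_add hisub hivar, integral_sub hisb hiin, integral_const_mul,
      integral_add ((hisq 0).const_mul 2) hisum, integral_const_mul,
      integral_finsetSum _ fun l _ => hiterm l]
    simp only [integral_const_mul]
    congr 3
    refine Finset.sum_congr rfl fun l _ => ?_
    rw [integral_add (hisq (l + 1)) (hisq l)]
  -- second moments
  set I := ∫ ω, S (past Zs t ω) ^ 2 ∂P with hI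
  have hI0 : 0 ≤ I := integral_nonneg fun ω => sq_nonneg _
  have hv : ∀ l, ∫ ω, ‖u l ω‖ ^ 2 ∂P ≤ 16 / 3 * (τ / a.B) * ((1 / 2) ^ l * I) := by
    intro l
    have h1 := hG.integral_norm_noiseSum_sq_le hn hτ (2 ^ l * a.B)
    have e1 : ∀ ω, ‖u l ω‖ ^ 2
        = (((2 : ℝ) ^ l * a.B)⁻¹) ^ 2 * ‖noiseSum G Zs (2 ^ l * a.B) ω‖ ^ 2 := fun ω => by
      simp only [u]
      rw [norm_smul, mul_pow, Real.norm_of_nonneg (by positivity)]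
    simp only [e1]
    rw [integral_const_mul]
    refine (mul_le_mul_of_nonneg_left h1 (by positivity)).trans (le_of_eq ?_)
    have e2 : (1 / 2 : ℝ) ^ l = (2 ^ l)⁻¹ := by rw [one_div, inv_pow]
    rw [e2, ← hI]
    push_cast
    field_simp
  have hvar : 2 * ∫ ω, ‖u 0 ω‖ ^ 2 ∂P + ∑ l ∈ Finset.range m,
      4 * (2 : ℝ) ^ (l + 1) * (∫ ω, ‖u (l + 1) ω‖ ^ 2 ∂P + ∫ ω, ‖u l ω‖ ^ 2 ∂P)
      ≤ 224 / 3 * I := by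
    -- The level weight and the variances combine to `4 · 16/3 · (1 + 2) = 64`, the same for every
    -- level.
    have h1 : ∀ l ∈ Finset.range m,
        4 * (2 : ℝ) ^ (l + 1) * (∫ ω, ‖u (l + 1) ω‖ ^ 2 ∂P + ∫ ω, ‖u l ω‖ ^ 2 ∂P)
        ≤ 64 * (τ / a.B) * I := fun l _ => by
      have e2 : (2 : ℝ) ^ l * (1 / 2) ^ l = 1 := by rw [← mul_pow]; norm_num
      refine (mul_le_mul_of_nonneg_left (add_le_add (hv (l + 1)) (hv l))
        (by positivity)).trans (le_of_eq ?_)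
      calc _ = 64 * ((2 : ℝ) ^ l * (1 / 2) ^ l) * (τ / a.B) * I := by ring
        _ = _ := by rw [e2, mul_one]
    have h2 := Finset.sum_le_sum h1
    rw [Finset.sum_const, Finset.card_range, nsmul_eq_mul] at h2
    have h3 := hv 0
    rw [pow_zero, one_mul] at h3
    -- The logarithmic factor in `B` is there for this: it compensates the number of levels.
    have h4 : (τ : ℝ) / a.B * m ≤ 1 := by
      rw [div_mul_eq_mul_div, div_le_one hBr]
      exact_mod_cast hB
    have h5 : (τ : ℝ) / a.B ≤ 1 := by
      refine le_trans ?_ h4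
      exact le_mul_of_one_le_right (by positivity) (by exact_mod_cast hm)
    have h6 := mul_le_mul_of_nonneg_right h4 hI0
    have h7 := mul_le_mul_of_nonneg_right h5 hI0
    linarith
  -- bias
  set e : ℝ := 8 / 3 * τ / (2 ^ m * a.B : ℝ) with hedef
  have hbias : -∫ ω, inner ℝ (H (past Zs t ω)) (u m ω) ∂P
      ≤ e * ∫ ω, S (past Zs t ω) * ‖H (past Zs t ω)‖ ∂P := by
    have h1 := hG.abs_integral_inner_noiseSum_le hn hτ hHm hH (2 ^ m * a.B)
    simp only [u, inner_smul_right]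
    rw [integral_const_mul]
    have h2 := (neg_le_abs _).trans h1
    have h3 := mul_le_mul_of_nonneg_left h2 (show 0 ≤ ((2 : ℝ) ^ m * a.B)⁻¹ by positivity)
    rw [hedef, div_eq_mul_inv]
    linarith
  have hiSH : Integrable (fun ω => S (past Zs t ω) * ‖H (past Zs t ω)‖) P := by
    refine Integrable.of_bound ((hG.measurable_bound.comp
      (hn.chain.measurable_past t)).mul hHm'.norm).aestronglyMeasurable (C * C')
      (Filter.Eventually.of_forall fun ω => ?_)
    rw [Real.norm_of_nonneg (mul_nonneg (hG.nonneg _) (norm_nonneg _))]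
    exact mul_le_mul (hG.bound_le _) (hH _) (norm_nonneg _)
      ((hG.nonneg (past Zs t ω)).trans (hG.bound_le _))
  have hiS := hG.integrable_bound hn.chain
  -- the deterministic inequality, integrated
  have hdet : ∫ ω, stateBound L μ f xs a (st ω) ∂P
      + e * ∫ ω, S (past Zs t ω) * ‖H (past Zs t ω)‖ ∂P + 2 * quadWeight L a * (224 / 3 * I)
      ≤ (1 - a.β / 2) * ∫ ω, lyapunov μ f xs (st ω) ∂P + stepNoise L σ a := by
    have hpt : ∀ ω, stateBound L μ f xs a (st ω) + e * (S (past Zs t ω) * ‖H (past Zs t ω)‖)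
        + 2 * quadWeight L a * (224 / 3 * S (past Zs t ω) ^ 2)
        ≤ (1 - a.β / 2) * lyapunov μ f xs (st ω) + stepNoise L σ a := fun ω => by
      rw [hst]
      exact stateBound_add_le hμ ha hc xs _ (Real.sqrt_nonneg _) (noiseLevel_sq f σ δ _)
        (by positivity) he hp
    have i1 : Integrable (fun ω => stateBound L μ f xs a (st ω)
        + e * (S (past Zs t ω) * ‖H (past Zs t ω)‖)) P := hisb.add (hiSH.const_mul e)
    have i2 : Integrable (fun ω => 2 * quadWeight L a * (224 / 3 * S (past Zs t ω) ^ 2)) P :=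
      (hiS.const_mul _).const_mul _
    have h := integral_mono (i1.add i2) ((hily.const_mul (1 - a.β / 2)).add
      (integrable_const (stepNoise L σ a))) hpt
    simp only [Pi.add_apply] at h
    rw [integral_add i1 i2, integral_add hisb (hiSH.const_mul e), integral_const_mul,
      integral_const_mul, integral_const_mul, integral_add (hily.const_mul _) (integrable_const _),
      integral_const_mul, integral_const, probReal_univ, one_smul] at h
    exact h
  have hvar' := mul_le_mul_of_nonneg_left hvar (show 0 ≤ 2 * quadWeight L a by positivity)
  change _ ≤ (1 - a.β / 2) * ∫ ω, lyapunov μ f xs (st ω) ∂P + stepNoise L σ a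
  linarith

end OneStep

/-! ### Averaging over the batch levels -/

section Levels

set_option linter.unusedSectionVars false

variable {Ω : Type*} [MeasurableSpace Ω] {P : Measure Ω} [IsProbabilityMeasure P]

theorem measurable_comp_of_countable {S T E : Type*} [MeasurableSpace S] [Countable S]
    [MeasurableSingletonClass S] [MeasurableSpace T] [MeasurableSpace E] {X : Ω → S} {Y : Ω → T}
    (hX : Measurable X) (hY : Measurable Y) {ψ : S → T → E} (hψ : ∀ s, Measurable (ψ s)) :
    Measurable fun ω => ψ (X ω) (Y ω) := by
  have h : Measurable fun q : T × S => ψ q.2 q.1 :=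
    measurable_from_prod_countable_left fun s => hψ s
  exact h.comp (hY.prodMk hX)

/-- Fubini for independent variables. As `X` takes countably many values, measurability of `ψ` is
needed only for each fixed value. -/
theorem integral_comp_of_indepFun {S T : Type*} [MeasurableSpace S] [Countable S]
    [MeasurableSingletonClass S] [MeasurableSpace T] {X : Ω → S} {Y : Ω → T}
    (hX : Measurable X) (hY : Measurable Y) (hXY : IndepFun X Y P) {ψ : S → T → ℝ}
    (hψ : ∀ s, Measurable (ψ s)) {C : ℝ} (hC : ∀ s t, |ψ s t| ≤ C) :
    ∫ ω, ψ (X ω) (Y ω) ∂P = ∫ ω', ∫ ω, ψ (X ω') (Y ω) ∂P ∂P := by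
  have hm : Measurable fun q : S × T => ψ q.1 q.2 :=
    measurable_comp_of_countable measurable_fst measurable_snd hψ
  have : IsProbabilityMeasure (P.map X) := Measure.isProbabilityMeasure_map hX.aemeasurable
  have : IsProbabilityMeasure (P.map Y) := Measure.isProbabilityMeasure_map hY.aemeasurable
  have hprod := (indepFun_iff_map_prod_eq_prod_map_map hX.aemeasurable hY.aemeasurable).1 hXY
  calc ∫ ω, ψ (X ω) (Y ω) ∂P
      = ∫ q, ψ q.1 q.2 ∂(P.map fun ω => (X ω, Y ω)) := by
        rw [integral_map (hX.prodMk hY).aemeasurable hm.aestronglyMeasurable]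
    _ = ∫ s, ∫ t, ψ s t ∂(P.map Y) ∂(P.map X) := by
        rw [hprod, integral_prod]
        exact Integrable.of_bound hm.aestronglyMeasurable C
          (Filter.Eventually.of_forall fun q => hC _ _)
    _ = ∫ ω', ∫ t, ψ (X ω') t ∂(P.map Y) ∂P := by
        rw [integral_map hX.aemeasurable]
        exact (measurable_of_countable _).aestronglyMeasurable
    _ = _ := by
        refine integral_congr_ae (Filter.Eventually.of_forall fun ω' => ?_)
        exact integral_map hY.aemeasurable (hψ _).aestronglyMeasurable

variable {Z : Type*} [MeasurableSpace Z] {Zs : ℕ → Ω → Z} {J : ℕ → Ω → ℕ}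

theorem IsBatchLevels.measureReal_eq (hJ : IsBatchLevels P Zs J) (k : ℕ) {j : ℕ} (hj : 1 ≤ j) :
    P.real (J k ⁻¹' {j}) = (1 / 2) ^ j := by
  rw [measureReal_def, hJ.law k j hj]
  simp

/-- The law is prescribed only on `j ≥ 1`, but the masses of `1, …, n` already sum to `1 - 2^{-n}`,
leaving at most `2^{-n}` for the value 0. -/
theorem IsBatchLevels.ae_pos (hJ : IsBatchLevels P Zs J) (k : ℕ) : ∀ᵐ ω ∂P, 1 ≤ J k ω := by
  have hp : IsProbabilityMeasure (P.map (J k)) :=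
    Measure.isProbabilityMeasure_map (hJ.measurable k).aemeasurable
  have hmap : ∀ j, (P.map (J k)).real {j} = P.real (J k ⁻¹' {j}) := fun j =>
    map_measureReal_apply (hJ.measurable k) (measurableSet_singleton j)
  have hle : ∀ n : ℕ, P.real (J k ⁻¹' {0}) ≤ (1 / 2 : ℝ) ^ n := fun n => by
    have h1 : ∑ l ∈ Finset.range (n + 1), (P.map (J k)).real {l} ≤ 1 := by
      rw [sum_measureReal_singleton]
      exact measureReal_le_one
    rw [Finset.sum_range_succ', hmap,
      Finset.sum_congr rfl fun l _ => (hmap (l + 1)).trans (hJ.measureReal_eq k (by omega)),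
      sum_half_pow] at h1
    linarith
  have h0 : P.real (J k ⁻¹' {0}) = 0 :=
    le_antisymm (ge_of_tendsto' (tendsto_pow_atTop_nhds_zero_of_lt_one (by norm_num)
      (by norm_num)) hle) measureReal_nonneg
  rw [ae_iff]
  have h1 : P (J k ⁻¹' {0}) = 0 := (measureReal_eq_zero_iff).1 h0
  convert h1 using 2
  ext ω
  simp

/-- As `h` is constant beyond `m`, `h(J)` is almost surely a finite combination of indicators, so no
infinite series is needed. -/
theorem IsBatchLevels.integral_comp (hJ : IsBatchLevels P Zs J) (k m : ℕ) {h : ℕ → ℝ}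
    (hh : ∀ l, m < l → h l = h (m + 1)) :
    Integrable (fun ω => h (J k ω)) P ∧ ∫ ω, h (J k ω) ∂P = levelMean m h := by
  let φ : Ω → ℝ := fun ω => h (m + 1) + ∑ l ∈ Finset.range m,
    (J k ⁻¹' {l + 1}).indicator (fun _ => h (l + 1) - h (m + 1)) ω
  have hms : ∀ l, MeasurableSet (J k ⁻¹' {l}) := fun l =>
    hJ.measurable k (measurableSet_singleton l)
  have hi : ∀ l ∈ Finset.range m, Integrable
      ((J k ⁻¹' {l + 1}).indicator (fun _ => h (l + 1) - h (m + 1))) P := fun l _ =>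
    (integrable_const _).indicator (hms _)
  have hae : (fun ω => h (J k ω)) =ᵐ[P] φ := by
    filter_upwards [hJ.ae_pos k] with ω hω
    simp only [φ]
    by_cases hle : J k ω ≤ m
    · rw [Finset.sum_eq_single (J k ω - 1)]
      · rw [Nat.sub_add_cancel hω, Set.indicator_of_mem (by exact rfl)]; ring
      · intro l _ hl
        have hne : ω ∉ J k ⁻¹' {l + 1} := fun h => by
          have : J k ω = l + 1 := h
          omega
        rw [Set.indicator_of_notMem hne]
      · intro hl
        exact absurd (Finset.mem_range.2 (by omega)) hl
    · rw [Finset.sum_eq_zero, hh _ (by omega), add_zero]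
      intro l hl
      have := Finset.mem_range.1 hl
      have hne : ω ∉ J k ⁻¹' {l + 1} := fun h => by
        have : J k ω = l + 1 := h
        omega
      rw [Set.indicator_of_notMem hne]
  have hφ : Integrable φ P := (integrable_const _).add (integrable_finsetSum _ hi)
  refine ⟨hφ.congr hae.symm, ?_⟩
  rw [integral_congr_ae hae]
  simp only [φ]
  rw [integral_add (integrable_const _) (integrable_finsetSum _ hi), integral_finsetSum _ hi,
    Finset.sum_congr rfl (g := fun l => (1 / 2 : ℝ) ^ (l + 1) * (h (l + 1) - h (m + 1)))]
  · simp only [mul_sub, Finset.sum_sub_distrib]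
    rw [← Finset.sum_mul, sum_half_pow, integral_const, probReal_univ, one_smul, levelMean]
    ring
  · intro l _
    rw [integral_indicator_const _ (hms _), hJ.measureReal_eq k (by omega), smul_eq_mul]

/-- Extension of a finite sequence of levels by zero. -/
def extendLevels {k : ℕ} (q : Fin k → ℕ) (i : ℕ) : ℕ := if h : i < k then q ⟨i, h⟩ else 0

theorem extendLevels_apply {k : ℕ} (j : ℕ → ℕ) {i : ℕ} (hi : i < k) :
    extendLevels (fun l : Fin k => j l) i = j i := by
  simp [extendLevels, hi]

/-- The first `k` batch levels. -/
def prefixLevels (J : ℕ → Ω → ℕ) (k : ℕ) (ω : Ω) : Fin k → ℕ := fun l => J l ω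

theorem IsBatchLevels.measurable_prefix (hJ : IsBatchLevels P Zs J) (k : ℕ) :
    Measurable (prefixLevels J k) :=
  measurable_pi_lambda _ fun l => hJ.measurable l

theorem IsBatchLevels.indepFun_prefix (hJ : IsBatchLevels P Zs J) (k : ℕ) :
    IndepFun (prefixLevels J k) (J k) P := by
  have h := hJ.iIndep.indepFun_finset (Finset.range k) {k} (by simp) hJ.measurable
  have h1 : Measurable fun (v : Finset.range k → ℕ) (l : Fin k) =>
      v ⟨l, Finset.mem_range.2 l.2⟩ := measurable_pi_lambda _ fun l => measurable_pi_apply _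
  have h2 : Measurable fun v : ({k} : Finset ℕ) → ℕ => v ⟨k, Finset.mem_singleton_self k⟩ :=
    measurable_pi_apply _
  exact h.comp h1 h2

theorem IsBatchLevels.indepFun_prefix_chain (hJ : IsBatchLevels P Zs J) (k : ℕ) :
    IndepFun (prefixLevels J k) (fun ω i => Zs i ω) P := by
  have h1 : Measurable fun (v : ℕ → ℕ) (l : Fin k) => v l :=
    measurable_pi_lambda _ fun l => measurable_pi_apply _
  exact hJ.indep_chain.comp h1 measurable_id

end Levels

/-! ### The one-step contraction for random batch levels -/

section Convergence

set_option linter.unusedSectionVars false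

variable {d : ℕ} {Z Ω : Type*} [MeasurableSpace Z] [MeasurableSpace Ω]
  {Q : Kernel Z Z} [IsMarkovKernel Q] {π : Measure Z} [IsProbabilityMeasure π] {τ : ℕ}
  {P : Measure Ω} [IsProbabilityMeasure P] {Zs : ℕ → Ω → Z} {J : ℕ → Ω → ℕ}
  {F : Vec d → Z → ℝ} {f : Vec d → ℝ} {a : Params} {L μ σ δ : ℝ}

theorem run_eq_extendLevels (x₀ : Vec d) (k : ℕ) (ω : Ω) :
    run F a x₀ (fun i => Zs i ω) (fun i => J i ω) k
      = run F a x₀ (fun i => Zs i ω) (extendLevels (prefixLevels J k ω)) k :=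
  run_congr_levels x₀ fun _ hi => (extendLevels_apply (fun i => J i ω) hi).symm

theorem integrable_comp_run (hr : IsExpectedRisk π F f) (hs : IsLSmooth L f)
    (hb : HasBoundedNoise π F f σ δ) (hM : 0 ≤ a.M) (hZ : ∀ n, Measurable (Zs n))
    (hJ : IsBatchLevels P Zs J) {φ : Vec d × Vec d → ℝ} (hφ : Continuous φ) (x₀ : Vec d) (k : ℕ) :
    Integrable (fun ω => φ ((run F a x₀ (fun i => Zs i ω) (fun i => J i ω) k).x,
      (run F a x₀ (fun i => Zs i ω) (fun i => J i ω) k).xf)) P := by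
  obtain ⟨C, hC⟩ := exists_bound_run (F := F) (a := a) x₀ hb hs hM hφ k
  have hz : Measurable fun ω => (fun i => Zs i ω) := measurable_pi_lambda _ hZ
  refine Integrable.of_bound (Measurable.aestronglyMeasurable ?_) C
    (Filter.Eventually.of_forall fun ω => hC _ _)
  simp only [run_eq_extendLevels]
  refine measurable_comp_of_countable (hJ.measurable_prefix k) hz
    (ψ := fun q z => φ ((run F a x₀ z (extendLevels q) k).x,
      (run F a x₀ z (extendLevels q) k).xf)) fun q => ?_
  have hm := measurable_run (a := a) x₀ hr.measurable_gradF (extendLevels q) k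
  exact hφ.measurable.comp (hm.1.prodMk hm.2)

theorem exists_bound_lyapunov_run (hs : IsLSmooth L f) (hb : HasBoundedNoise π F f σ δ)
    (hM : 0 ≤ a.M) (x₀ xs : Vec d) (k : ℕ) :
    ∃ C, ∀ (z : ℕ → Z) (j : ℕ → ℕ), |lyapunov μ f xs (run F a x₀ z j k)| ≤ C := by
  obtain ⟨C, hC⟩ := exists_bound_run (F := F) (a := a) x₀ hb hs hM
    (continuous_lyapunov μ hs xs) k
  refine ⟨C, fun z j => ?_⟩
  rw [← lyapunov_reset]
  exact hC z j

theorem measurable_lyapunov_run (hr : IsExpectedRisk π F f) (hs : IsLSmooth L f)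
    (x₀ xs : Vec d) (j : ℕ → ℕ) (k : ℕ) :
    Measurable fun z : ℕ → Z => lyapunov μ f xs (run F a x₀ z j k) := by
  simp only [← lyapunov_reset xs (run F a x₀ _ j k)]
  have hm := measurable_run (a := a) x₀ hr.measurable_gradF j k
  have h := (continuous_lyapunov μ hs xs).measurable.comp (hm.1.prodMk hm.2)
  exact h

theorem integral_lyapunov_run (hr : IsExpectedRisk π F f) (hs : IsLSmooth L f)
    (hb : HasBoundedNoise π F f σ δ) (hM : 0 ≤ a.M) (hZ : ∀ n, Measurable (Zs n))
    (hJ : IsBatchLevels P Zs J) (x₀ xs : Vec d) (k : ℕ) :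
    ∫ ω, lyapunov μ f xs (run F a x₀ (fun i => Zs i ω) (fun i => J i ω) k) ∂P
      = ∫ ω', ∫ ω, lyapunov μ f xs
          (run F a x₀ (fun i => Zs i ω) (extendLevels (prefixLevels J k ω')) k) ∂P ∂P := by
  obtain ⟨C, hC⟩ := exists_bound_lyapunov_run (F := F) (a := a) (μ := μ) hs hb hM x₀ xs k
  simp only [run_eq_extendLevels]
  exact integral_comp_of_indepFun (hJ.measurable_prefix k) (measurable_pi_lambda _ hZ)
    (hJ.indepFun_prefix_chain k)
    (ψ := fun q z => lyapunov μ f xs (run F a x₀ z (extendLevels q) k))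
    (fun q => measurable_lyapunov_run hr hs x₀ xs _ k) (fun q z => hC z _)

/-- Truncated levels all use the base batch and differ only in the counter, so the integrand is
constant beyond `m`, as `levelMean` requires. -/
theorem lyapunov_step_congr {z : ℕ → Z} {s : State d} {l l' : ℕ} (hl : ¬(2 : ℝ) ^ l ≤ a.M)
    (hl' : ¬(2 : ℝ) ^ l' ≤ a.M) (xs : Vec d) :
    lyapunov μ f xs (step F a z l s) = lyapunov μ f xs (step F a z l' s) := by
  simp only [lyapunov, step, gradEst, if_neg hl, if_neg hl']

/-- Independence is used twice: of the levels from the chain, to freeze them, and of the newest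
level from the earlier ones, to average it first and then the others. -/
theorem integral_lyapunov_run_succ_le (hL : 0 < L) (hμ : 0 < μ) (ha : IsCoupled μ a)
    (hr : IsExpectedRisk π F f) (hs : IsLSmooth L f) (hc : IsStronglyConvex μ f)
    (hn : IsErgodicNoise Q π τ P Zs) (hb : HasBoundedNoise π F f σ δ)
    (hJ : IsBatchLevels P Zs J) (hτ : 1 ≤ τ)
    {m : ℕ} (hm : 1 ≤ m) (hM : (2 : ℝ) ^ m ≤ a.M) (hM' : a.M < 2 ^ (m + 1))
    (hB : τ * m ≤ a.B)
    (he : (8 / 3 * τ / (2 ^ m * a.B : ℝ)) ^ 2 * (1 + 2 * a.p / a.β) ≤ a.p / 3)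
    (hp : a.p * (2 * (1 + L * a.γ) + δ ^ 2 * (1 / 3 + 2 * (1 + L * a.γ) * (224 / 3))) ≤ 1)
    (x₀ xs : Vec d) (k : ℕ) :
    ∫ ω, lyapunov μ f xs (run F a x₀ (fun i => Zs i ω) (fun i => J i ω) (k + 1)) ∂P
      ≤ (1 - a.β / 2)
          * ∫ ω, lyapunov μ f xs (run F a x₀ (fun i => Zs i ω) (fun i => J i ω) k) ∂P
        + stepNoise L σ a := by
  have hM0 : 0 ≤ a.M := le_trans (by positivity) hM
  have hZ := hn.chain.measurable
  let A : (Fin k → ℕ) → ℝ := fun q =>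
    ∫ ω, lyapunov μ f xs (run F a x₀ (fun i => Zs i ω) (extendLevels q) k) ∂P
  let D : (Fin k → ℕ) → ℕ → ℝ := fun q l => ∫ ω, lyapunov μ f xs
    (run F a x₀ (fun i => Zs i ω) (Function.update (extendLevels q) k l) (k + 1)) ∂P
  obtain ⟨C, hC⟩ := exists_bound_lyapunov_run (F := F) (a := a) (μ := μ) hs hb hM0 x₀ xs k
  obtain ⟨C', hC'⟩ :=
    exists_bound_lyapunov_run (F := F) (a := a) (μ := μ) hs hb hM0 x₀ xs (k + 1)
  have hA : ∀ q, |A q| ≤ C := fun q => by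
    simpa using norm_integral_le_of_norm_le_const (μ := P)
      (f := fun ω => lyapunov μ f xs (run F a x₀ (fun i => Zs i ω) (extendLevels q) k))
      (Filter.Eventually.of_forall fun ω => hC _ _)
  have hD : ∀ q l, |D q l| ≤ C' := fun q l => by
    simpa using norm_integral_le_of_norm_le_const (μ := P)
      (f := fun ω => lyapunov μ f xs (run F a x₀ (fun i => Zs i ω)
        (Function.update (extendLevels q) k l) (k + 1)))
      (Filter.Eventually.of_forall fun ω => hC' _ _)
  have hsucc : ∀ ω', ∫ ω, lyapunov μ f xs (run F a x₀ (fun i => Zs i ω)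
      (extendLevels (prefixLevels J (k + 1) ω')) (k + 1)) ∂P
      = D (prefixLevels J k ω') (J k ω') := fun ω' => by
    refine integral_congr_ae (Filter.Eventually.of_forall fun ω => ?_)
    refine congrArg (lyapunov μ f xs) (run_congr_levels x₀ fun i hi => ?_)
    rw [show extendLevels (prefixLevels J (k + 1) ω') i = J i ω' from
      extendLevels_apply (fun i => J i ω') hi]
    rcases eq_or_ne i k with rfl | hne
    · rw [Function.update_self]
    · rw [Function.update_of_ne hne]
      exact (extendLevels_apply (fun i => J i ω') (by omega)).symm
  have hlev : ∀ q, ∫ ω, D q (J k ω) ∂P ≤ (1 - a.β / 2) * A q + stepNoise L σ a := fun q => by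
    rw [(hJ.integral_comp k m (h := D q) ?_).2]
    · exact levelMean_integral_lyapunov_le hL hμ ha hr hs hc hn hb hτ hm hM hM' hB he hp x₀ xs _ k
    · intro l hl
      refine integral_congr_ae (Filter.Eventually.of_forall fun ω => ?_)
      have hlM : ∀ l', m < l' → ¬(2 : ℝ) ^ l' ≤ a.M := fun l' hl' =>
        not_le.2 (hM'.trans_le (pow_le_pow_right₀ one_le_two hl'))
      simp only [run_update]
      exact lyapunov_step_congr (hlM l hl) (hlM _ (Nat.lt_succ_self m)) xs
  rw [integral_lyapunov_run hr hs hb hM0 hZ hJ, integral_lyapunov_run hr hs hb hM0 hZ hJ]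
  simp only [hsucc]
  rw [integral_comp_of_indepFun (hJ.measurable_prefix k) (hJ.measurable k) (hJ.indepFun_prefix k)
    (ψ := D) (fun q => measurable_of_countable _) hD]
  have hpm := hJ.measurable_prefix k
  have hiA : Integrable (fun ω => A (prefixLevels J k ω)) P :=
    Integrable.of_bound ((measurable_of_countable A).comp hpm).aestronglyMeasurable C
      (Filter.Eventually.of_forall fun ω => hA _)
  have hiD : Integrable (fun ω' => ∫ ω, D (prefixLevels J k ω') (J k ω) ∂P) P := by
    refine Integrable.of_bound ((measurable_of_countable
      (fun q => ∫ ω, D q (J k ω) ∂P)).comp hpm).aestronglyMeasurable C'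
      (Filter.Eventually.of_forall fun ω' => ?_)
    simpa using norm_integral_le_of_norm_le_const (μ := P)
      (f := fun ω => D (prefixLevels J k ω') (J k ω))
      (Filter.Eventually.of_forall fun ω => hD _ _)
  have h := integral_mono hiD ((hiA.const_mul (1 - a.β / 2)).add
    (integrable_const (stepNoise L σ a))) fun ω' => hlev (prefixLevels J k ω')
  simp only [Pi.add_apply] at h
  rw [integral_add (hiA.const_mul _) (integrable_const _), integral_const_mul, integral_const,
    probReal_univ, one_smul] at h
  exact h

theorem le_pow_mul_add_of_le {u : ℕ → ℝ} {q c : ℝ} (hq0 : 0 ≤ q) (hq1 : q < 1)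
    (hu : ∀ k, u (k + 1) ≤ q * u k + c) (hc : 0 ≤ c) (k : ℕ) :
    u k ≤ q ^ k * u 0 + c / (1 - q) := by
  have h1 : 0 < 1 - q := by linarith
  induction k with
  | zero => simpa using div_nonneg hc h1.le
  | succ k ih =>
    have h2 := mul_le_mul_of_nonneg_left ih hq0
    have h3 : q * (c / (1 - q)) + c = c / (1 - q) := by field_simp; ring
    have := hu k
    rw [pow_succ]
    linarith

end Convergence

/-! ### The parameters -/

theorem C₁_mem : 16 ≤ C₁ ∧ C₁ ≤ 32 := by
  have h1 : 1 ≤ Real.log 4 := by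
    have : Real.log 4 = 2 * Real.log 2 := by
      rw [show (4 : ℝ) = 2 ^ 2 by norm_num, Real.log_pow]; norm_num
    linarith [Real.log_two_gt_d9]
  have h2 : 0 ≤ 1 / Real.log 4 ^ 2 := by positivity
  have h3 : 1 / Real.log 4 ^ 2 ≤ 1 := by
    rw [div_le_one (by positivity)]
    exact one_le_pow₀ h1
  unfold C₁
  constructor <;> linarith

/-- `γ` and `p` are defined through each other. Eliminating `p` leaves a fixed-point equation for a
continuous map of `[0, 3/(4L)]` into itself; its values are positive, hence so is the fixed point.
-/
theorem exists_isHorizonChoice {L μ σ δ R : ℝ} {τ N : ℕ} (hL : 0 < L) (hμ : 0 < μ)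
    (hN : 1 ≤ N) : ∃ a : Params, IsHorizonChoice L μ σ δ R τ N a := by
  have hNr : (0 : ℝ) < N := by exact_mod_cast hN
  have hC := C₁_mem.1
  let c : ℝ := 1 + 4 * (C₁ * τ * (τ : ℝ)⁻¹ + (C₁ + 1) * (τ : ℝ) ^ 2 * ((τ : ℝ) ^ 2)⁻¹) * δ ^ 2
  have hc : 0 ≤ c := by
    have : 0 ≤ C₁ := by linarith
    positivity
  let p : ℝ → ℝ := fun γ => (1 + 2 * (1 + γ * L) * c)⁻¹
  have hden : ∀ γ, 0 ≤ γ → 0 < 1 + 2 * (1 + γ * L) * c := fun γ hγ => by positivity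
  have hlog : 0 < Real.log (max 2 (μ ^ 2 * N * R / σ ^ 2)) :=
    Real.log_pos (lt_of_lt_of_le one_lt_two (le_max_left _ _))
  have hpos : ∀ γ, 0 ≤ γ → 0 < horizonStepsize L μ σ R (p γ) N := fun γ hγ => by
    have hp : 0 < p γ := inv_pos.2 (hden γ hγ)
    unfold horizonStepsize
    split_ifs
    · positivity
    · exact lt_min (by positivity) (by positivity)
  have hle : ∀ γ, horizonStepsize L μ σ R (p γ) N ≤ 3 / (4 * L) := fun γ => by
    unfold horizonStepsize
    split_ifs
    · exact le_rfl
    · exact min_le_left _ _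
  have hcont : ContinuousOn (fun γ => horizonStepsize L μ σ R (p γ) N)
      (Set.Icc 0 (3 / (4 * L))) := by
    unfold horizonStepsize
    split_ifs
    · exact continuousOn_const
    · have hpc : ContinuousOn p (Set.Icc 0 (3 / (4 * L))) :=
        ContinuousOn.inv₀ (by fun_prop) fun γ hγ => (hden γ hγ.1).ne'
      refine ContinuousOn.inf continuousOn_const (ContinuousOn.mul (ContinuousOn.div continuousOn_const
        (((hpc.pow 2).mul continuousOn_const).mul continuousOn_const) fun γ hγ => ?_)
        continuousOn_const)
      have hp : 0 < p γ := inv_pos.2 (hden γ hγ.1)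
      positivity
  obtain ⟨γ, hγ, hfix⟩ := exists_mem_Icc_isFixedPt_of_mapsTo hcont (by positivity)
    fun γ hγ => ⟨(hpos γ hγ.1).le, hle γ⟩
  have hfix' : horizonStepsize L μ σ R (p γ) N = γ := hfix
  let β := √(4 * p γ ^ 2 * μ * γ / 3)
  let η := √(3 / (μ * γ))
  let M := max 2 (√(C₂ * (p γ)⁻¹ * (1 + 2 * p γ / β)))
  refine ⟨⟨γ, (p γ * η⁻¹ - 1) / (β * p γ * η⁻¹ - 1), η, β, p γ, M,
    ⌈τ * Real.logb 2 M⌉₊⟩, ⟨?_, hγ.2, rfl, rfl, rfl, rfl, rfl, rfl⟩, hfix'.symm⟩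
  have := hpos γ hγ.1
  rwa [hfix'] at this

/-- The rate `√(μγ/3)`; it satisfies `η = rate⁻¹` and `β = 2 p rate`. -/
noncomputable def rate (μ : ℝ) (a : Params) : ℝ := √(μ * a.γ / 3)

section Admissible

variable {L μ δ : ℝ} {τ : ℕ} {a : Params}

theorem rate_pos (hμ : 0 < μ) (hγ : 0 < a.γ) : 0 < rate μ a :=
  Real.sqrt_pos.2 (by positivity)

theorem rate_sq (hμ : 0 < μ) (hγ : 0 < a.γ) : rate μ a ^ 2 = μ * a.γ / 3 :=
  Real.sq_sqrt (by positivity)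

/-- With `b = τ` the mixing time cancels, so `p` and the iteration count do not depend on it. -/
theorem IsAdmissible.inv_p_eq (h : IsAdmissible L μ δ τ τ a) (hτ : 1 ≤ τ) :
    a.p⁻¹ = 1 + 2 * (1 + a.γ * L) * (1 + 4 * (2 * C₁ + 1) * δ ^ 2) := by
  have hτr : (τ : ℝ) ≠ 0 := by positivity
  rw [h.p_eq, inv_inv, mul_assoc C₁, mul_inv_cancel₀ hτr, mul_assoc (C₁ + 1),
    mul_inv_cancel₀ (pow_ne_zero 2 hτr)]
  ring

theorem IsAdmissible.γ_mul_le (h : IsAdmissible L μ δ τ τ a) (hL : 0 < L) :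
    0 ≤ a.γ * L ∧ a.γ * L ≤ 3 / 4 := by
  refine ⟨mul_nonneg h.γ_pos.le hL.le, ?_⟩
  have := mul_le_mul_of_nonneg_right h.γ_le hL.le
  rwa [show 3 / (4 * L) * L = 3 / 4 by field_simp] at this

theorem IsAdmissible.inv_p_mem (h : IsAdmissible L μ δ τ τ a) (hL : 0 < L) (hτ : 1 ≤ τ) :
    3 ≤ a.p⁻¹ ∧ a.p⁻¹ ≤ 910 * (1 + δ ^ 2) := by
  obtain ⟨h0, h1⟩ := h.γ_mul_le hL
  obtain ⟨c0, c1⟩ := C₁_mem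
  rw [h.inv_p_eq hτ]
  have hd : 0 ≤ δ ^ 2 := sq_nonneg δ
  have hk0 : 0 ≤ 4 * (2 * C₁ + 1) * δ ^ 2 := by positivity
  -- `260 = 4(2 · 32 + 1)`; with `1 + γL ≤ 7/4` this produces `910 = 2 · (7/4) · 260`.
  have hk1 : 4 * (2 * C₁ + 1) * δ ^ 2 ≤ 260 * δ ^ 2 := by
    refine mul_le_mul_of_nonneg_right ?_ hd
    linarith
  generalize 4 * (2 * C₁ + 1) * δ ^ 2 = K at *
  constructor
  · nlinarith
  · have : (1 + a.γ * L) * (1 + K) ≤ 7 / 4 * (1 + 260 * δ ^ 2) :=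
      mul_le_mul (by linarith) (by linarith) (by positivity) (by norm_num)
    nlinarith

theorem IsAdmissible.p_pos (h : IsAdmissible L μ δ τ τ a) (hL : 0 < L) (hτ : 1 ≤ τ) :
    0 < a.p := inv_pos.1 (by linarith [(h.inv_p_mem hL hτ).1])

theorem IsAdmissible.p_le (h : IsAdmissible L μ δ τ τ a) (hL : 0 < L) (hτ : 1 ≤ τ) :
    a.p ≤ 1 / 3 := by
  have := (h.inv_p_mem hL hτ).1
  rw [le_inv_comm₀ (by norm_num) (h.p_pos hL hτ)] at this
  rwa [one_div]

theorem IsAdmissible.variance_cond (h : IsAdmissible L μ δ τ τ a) (hL : 0 < L) (hτ : 1 ≤ τ) :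
    a.p * (2 * (1 + L * a.γ) + δ ^ 2 * (1 / 3 + 2 * (1 + L * a.γ) * (224 / 3))) ≤ 1 := by
  have hp := h.p_pos hL hτ
  rw [← le_div_iff₀' hp, one_div a.p, h.inv_p_eq hτ, mul_comm L]
  obtain ⟨h0, h1⟩ := h.γ_mul_le hL
  have hd : 0 ≤ δ ^ 2 := sq_nonneg δ
  -- `132 = 4(2 · 16 + 1)`, from `C₁ ≥ 16`; it exceeds `224/3` with room for the bias share `1/3`.
  have hk : 132 * δ ^ 2 ≤ 4 * (2 * C₁ + 1) * δ ^ 2 := by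
    refine mul_le_mul_of_nonneg_right ?_ hd
    linarith [C₁_mem.1]
  generalize 4 * (2 * C₁ + 1) * δ ^ 2 = K at *
  have h2 : (1 + a.γ * L) * (132 * δ ^ 2) ≤ (1 + a.γ * L) * K :=
    mul_le_mul_of_nonneg_left hk (by linarith)
  nlinarith [mul_nonneg h0 hd]

theorem IsAdmissible.η_eq_inv (h : IsAdmissible L μ δ τ τ a) : a.η = (rate μ a)⁻¹ := by
  rw [h.η_eq, rate, ← Real.sqrt_inv, inv_div]

theorem IsAdmissible.β_eq_mul (h : IsAdmissible L μ δ τ τ a) (hL : 0 < L) (hτ : 1 ≤ τ) :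
    a.β = 2 * a.p * rate μ a := by
  have hp := h.p_pos hL hτ
  rw [h.β_eq, rate, show 4 * a.p ^ 2 * μ * a.γ / 3 = (2 * a.p) ^ 2 * (μ * a.γ / 3) by ring,
    Real.sqrt_mul (by positivity), Real.sqrt_sq (by positivity)]

theorem IsAdmissible.rate_le (h : IsAdmissible L μ δ τ τ a) (hL : 0 < L) (hμL : μ ≤ L) :
    rate μ a ≤ 1 / 2 := by
  rw [rate, Real.sqrt_le_left (by norm_num)]
  have h1 := (h.γ_mul_le hL).2
  have h2 := mul_le_mul_of_nonneg_right hμL h.γ_pos.le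
  nlinarith

theorem IsAdmissible.isCoupled (h : IsAdmissible L μ δ τ τ a) (hL : 0 < L) (hμ : 0 < μ)
    (hμL : μ ≤ L) (hτ : 1 ≤ τ) : IsCoupled μ a := by
  have hp := h.p_pos hL hτ
  have hp3 := h.p_le hL hτ
  have hw := rate_pos hμ h.γ_pos
  have hw2 := h.rate_le hL hμL
  have hwsq := rate_sq hμ h.γ_pos
  have hη := h.η_eq_inv
  have hβ := h.β_eq_mul hL hτ
  have hη2 : 2 ≤ a.η := by
    rw [hη, le_inv_comm₀ (by norm_num) hw]
    linarith
  have hβ1 : a.β ≤ 1 := by rw [hβ]; nlinarith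
  have hβ0 : 0 < a.β := by rw [hβ]; positivity
  have hηw : a.η * rate μ a = 1 := by rw [hη, inv_mul_cancel₀ hw.ne']
  refine ⟨h.γ_pos, hp, hβ0, hβ1, by linarith, ?_, ?_, ?_⟩
  · rw [hβ, mul_assoc, mul_comm (rate μ a), hηw, mul_one]
  · have : μ * a.γ = 3 * rate μ a ^ 2 := by rw [hwsq]; ring
    rw [mul_assoc, this]
    calc a.η ^ 2 * (3 * rate μ a ^ 2) = 3 * (a.η * rate μ a) ^ 2 := by ring
      _ = 3 := by rw [hηw]; norm_num
  · have hne : a.β * a.p * a.η⁻¹ - 1 ≠ 0 := by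
      rw [hη, inv_inv]
      have h1 : a.β * a.p ≤ 1 := by nlinarith
      have : a.β * a.p * rate μ a ≤ 1 * (1 / 2) := mul_le_mul h1 hw2 hw.le (by norm_num)
      linarith
    have hηne : a.η ≠ 0 := by linarith
    rw [h.θ_eq, div_mul_eq_mul_div, div_eq_iff hne]
    field_simp
    ring

theorem IsAdmissible.two_le_M (h : IsAdmissible L μ δ τ τ a) : 2 ≤ a.M := by
  rw [h.M_eq]; exact le_max_left _ _

theorem IsAdmissible.one_le_logb (h : IsAdmissible L μ δ τ τ a) : 1 ≤ Real.logb 2 a.M := by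
  have := h.two_le_M
  rw [Real.le_logb_iff_rpow_le one_lt_two (by linarith), Real.rpow_one]
  exact this

/-- `m` is the integer part of `log₂ M`, the last level that is not truncated; it is at least 1
since `M ≥ 2`. -/
theorem IsAdmissible.exists_level (h : IsAdmissible L μ δ τ τ a) :
    ∃ m : ℕ, 1 ≤ m ∧ (2 : ℝ) ^ m ≤ a.M ∧ a.M < 2 ^ (m + 1) ∧ (m : ℝ) ≤ Real.logb 2 a.M ∧
      τ * m ≤ a.B := by
  have hM := h.two_le_M
  obtain ⟨m, h1, h2⟩ := exists_nat_pow_near (show 1 ≤ a.M by linarith) one_lt_two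
  have hm : 1 ≤ m := by
    by_contra hlt
    have : m = 0 := by omega
    subst this
    norm_num at h2
    linarith
  have hlog : (m : ℝ) ≤ Real.logb 2 a.M := by
    rw [Real.le_logb_iff_rpow_le one_lt_two (by linarith), Real.rpow_natCast]
    exact h1
  refine ⟨m, hm, h1, h2, hlog, ?_⟩
  have h3 : (τ : ℝ) * m ≤ a.B := by
    rw [h.B_eq]
    exact (mul_le_mul_of_nonneg_left hlog (by positivity)).trans (Nat.le_ceil _)
  exact_mod_cast h3

/-- `2^m > M/2` and `B ≥ τ` bound the relative bias by `16/(3M)`. Since `(16/3)² = C₂/3`, the lower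
bound on `M` is exactly what is required. -/
theorem IsAdmissible.bias_cond (h : IsAdmissible L μ δ τ τ a) (hL : 0 < L) (hμ : 0 < μ)
    (hμL : μ ≤ L) (hτ : 1 ≤ τ) {m : ℕ} (hm : 1 ≤ m) (hM' : a.M < 2 ^ (m + 1))
    (hB : τ * m ≤ a.B) :
    (8 / 3 * τ / (2 ^ m * a.B : ℝ)) ^ 2 * (1 + 2 * a.p / a.β) ≤ a.p / 3 := by
  have hc := h.isCoupled hL hμ hμL hτ
  have hp := hc.p_pos
  have hβ := hc.β_pos
  have hM0 : 0 < a.M := by linarith [h.two_le_M]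
  have hτB : (τ : ℝ) ≤ a.B := by
    exact_mod_cast (Nat.le_mul_of_pos_right τ hm).trans hB
  have hτ0 : (0 : ℝ) < τ := by exact_mod_cast hτ
  have hB0 : (0 : ℝ) < a.B := hτ0.trans_le hτB
  have he : 8 / 3 * τ / (2 ^ m * a.B : ℝ) ≤ 16 / 3 / a.M := by
    rw [div_le_div_iff₀ (by positivity) hM0]
    have h1 : a.M ≤ 2 * 2 ^ m := by rw [← pow_succ']; exact hM'.le
    have h2 := mul_le_mul hτB h1 hM0.le hB0.le
    nlinarith
  have he2 := pow_le_pow_left₀ (by positivity) he 2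
  have hMsq : C₂ * a.p⁻¹ * (1 + 2 * a.p / a.β) ≤ a.M ^ 2 := by
    refine (Real.sqrt_le_left hM0.le).1 ?_
    conv_rhs => rw [h.M_eq]
    exact le_max_right _ _
  refine (mul_le_mul_of_nonneg_right he2 (by positivity)).trans ?_
  rw [div_pow, div_mul_eq_mul_div, div_le_iff₀ (by positivity)]
  have h3 := mul_le_mul_of_nonneg_left hMsq (show 0 ≤ a.p / 3 by positivity)
  refine le_trans (le_of_eq ?_) h3
  unfold C₂
  field_simp
  norm_num

theorem IsAdmissible.stepNoise_le (h : IsAdmissible L μ δ τ τ a) (hL : 0 < L) (hμ : 0 < μ)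
    (hτ : 1 ≤ τ) (σ : ℝ) :
    stepNoise L σ a / (a.β / 2) ≤ 2358 * (a.p * rate μ a) * (σ ^ 2 / μ ^ 2) := by
  have hp := h.p_pos hL hτ
  have hw := rate_pos hμ h.γ_pos
  have hγ : a.γ = 3 * rate μ a ^ 2 / μ := by rw [rate_sq hμ h.γ_pos]; field_simp
  -- With `γL ≤ 3/4` the left side is at most `785/3 < 262`; then `2358 = 9 · 262`, where 9 comes
  -- from `γ² = 9w⁴/μ²`.
  have hK : 1 / 3 + 2 * (1 + L * a.γ) * (224 / 3) ≤ 262 := by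
    have := (h.γ_mul_le hL).2
    linarith
  have e1 : stepNoise L σ a / (a.β / 2) = 9 * (a.p * rate μ a) * (σ ^ 2 / μ ^ 2)
      * (1 / 3 + 2 * (1 + L * a.γ) * (224 / 3)) := by
    generalize hKdef : 1 / 3 + 2 * (1 + L * a.γ) * (224 / 3) = K
    rw [stepNoise, hKdef, h.η_eq_inv, h.β_eq_mul hL hτ, hγ]
    field_simp
    ring
  rw [e1]
  have := mul_le_mul_of_nonneg_left hK
    (show 0 ≤ 9 * (a.p * rate μ a) * (σ ^ 2 / μ ^ 2) by positivity)
  linarith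

end Admissible

/-! ### Error and cost of the method for admissible parameters -/

section Bounds

variable {d : ℕ} {Z Ω : Type*} [MeasurableSpace Z] [MeasurableSpace Ω]
  {Q : Kernel Z Z} [IsMarkovKernel Q] {π : Measure Z} [IsProbabilityMeasure π] {τ : ℕ}
  {P : Measure Ω} [IsProbabilityMeasure P] {Zs : ℕ → Ω → Z} {J : ℕ → Ω → ℕ}
  {F : Vec d → Z → ℝ} {f : Vec d → ℝ} {a : Params} {L μ σ δ : ℝ}

theorem integral_norm_sq_run_le (hL : 0 < L) (hμ : 0 < μ) (hμL : μ ≤ L)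
    (h : IsAdmissible L μ δ τ τ a) (hr : IsExpectedRisk π F f) (hs : IsLSmooth L f)
    (hc : IsStronglyConvex μ f) (hn : IsErgodicNoise Q π τ P Zs)
    (hb : HasBoundedNoise π F f σ δ) (hJ : IsBatchLevels P Zs J) (hτ : 1 ≤ τ)
    {x₀ xs : Vec d} (hxs : ∀ y, f xs ≤ f y) (N : ℕ) :
    Integrable (fun ω =>
        ‖(run F a x₀ (fun i => Zs i ω) (fun k => J k ω) N).x - xs‖ ^ 2) P ∧
      ∫ ω, ‖(run F a x₀ (fun i => Zs i ω) (fun k => J k ω) N).x - xs‖ ^ 2 ∂P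
        ≤ Real.exp (-(a.p * rate μ a * N)) * (‖x₀ - xs‖ ^ 2 + 6 / μ * (f x₀ - f xs))
          + 2358 * (a.p * rate μ a) * (σ ^ 2 / μ ^ 2) := by
  have hcp := h.isCoupled hL hμ hμL hτ
  have hM0 : 0 ≤ a.M := by linarith [h.two_le_M]
  have hZ := hn.chain.measurable
  obtain ⟨m, hm, hM, hM', -, hB⟩ := h.exists_level
  have hint : Integrable (fun ω =>
      ‖(run F a x₀ (fun i => Zs i ω) (fun k => J k ω) N).x - xs‖ ^ 2) P :=
    integrable_comp_run hr hs hb hM0 hZ hJ (φ := fun q => ‖q.1 - xs‖ ^ 2) (by fun_prop) x₀ N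
  refine ⟨hint, ?_⟩
  have hly : Integrable (fun ω =>
      lyapunov μ f xs (run F a x₀ (fun i => Zs i ω) (fun k => J k ω) N)) P := by
    simp only [← lyapunov_reset xs (run F a x₀ _ _ N)]
    exact integrable_comp_run hr hs hb hM0 hZ hJ (continuous_lyapunov μ hs xs) x₀ N
  have h1 : ∫ ω, ‖(run F a x₀ (fun i => Zs i ω) (fun k => J k ω) N).x - xs‖ ^ 2 ∂P
      ≤ ∫ ω, lyapunov μ f xs (run F a x₀ (fun i => Zs i ω) (fun k => J k ω) N) ∂P := by
    refine integral_mono hint hly fun ω => ?_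
    refine le_add_of_nonneg_right (mul_nonneg (by positivity) (sub_nonneg.2 (hxs _)))
  have hβ := hcp.β_pos
  have hβ1 := hcp.β_le
  have hnoise : 0 ≤ stepNoise L σ a := by
    have := hcp.γ_pos
    unfold stepNoise; positivity
  have h2 := le_pow_mul_add_of_le (q := 1 - a.β / 2) (c := stepNoise L σ a)
    (u := fun k => ∫ ω, lyapunov μ f xs (run F a x₀ (fun i => Zs i ω) (fun k => J k ω) k) ∂P)
    (by linarith) (by linarith)
    (fun k => integral_lyapunov_run_succ_le hL hμ hcp hr hs hc hn hb hJ hτ hm hM hM' hB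
      (h.bias_cond hL hμ hμL hτ hm hM' hB) (h.variance_cond hL hτ) x₀ xs k) hnoise N
  have h0 : ∫ ω, lyapunov μ f xs (run F a x₀ (fun i => Zs i ω) (fun k => J k ω) 0) ∂P
      = ‖x₀ - xs‖ ^ 2 + 6 / μ * (f x₀ - f xs) := by
    simp [run, lyapunov]
  rw [h0, sub_sub_cancel] at h2
  have hR : 0 ≤ ‖x₀ - xs‖ ^ 2 + 6 / μ * (f x₀ - f xs) :=
    add_nonneg (sq_nonneg _) (mul_nonneg (by positivity) (sub_nonneg.2 (hxs _)))
  have hexp : (1 - a.β / 2) ^ N ≤ Real.exp (-(a.p * rate μ a * N)) := by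
    have e1 : a.β / 2 = a.p * rate μ a := by rw [h.β_eq_mul hL hτ]; ring
    have h3 : 1 - a.β / 2 ≤ Real.exp (-(a.p * rate μ a)) := by
      rw [← e1]; linarith [Real.add_one_le_exp (-(a.β / 2))]
    refine (pow_le_pow_left₀ (by linarith) h3 N).trans (le_of_eq ?_)
    rw [← Real.exp_nat_mul]
    congr 1
    ring
  exact h1.trans (h2.trans (add_le_add (mul_le_mul_of_nonneg_right hexp hR)
    (h.stepNoise_le hL hμ hτ σ)))

/-- A level `l ≤ m` costs `2^l B` with probability `2^{-l}`, hence `B` in the mean; truncated levels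
together add at most `B`. Both `m + 1` and `B/τ` are at most `2 log₂ M`. -/
theorem integral_oracleCalls_le (h : IsAdmissible L μ δ τ τ a) (hJ : IsBatchLevels P Zs J)
    (hτ : 1 ≤ τ) (N : ℕ) :
    Integrable (fun ω => (oracleCalls a (fun k => J k ω) N : ℝ)) P ∧
      ∫ ω, (oracleCalls a (fun k => J k ω) N : ℝ) ∂P ≤ 4 * N * τ * Real.logb 2 a.M ^ 2 := by
  obtain ⟨m, hm, hM, hM', hml, hB⟩ := h.exists_level
  let c : ℕ → ℝ := fun l => if (2 : ℝ) ^ l ≤ a.M then 2 ^ l * a.B else a.B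
  have hcM : ∀ l, m < l → c l = a.B := fun l hl =>
    if_neg (not_le.2 (hM'.trans_le (pow_le_pow_right₀ one_le_two hl)))
  have hlev := fun k => hJ.integral_comp k m (h := c) fun l hl => by
    rw [hcM l hl, hcM _ (Nat.lt_succ_self m)]
  have hcalls : ∀ ω, (oracleCalls a (fun k => J k ω) N : ℝ)
      = ∑ k ∈ Finset.range N, c (J k ω) := fun ω => by
    simp only [oracleCalls, c]
    push_cast
    exact Finset.sum_congr rfl fun k _ => by split_ifs <;> rfl
  have hmean : levelMean m c ≤ 4 * τ * Real.logb 2 a.M ^ 2 := by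
    have h1 : levelMean m c = m * a.B + (1 / 2) ^ m * a.B := by
      rw [levelMean, hcM _ (Nat.lt_succ_self m), Finset.sum_congr rfl (g := fun _ => (a.B : ℝ))]
      · simp
      · intro l hl
        simp only [c]
        rw [if_pos ((pow_le_pow_right₀ one_le_two (Finset.mem_range.1 hl)).trans hM),
          ← mul_assoc, ← mul_pow]
        norm_num
    have h2 : (1 / 2 : ℝ) ^ m * a.B ≤ 1 * a.B :=
      mul_le_mul_of_nonneg_right (pow_le_one₀ (by norm_num) (by norm_num)) (by positivity)
    set lg := Real.logb 2 a.M
    have hlg : 1 ≤ lg := h.one_le_logb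
    have hτr : (1 : ℝ) ≤ τ := by exact_mod_cast hτ
    have hBle : (a.B : ℝ) ≤ 2 * (τ * lg) := by
      rw [h.B_eq]
      have h3 := (Nat.ceil_lt_add_one (show 0 ≤ (τ : ℝ) * lg by positivity)).le
      have h4 : 1 ≤ (τ : ℝ) * lg := one_le_mul_of_one_le_of_one_le hτr hlg
      linarith
    have h5 : ((m : ℝ) + 1) * a.B ≤ (2 * lg) * (2 * (τ * lg)) :=
      mul_le_mul (by linarith) hBle (by positivity) (by positivity)
    rw [h1]
    linarith
  simp only [hcalls]
  refine ⟨integrable_finsetSum _ fun k _ => (hlev k).1, ?_⟩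
  rw [integral_finsetSum _ fun k _ => (hlev k).1, Finset.sum_congr rfl fun k _ => (hlev k).2,
    Finset.sum_const, Finset.card_range, nsmul_eq_mul]
  refine (mul_le_mul_of_nonneg_left hmean (by positivity)).trans (le_of_eq ?_)
  ring

end Bounds

/-! ### The choice of the horizon -/

/-- The number of iterations up to a logarithm, in terms of `κ = L / μ`, `s = σ² / (μ² ε)` and
`r = R / ε`. -/
noncomputable def workload (δ κ s r : ℝ) : ℝ := (1 + δ ^ 2) * √κ * Real.log (2 + r) + s

/-- The argument of the logarithmic factors. -/
def logArg (δ κ s r : ℝ) : ℝ := 2 + δ ^ 2 + κ + s + r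

/-- The horizon. -/
noncomputable def horizon (δ κ s r : ℝ) : ℕ :=
  -- `10^6` is generous: the optimization error needs `2 · 1820`, the noise `4716 · 29`.
  ⌈10 ^ 6 * workload δ κ s r * Real.log (logArg δ κ s r)⌉₊

section Horizon

variable {δ κ s r : ℝ}

theorem one_le_log_logArg (hκ : 1 ≤ κ) (hs : 0 ≤ s) (hr : 0 ≤ r) :
    1 ≤ Real.log (logArg δ κ s r) := by
  have h3 : 3 ≤ logArg δ κ s r := by unfold logArg; nlinarith [sq_nonneg δ]
  rw [Real.le_log_iff_exp_le (by linarith)]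
  linarith [Real.exp_one_lt_d9]

theorem half_le_log_two_add (hr : 0 ≤ r) : 1 / 2 ≤ Real.log (2 + r) := by
  have := Real.log_le_log two_pos (show 2 ≤ 2 + r by linarith)
  linarith [Real.log_two_gt_d9]

theorem half_le_workload (hκ : 1 ≤ κ) (hs : 0 ≤ s) (hr : 0 ≤ r) : 1 / 2 ≤ workload δ κ s r := by
  have h1 := half_le_log_two_add hr
  have h2 : 1 ≤ √κ := Real.one_le_sqrt.2 hκ
  have h3 : 1 ≤ (1 + δ ^ 2) * √κ := one_le_mul_of_one_le_of_one_le (by nlinarith [sq_nonneg δ]) h2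
  have h4 : 1 * (1 / 2) ≤ (1 + δ ^ 2) * √κ * Real.log (2 + r) :=
    mul_le_mul h3 h1 (by norm_num) (by positivity)
  unfold workload
  linarith

theorem le_horizon : 10 ^ 6 * workload δ κ s r * Real.log (logArg δ κ s r) ≤ horizon δ κ s r :=
  Nat.le_ceil _

theorem horizon_le (hκ : 1 ≤ κ) (hs : 0 ≤ s) (hr : 0 ≤ r) :
    (horizon δ κ s r : ℝ) ≤ 2 * 10 ^ 6 * workload δ κ s r * Real.log (logArg δ κ s r) := by
  have h1 := one_le_log_logArg (δ := δ) hκ hs hr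
  have h2 := half_le_workload (δ := δ) hκ hs hr
  have h3 : 1 / 2 * 1 ≤ workload δ κ s r * Real.log (logArg δ κ s r) :=
    mul_le_mul h2 h1 (by norm_num) (by linarith)
  have h4 := (Nat.ceil_lt_add_one (show
    0 ≤ 10 ^ 6 * workload δ κ s r * Real.log (logArg δ κ s r) by nlinarith)).le
  unfold horizon
  linarith

/-- A crude polynomial bound suffices: it only serves to make `log N` a multiple of the logarithm of
`logArg`. -/
theorem horizon_le_pow (hκ : 1 ≤ κ) (hs : 0 ≤ s) (hr : 0 ≤ r) :
    (horizon δ κ s r : ℝ) ≤ 4 * 10 ^ 6 * logArg δ κ s r ^ 4 := by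
  set A := logArg δ κ s r with hA
  have hA3 : 3 ≤ A := by rw [hA, logArg]; nlinarith [sq_nonneg δ]
  have hd := sq_nonneg δ
  have h1 : 1 + δ ^ 2 ≤ A := by rw [hA, logArg]; linarith
  have h2 : √κ ≤ A := by
    refine (Real.sqrt_le_left (by linarith)).2 ?_
    have : κ ≤ A := by rw [hA, logArg]; linarith
    nlinarith
  have h3 : Real.log (2 + r) ≤ A := by
    refine (Real.log_le_self (by linarith)).trans ?_
    rw [hA, logArg]; linarith
  have h4 : s ≤ A := by rw [hA, logArg]; linarith
  have h5 : workload δ κ s r ≤ 2 * A ^ 3 := by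
    have e1 : (1 + δ ^ 2) * √κ * Real.log (2 + r) ≤ A * A * A :=
      mul_le_mul (mul_le_mul h1 h2 (Real.sqrt_nonneg _) (by linarith)) h3
        (Real.log_nonneg (by linarith)) (by positivity)
    have e2 : A ≤ A * A * A := by nlinarith [mul_self_nonneg A]
    unfold workload
    nlinarith
  have h6 : Real.log A ≤ A := Real.log_le_self (by linarith)
  have h7 : workload δ κ s r * Real.log A ≤ 2 * A ^ 3 * A :=
    mul_le_mul h5 h6 (Real.log_nonneg (by linarith)) (by positivity)
  have := horizon_le (δ := δ) hκ hs hr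
  rw [← hA] at this
  nlinarith

theorem log_le_of_le_two_pow {x : ℝ} {n : ℕ} (hx : 0 < x) (h : x ≤ 2 ^ n) : Real.log x ≤ n := by
  refine (Real.log_le_log hx h).trans ?_
  rw [Real.log_pow]
  have := Real.log_two_lt_d9
  nlinarith [(Nat.cast_nonneg n : (0 : ℝ) ≤ n)]

/-- The noise term requires `N` to dominate `s log(N r/s)`, with `N` also inside the logarithm.
There `log N ≤ 26 ℓ` and `log r ≤ ℓ`, while `-s log s ≤ 1` for every `s > 0`, so small `s` does no
harm. -/
theorem mul_log_horizon_le (hκ : 1 ≤ κ) (hs : 0 < s) (hr : 0 ≤ r) :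
    4716 * (s * Real.log (max 2 (horizon δ κ s r * r / s))) ≤ horizon δ κ s r := by
  have hl := one_le_log_logArg (δ := δ) hκ hs.le hr
  have hw := half_le_workload (δ := δ) hκ hs.le hr
  have hN := le_horizon (δ := δ) (κ := κ) (s := s) (r := r)
  have hNp := horizon_le_pow (δ := δ) hκ hs.le hr
  have hsw : s ≤ workload δ κ s r := by
    have h1 := half_le_log_two_add hr
    unfold workload
    have : 0 ≤ (1 + δ ^ 2) * √κ * Real.log (2 + r) := by positivity
    linarith
  have hrA : r ≤ logArg δ κ s r := by unfold logArg; nlinarith [sq_nonneg δ]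
  have hA3 : 3 ≤ logArg δ κ s r := by unfold logArg; nlinarith [sq_nonneg δ]
  set ℓ := Real.log (logArg δ κ s r) with hℓ
  set W := workload δ κ s r
  set n := (horizon δ κ s r : ℝ)
  have hWl : 1 / 2 ≤ W * ℓ := by nlinarith
  have hsl : s * ℓ ≤ W * ℓ := mul_le_mul_of_nonneg_right hsw (by linarith)
  have hn0 : 0 < n := by nlinarith
  -- `29 = 26 + 1 + 2`: from `log N`, from `log r`, and from `1 ≤ 2 W ℓ` for the term `-s log s`.
  suffices s * Real.log (max 2 (n * r / s)) ≤ 29 * (W * ℓ) by nlinarith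
  rcases le_total (n * r / s) 2 with hle | hle
  · rw [max_eq_left hle]
    have := Real.log_two_lt_d9
    nlinarith
  · rw [max_eq_right hle]
    have hr0 : 0 < r := by
      rcases hr.eq_or_lt with h0 | h0
      · rw [← h0] at hle; norm_num at hle
      · exact h0
    rw [Real.log_div (by positivity) hs.ne', Real.log_mul hn0.ne' hr0.ne']
    have h1 : Real.log n ≤ 26 * ℓ := by
      refine (Real.log_le_log hn0 hNp).trans ?_
      rw [Real.log_mul (by norm_num) (by positivity), Real.log_pow, ← hℓ]
      have := log_le_of_le_two_pow (x := 4 * 10 ^ 6) (n := 22) (by norm_num) (by norm_num)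
      push_cast at this ⊢
      linarith
    have h2 : Real.log r ≤ ℓ := Real.log_le_log hr0 hrA
    have h3 : -(s * Real.log s) ≤ 1 := by
      have h4 := Real.log_le_sub_one_of_pos (inv_pos.2 hs)
      rw [Real.log_inv] at h4
      have h5 := mul_le_mul_of_nonneg_left h4 hs.le
      rw [mul_sub, mul_inv_cancel₀ hs.ne'] at h5
      linarith
    have h6 : s * (Real.log n + Real.log r) ≤ s * (27 * ℓ) :=
      mul_le_mul_of_nonneg_left (by linarith) hs.le
    nlinarith

end Horizon

/-! ### Error and truncation level at the chosen horizon -/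

/-- Since `2p/β = η`, the quantity `M` is polynomial in `logArg` once `η` is. Explicitly `log M ≤
(40 + 5) ℓ`, and passing to base 2 at most doubles this. -/
theorem logb_M_le {L μ δ κ s r n : ℝ} {τ : ℕ} {a : Params} (h : IsAdmissible L μ δ τ τ a)
    (hL : 0 < L) (hμ : 0 < μ) (hμL : μ ≤ L) (hτ : 1 ≤ τ) (hκ : 1 ≤ κ) (hs : 0 ≤ s) (hr : 0 ≤ r)
    (hn : n ≤ 4 * 10 ^ 6 * logArg δ κ s r ^ 4)
    (hη : a.η ≤ 2 * κ + n) : Real.logb 2 a.M ≤ 90 * Real.log (logArg δ κ s r) := by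
  have hc := h.isCoupled hL hμ hμL hτ
  have hp := hc.p_pos
  have hη0 : 0 < a.η := hp.trans_le hc.p_le_η
  have hl := one_le_log_logArg (δ := δ) hκ hs hr
  have hpA := (h.inv_p_mem hL hτ).2
  have hM2 := h.two_le_M
  have hd := sq_nonneg δ
  have hA3 : 3 ≤ logArg δ κ s r := by unfold logArg; linarith
  have hκA : κ ≤ logArg δ κ s r := by unfold logArg; linarith
  have hδA : 1 + δ ^ 2 ≤ logArg δ κ s r := by unfold logArg; linarith
  set A := logArg δ κ s r with hA
  have hA4 : A ≤ A ^ 4 := le_self_pow₀ (by linarith) (by norm_num)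
  have hA45 : A ^ 4 ≤ A ^ 5 := pow_le_pow_right₀ (by linarith) (by norm_num)
  have hηA : 1 + a.η ≤ 5 * 10 ^ 6 * A ^ 4 := by linarith
  have hηβ : 2 * a.p / a.β = a.η := by
    rw [div_eq_iff hc.β_pos.ne', mul_comm a.η, hc.β_mul_η]
  have hM : a.M ≤ 10 ^ 12 * A ^ 5 := by
    rw [h.M_eq, hηβ]
    refine max_le (by linarith) ?_
    have h1 : a.p⁻¹ * (1 + a.η) ≤ (910 * A) * (5 * 10 ^ 6 * A ^ 4) :=
      mul_le_mul (by linarith) hηA (by positivity) (by positivity)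
    have h2 : C₂ * a.p⁻¹ * (1 + a.η) ≤ 10 ^ 12 * A ^ 5 := by
      rw [mul_assoc, C₂]
      have e1 : (910 * A) * (5 * 10 ^ 6 * A ^ 4) = 4550 * 10 ^ 6 * A ^ 5 := by ring
      rw [e1] at h1
      linarith
    refine (Real.sqrt_le_left (by positivity)).2 (h2.trans ?_)
    exact le_self_pow₀ (by linarith) (by norm_num)
  have hlogM : Real.log a.M ≤ 45 * Real.log A := by
    refine (Real.log_le_log (by linarith) hM).trans ?_
    rw [Real.log_mul (by norm_num) (by positivity), Real.log_pow A 5]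
    have := log_le_of_le_two_pow (x := 10 ^ 12) (n := 40) (by norm_num) (by norm_num)
    push_cast at this ⊢
    linarith
  rw [Real.logb, div_le_iff₀ (Real.log_pos one_lt_two)]
  have := Real.log_two_gt_d9
  nlinarith

theorem exp_mul_le_half {x r : ℝ} (hr : 0 ≤ r) (hx : 2 * Real.log (2 + r) ≤ x) :
    Real.exp (-x) * r ≤ 1 / 2 := by
  have h2 : (0 : ℝ) < 2 + r := by linarith
  have h1 : Real.exp (-x) ≤ ((2 + r) ^ 2)⁻¹ := by
    rw [Real.exp_neg]
    refine inv_anti₀ (by positivity) ?_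
    rw [← Real.log_le_iff_le_exp (by positivity), Real.log_pow]
    exact_mod_cast hx
  refine (mul_le_mul_of_nonneg_right h1 hr).trans ?_
  rw [inv_mul_le_iff₀ (by positivity)]
  nlinarith

/-- Since `(p w N)² = p² μ N² γ/3`, the second entry of the minimum is the stepsize at which `p w N`
equals the logarithm. The alternatives are the two branches of the minimum; the inequality holds in
both. -/
theorem IsHorizonChoice.rate_spec {L μ σ δ R : ℝ} {τ N : ℕ} {a : Params}
    (h : IsHorizonChoice L μ σ δ R τ N a) (hL : 0 < L) (hμ : 0 < μ) (hτ : 1 ≤ τ) (hN : 1 ≤ N) :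
    (rate μ a = (2 * √(L / μ))⁻¹ ∨ σ ≠ 0 ∧
        a.p * rate μ a * N = Real.log (max 2 (μ ^ 2 * N * R / σ ^ 2))) ∧
      (σ ≠ 0 → a.p * rate μ a * N ≤ Real.log (max 2 (μ ^ 2 * N * R / σ ^ 2))) := by
  have hp := h.admissible.p_pos hL hτ
  have hw := rate_pos hμ h.admissible.γ_pos
  have hwsq := rate_sq hμ h.admissible.γ_pos
  have hNr : (0 : ℝ) < N := by exact_mod_cast hN
  have hlog : 0 ≤ Real.log (max 2 (μ ^ 2 * N * R / σ ^ 2)) :=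
    Real.log_nonneg (one_le_two.trans (le_max_left _ _))
  set ℓ := Real.log (max 2 (μ ^ 2 * N * R / σ ^ 2)) with hℓ
  have hX : (a.p * rate μ a * N) ^ 2 = a.p ^ 2 * μ * N ^ 2 / 3 * a.γ := by
    rw [mul_pow, mul_pow, hwsq]; ring
  have hXℓ : a.p ^ 2 * μ * N ^ 2 / 3 * (3 / (a.p ^ 2 * μ * N ^ 2) * ℓ ^ 2) = ℓ ^ 2 := by
    field_simp
  have hfirst : a.γ = 3 / (4 * L) → rate μ a = (2 * √(L / μ))⁻¹ := fun hγ => by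
    rw [rate, hγ, show μ * (3 / (4 * L)) / 3 = (2 ^ 2 * (L / μ))⁻¹ by field_simp; norm_num,
      Real.sqrt_inv, Real.sqrt_mul (by norm_num), Real.sqrt_sq (by norm_num)]
  have hγ := h.γ_eq
  unfold horizonStepsize at hγ
  split_ifs at hγ with hσ
  · exact ⟨Or.inl (hfirst hγ), fun h => absurd hσ h⟩
  · rw [← hℓ] at hγ
    constructor
    · rcases min_choice (3 / (4 * L)) (3 / (a.p ^ 2 * μ * (N : ℝ) ^ 2) * ℓ ^ 2) with hc | hc
      · exact Or.inl (hfirst (hγ.trans hc))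
      · refine Or.inr ⟨hσ, (sq_eq_sq₀ (by positivity) hlog).1 ?_⟩
        rw [hX, hγ.trans hc, hXℓ]
    · intro _
      refine (sq_le_sq₀ (by positivity) hlog).1 ?_
      rw [hX, ← hXℓ]
      exact mul_le_mul_of_nonneg_left (hγ.le.trans (min_le_right _ _)) (by positivity)

/-- The two error terms after the horizon, relative to the target accuracy. -/
theorem relative_error_le {δ κ s r p w ℓ : ℝ} {N : ℕ} (hN : N = horizon δ κ s r) (hκ : 1 ≤ κ)
    (hs : 0 ≤ s) (hr : 0 ≤ r) (hp : 0 < p) (hpδ : p⁻¹ ≤ 910 * (1 + δ ^ 2)) (hw : 0 < w)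
    (hℓ : 0 < s → ℓ = Real.log (max 2 (N * r / s)))
    (hcase : w = (2 * √κ)⁻¹ ∨ 0 < s ∧ p * w * N = ℓ) (hle : 0 < s → p * w * N ≤ ℓ) :
    Real.exp (-(p * w * N)) * r + 2358 * (p * w) * s ≤ 1 := by
  have hl := one_le_log_logArg (δ := δ) hκ hs hr
  have hW := half_le_workload (δ := δ) hκ hs hr
  have hNle : 10 ^ 6 * workload δ κ s r * Real.log (logArg δ κ s r) ≤ N := hN ▸ le_horizon
  have hlr := half_le_log_two_add hr
  have hWN : 10 ^ 6 * workload δ κ s r ≤ N := by nlinarith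
  have hN0 : (0 : ℝ) < N := by linarith
  have hsqrt : 1 ≤ √κ := Real.one_le_sqrt.2 hκ
  have hsW : s ≤ workload δ κ s r := by
    have : 0 ≤ (1 + δ ^ 2) * √κ * Real.log (2 + r) := by positivity
    unfold workload; linarith
  have hfirst : Real.exp (-(p * w * N)) * r ≤ 1 / 2 := by
    rcases hcase with hc | ⟨hs0, hc⟩
    · refine exp_mul_le_half hr ?_
      have h1 : 10 ^ 6 * ((1 + δ ^ 2) * √κ * Real.log (2 + r)) ≤ N := by
        unfold workload at hWN; linarith
      have h2 : 1 ≤ p * (910 * (1 + δ ^ 2)) := by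
        rw [← inv_mul_le_iff₀ hp, mul_one]; exact hpδ
      have h3 : p * w * (10 ^ 6 * ((1 + δ ^ 2) * √κ * Real.log (2 + r))) ≤ p * w * N :=
        mul_le_mul_of_nonneg_left h1 (by positivity)
      refine le_trans ?_ h3
      -- `1820 = 2 · 910`, from `w = 1/(2√κ)` and the lower bound on `p`.
      have e1 : p * w * (10 ^ 6 * ((1 + δ ^ 2) * √κ * Real.log (2 + r)))
          = (p * (910 * (1 + δ ^ 2))) * (10 ^ 6 / 1820) * Real.log (2 + r) := by
        rw [hc]; field_simp; ring
      rw [e1]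
      nlinarith
    -- Here `exp(-p w N)` is the reciprocal of `max(2, N r/s)`, so the relative error is at most
    -- `s/N` when `r > 0`, and `N ≥ 2s`.
    · rw [hc, hℓ hs0, Real.exp_neg, Real.exp_log (by positivity)]
      have h1 : N * r / s ≤ max 2 (N * r / s) := le_max_right _ _
      rw [inv_mul_le_iff₀ (by positivity)]
      have h2 : 2 * s ≤ N := by linarith
      have h3 : 2 * r ≤ N * r / s := by
        rw [le_div_iff₀ hs0]; nlinarith
      linarith
  have hsecond : 2358 * (p * w) * s ≤ 1 / 2 := by
    rcases hs.eq_or_lt with h0 | h0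
    · rw [← h0]; norm_num
    · have h1 := hle h0
      rw [hℓ h0] at h1
      have h2 := mul_log_horizon_le (δ := δ) hκ h0 hr
      rw [← hN] at h2
      have h3 := mul_le_mul_of_nonneg_left h1 h0.le
      have h4 : (4716 * (p * w) * s) * N ≤ 1 * N := by linarith
      have := le_of_mul_le_mul_right h4 hN0
      linarith
  linarith

/-- In the second branch `log 2 ≤ p w N ≤ w N/3`, so `w N ≥ 1`. The 2 inside the maximum thus keeps
the stepsize, and with it `η` and `M`, under control. -/
theorem inv_rate_le {κ p w : ℝ} {N : ℕ} (hκ : 1 ≤ κ) (hp : 0 < p) (hp3 : p ≤ 1 / 3) (hw : 0 < w)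
    {x : ℝ} (hcase : w = (2 * √κ)⁻¹ ∨ p * w * N = Real.log (max 2 x)) : w⁻¹ ≤ 2 * κ + N := by
  have hN : (0 : ℝ) ≤ N := Nat.cast_nonneg N
  rcases hcase with hc | hc
  · rw [hc, inv_inv]
    have : √κ ≤ κ := (Real.sqrt_le_left (by linarith)).2 (by nlinarith)
    linarith
  · have h1 : Real.log 2 ≤ p * w * N :=
      hc ▸ Real.log_le_log two_pos (le_max_left _ _)
    have h2 := Real.log_two_gt_d9
    have h3 : 1 ≤ w * N := by
      have : p * (w * N) ≤ 1 / 3 * (w * N) := mul_le_mul_of_nonneg_right hp3 (by positivity)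
      linarith
    have h4 : w⁻¹ ≤ N := by rwa [inv_le_iff_one_le_mul₀' hw]
    linarith

end MarkovASGD

/-! ### The oracle complexity bound -/

theorem mainTheorem2 :
    ∃ C : ℝ, 0 < C ∧
      ∀ (L μ σ δ R ε : ℝ) (τ : ℕ),
        0 < L → 0 < μ → 0 ≤ σ → 0 ≤ δ → 0 ≤ R → 0 < ε → 1 ≤ τ →
      ∃ N : ℕ, 1 ≤ N ∧
        (∃ a : MarkovASGD.Params, MarkovASGD.IsHorizonChoice L μ σ δ R τ N a) ∧
        ∀ a : MarkovASGD.Params, MarkovASGD.IsHorizonChoice L μ σ δ R τ N a →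
        ∀ (d : ℕ) (Z Ω : Type*) [TopologicalSpace Z] [PolishSpace Z] [MeasurableSpace Z]
          [BorelSpace Z] [MeasurableSpace Ω]
          (Q : ProbabilityTheory.Kernel Z Z) [ProbabilityTheory.IsMarkovKernel Q]
          (π : MeasureTheory.Measure Z) [MeasureTheory.IsProbabilityMeasure π]
          (P : MeasureTheory.Measure Ω) [MeasureTheory.IsProbabilityMeasure P]
          (Zs : ℕ → Ω → Z) (J : ℕ → Ω → ℕ)
          (F : MarkovASGD.Vec d → Z → ℝ) (f : MarkovASGD.Vec d → ℝ)
          (x₀ xs : MarkovASGD.Vec d),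
          0 < d →
          MarkovASGD.IsExpectedRisk π F f →
          MarkovASGD.IsLSmooth L f →
          MarkovASGD.IsStronglyConvex μ f →
          MarkovASGD.IsErgodicNoise Q π τ P Zs →
          MarkovASGD.HasBoundedNoise π F f σ δ →
          MarkovASGD.IsBatchLevels P Zs J →
          (∀ y, f xs ≤ f y) →
          R = ‖x₀ - xs‖ ^ 2 + 6 / μ * (f x₀ - f xs) →
          (MeasureTheory.Integrable (fun ω =>
              ‖(MarkovASGD.run F a x₀ (fun i => Zs i ω) (fun k => J k ω) N).x - xs‖ ^ 2) P ∧
            ∫ ω, ‖(MarkovASGD.run F a x₀ (fun i => Zs i ω) (fun k => J k ω) N).x - xs‖ ^ 2 ∂P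
              ≤ ε) ∧
          (MeasureTheory.Integrable
              (fun ω => (MarkovASGD.oracleCalls a (fun k => J k ω) N : ℝ)) P ∧
            ∫ ω, (MarkovASGD.oracleCalls a (fun k => J k ω) N : ℝ) ∂P
              ≤ C * τ *
                ((1 + δ ^ 2) * √(L / μ) * Real.log (2 + R / ε) + σ ^ 2 / (μ ^ 2 * ε)) *
                Real.log (2 + δ ^ 2 + L / μ + σ ^ 2 / (μ ^ 2 * ε) + R / ε) ^ 3) := by
  refine ⟨10 ^ 12, by norm_num, fun L μ σ δ R ε τ hL hμ hσ _ hR hε hτ => ?_⟩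
  rcases lt_or_ge L μ with hlt | hμL
  -- No problem has `L < μ` in positive dimension, so any horizon serves; the parameters must still
  -- be exhibited.
  · refine ⟨1, le_rfl, MarkovASGD.exists_isHorizonChoice hL hμ le_rfl, ?_⟩
    intro a _ d Z Ω _ _ _ _ _ Q _ π _ P _ Zs J F f x₀ xs hd _ hs hc
    exact absurd (MarkovASGD.le_of_isStronglyConvex_of_isLSmooth hd hs hc) (not_le.2 hlt)
  set κ := L / μ with hκdef
  set s := σ ^ 2 / (μ ^ 2 * ε) with hsdef
  set r := R / ε with hrdef
  have hκ : 1 ≤ κ := (one_le_div hμ).2 hμL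
  have hs0 : 0 ≤ s := by positivity
  have hr0 : 0 ≤ r := by positivity
  obtain ⟨N, hNdef⟩ : ∃ N, N = MarkovASGD.horizon δ κ s r := ⟨_, rfl⟩
  have hl := MarkovASGD.one_le_log_logArg (δ := δ) hκ hs0 hr0
  have hW := MarkovASGD.half_le_workload (δ := δ) hκ hs0 hr0
  have hN1 : 1 ≤ N := by
    have h1 : (10 : ℝ) ^ 6 * MarkovASGD.workload δ κ s r
        * Real.log (MarkovASGD.logArg δ κ s r) ≤ N := hNdef ▸ MarkovASGD.le_horizon
    have h2 : (1 : ℝ) ≤ N := by nlinarith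
    exact_mod_cast h2
  refine ⟨N, hN1, MarkovASGD.exists_isHorizonChoice hL hμ hN1, ?_⟩
  intro a ha d Z Ω _ _ _ _ _ Q _ π _ P _ Zs J F f x₀ xs _ hr hs hc hn hb hJ hxs hReq
  have hadm := ha.admissible
  have hp := hadm.p_pos hL hτ
  have hw := MarkovASGD.rate_pos hμ hadm.γ_pos
  obtain ⟨hcase, hle⟩ := ha.rate_spec hL hμ hτ hN1
  have hσs : 0 < s → σ ≠ 0 := fun h h0 => by
    rw [hsdef, h0] at h; norm_num at h
  refine ⟨?_, ?_⟩
  · obtain ⟨hint, hbound⟩ := MarkovASGD.integral_norm_sq_run_le hL hμ hμL hadm hr hs hc hn hb hJ hτ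
      hxs (x₀ := x₀) N
    refine ⟨hint, hbound.trans ?_⟩
    -- In the relative quantities, `μ²NR/σ²` is `N r/s`.
    have harg : 0 < s → Real.log (max 2 (μ ^ 2 * N * R / σ ^ 2))
        = Real.log (max 2 (N * r / s)) := fun h => by
      have := hσs h
      congr 2
      rw [hsdef, hrdef]
      field_simp
    have hcase' : MarkovASGD.rate μ a = (2 * √κ)⁻¹ ∨ 0 < s ∧
        a.p * MarkovASGD.rate μ a * N = Real.log (max 2 (μ ^ 2 * N * R / σ ^ 2)) := by
      refine hcase.imp_right fun h => ⟨?_, h.2⟩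
      have := h.1
      positivity
    have hrel := MarkovASGD.relative_error_le hNdef hκ hs0 hr0 hp (hadm.inv_p_mem hL hτ).2 hw
      harg hcase' fun h => hle (hσs h)
    have hmul := mul_le_mul_of_nonneg_right hrel hε.le
    rw [one_mul] at hmul
    refine le_trans (le_of_eq ?_) hmul
    rw [← hReq, hsdef, hrdef]
    field_simp
  · obtain ⟨hint, hbound⟩ := MarkovASGD.integral_oracleCalls_le hadm hJ hτ N
    refine ⟨hint, hbound.trans ?_⟩
    have hη : a.η ≤ 2 * κ + N := by
      rw [hadm.η_eq_inv]
      exact MarkovASGD.inv_rate_le hκ hp (hadm.p_le hL hτ) hw (hcase.imp_right And.right)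
    have hM := MarkovASGD.logb_M_le hadm hL hμ hμL hτ hκ hs0 hr0
      (hNdef ▸ MarkovASGD.horizon_le_pow (δ := δ) hκ hs0 hr0) hη
    have hlog := hadm.one_le_logb
    have hNle : (N : ℝ) ≤ 2 * 10 ^ 6 * MarkovASGD.workload δ κ s r
        * Real.log (MarkovASGD.logArg δ κ s r) := hNdef ▸ MarkovASGD.horizon_le hκ hs0 hr0
    change _ ≤ 10 ^ 12 * τ * MarkovASGD.workload δ κ s r
      * Real.log (MarkovASGD.logArg δ κ s r) ^ 3
    set ℓ := Real.log (MarkovASGD.logArg δ κ s r)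
    set W := MarkovASGD.workload δ κ s r
    have hsq : Real.logb 2 a.M ^ 2 ≤ (90 * ℓ) ^ 2 := pow_le_pow_left₀ (by linarith) hM 2
    have hW0 : 0 ≤ W := by linarith
    have hℓ0 : 0 ≤ ℓ := by linarith
    calc 4 * N * τ * Real.logb 2 a.M ^ 2
        ≤ 4 * (2 * 10 ^ 6 * W * ℓ) * τ * (90 * ℓ) ^ 2 := by gcongr
      -- `4 · 2 · 10^6 · 90²`. One logarithm comes from `N`, two from `log₂² M`.
      _ = 64800000000 * (τ * W * ℓ ^ 3) := by ring
      _ ≤ 10 ^ 12 * (τ * W * ℓ ^ 3) := by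
        refine mul_le_mul_of_nonneg_right (by norm_num) (by positivity)
      _ = 10 ^ 12 * τ * W * ℓ ^ 3 := by ring
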